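/- Let $d,N\ge 1$, let $A,B\in\mathbb{C}^{N,N}$ and $S\in\mathbb{R}^{d,d}$ be such that $A$ and $B$ are simultaneously diagonalizable, i.e. there is an invertible $Y\in\mathbb{C}^{N,N}$ for which $Y^{-1}AY$ and $Y^{-1}BY$ are diagonal, $\operatorname{Re}\sigma(A)>0$, and $S$ is skew-symmetric. With the spectral radius $\rho(C)=\max_{z\in\sigma(C)}|z|$ and the spectral abscissa $s(C)=\max_{z\in\sigma(C)}\operatorname{Re}z$ put $$a_{\min}=\rho(A^{-1})^{-1},\quad a_{\max}=\rho(A),\quad a_0=-s(-A),\quad b_0=-s(-B),\quad a_1=\frac{a_{\max}^2}{a_{\min}a_0},\quad \kappa=|Y||Y^{-1}|,$$ where $|\cdot|$ is the spectral norm. Let $1\le p<\infty$ and let $\theta\in C(\mathbb{R}^d,\mathbb{R})$ be a radial weight function of exponential growth rate $\eta\ge 0$, i.e. $\theta>0$, $\theta(x)$ depends only on $|x|$, and there is $C_\theta>0$ with $\theta(x+y)\le C_\theta\,\theta(x)e^{\eta|y|}$ for all $x,y\in\mathbb{R}^d$. Assume moreover that $$\lim_{|\psi|\to 0}\ \sup_{x\in\mathbb{R}^d}\left|\frac{\theta(x+\psi)-\theta(x)}{\theta(x)}\right|=0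 .$$ Let $L^p_\theta=\{v\in L^1_{\mathrm{loc}}(\mathbb{R}^d,\mathbb{C}^N)\mid \theta v\in L^p(\mathbb{R}^d,\mathbb{C}^N)\}$ with norm $\|v\|_{L^p_\theta}=\|\theta v\|_{L^p}$. With the kernel $$H(x,\xi,t)=(4\pi tA)^{-d/2}\exp\left(-Bt-(4tA)^{-1}|e^{tS}x-\xi|^2\right),\qquad x,\xi\in\mathbb{R}^d,\ t>0$$ (principal branch of the matrix power), let $[T(t)v](x)=\int_{\mathbb{R}^d}H(x,\xi,t)v(\xi)\,d\xi$ for $t>0$ and $T(0)v=v$. Then these integrals converge absolutely for every $v\in L^p_\theta$, and $T(t)$ maps $L^p_\theta$ into itself. Let $A_{p,\theta}$ be the infinitesimal generator of $(T(t))_{t\ge 0}$ in $L^p_\theta$, i.e. $A_{p,\theta}v=\lim_{t\downarrow 0}\frac1t(T(t)v-v)$ on the domain $\mathcal{D}(A_{p,\theta})$ of all $v\in L^p_\theta$ for which this limit exists in $L^p_\theta$. Let $\varepsilon>0$, $\nu=a_{\max}^2\eta^2p^2/a_0$ and $$\omega_{p,\theta}=-b_0+(1+\varepsilon)\frac{a_{\max}^2\eta^2p}{a_0},\qquad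 M_{p,\theta}=C_\theta\,\kappa\,a_1^{d/2}\,C_*,$$ where $C_*>0$ is any constant, depending only on $d,A,\eta,p,\varepsilon$, such that $$\left[{}_1F_1\left(\tfrac d2;\tfrac12;\nu t\right)+2\,\frac{\Gamma(\frac{d+1}{2})}{\Gamma(\frac d2)}(\nu t)^{1/2}\,{}_1F_1\left(\tfrac{d+1}{2};\tfrac32;\nu t\right)\right]^{1/p}\le C_*\,e^{(1+\varepsilon)\frac{\nu}{p}t}\qquad\text{for all }t\ge 0;$$ such constants exist. Here ${}_1F_1$ denotes Kummer's confluent hypergeometric function. Let $\lambda\in\mathbb{C}$ with $\operatorname{Re}\lambda>\omega_{p,\theta}$. Then $\lambda$ belongs to the resolvent set of $A_{p,\theta}$, i.e. $\lambda I-A_{p,\theta}:\mathcal{D}(A_{p,\theta})\to L^p_\theta$ is bijective, with inverse $R(\lambda,A_{p,\theta})$. That is, for every $g\in L^p_\theta$ the resolvent equation $(\lambda I-A_{p,\theta})v=g$ has a unique solution $v_\star\in\mathcal{D}(A_{p,\theta})$. It is given by $$v_\star=R(\lambda,A_{p,\theta})g=\int_0^\infty e^{-\lambda t}T(t)g\,dt=\int_0^\infty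 e^{-\lambda t}\int_{\mathbb{R}^d}H(\cdot,\xi,t)g(\xi)\,d\xi\,dt,$$ where the first integral converges absolutely in $L^p_\theta$ and the second one holds, with absolute convergence of the integral in $t$, at almost every point of $\mathbb{R}^d$. Moreover, $$\|v_\star\|_{L^p_\theta}\le\frac{M_{p,\theta}}{\operatorname{Re}\lambda-\omega_{p,\theta}}\,\|g\|_{L^p_\theta}.$$ -/

import Mathlib

open MeasureTheory Filter Topology
open scoped ENNReal

namespace OrnsteinUhlenbeck

/-- `ℝ^d` with the Euclidean norm. -/
abbrev RSpace (d : ℕ) : Type := EuclideanSpace ℝ (Fin d)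

/-- `ℂ^N` with the Euclidean norm. -/
abbrev CSpace (N : ℕ) : Type := EuclideanSpace ℂ (Fin N)

section MatrixConstants

variable {N : ℕ}

/-- The spectral abscissa `s(C) = max {Re z | z ∈ σ(C)}` (a maximum over a finite set). -/
noncomputable def spectralAbscissa (C : Matrix (Fin N) (Fin N) ℂ) : ℝ :=
  sSup (Complex.re '' spectrum ℂ C)

/-- `a_min = (ρ(A⁻¹))⁻¹`. -/
noncomputable def aMin (A : Matrix (Fin N) (Fin N) ℂ) : ℝ :=
  ((spectralRadius ℂ A⁻¹).toReal)⁻¹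

/-- `a_max = ρ(A)`. -/
noncomputable def aMax (A : Matrix (Fin N) (Fin N) ℂ) : ℝ :=
  (spectralRadius ℂ A).toReal

/-- `a_0 = -s(-A)`, and also `b_0 = -s(-B)`: the smallest real part of an eigenvalue. -/
noncomputable def lowerAbscissa (C : Matrix (Fin N) (Fin N) ℂ) : ℝ :=
  -spectralAbscissa (-C)

/-- The spectral (Euclidean operator) norm of a matrix. -/
noncomputable def specNorm (C : Matrix (Fin N) (Fin N) ℂ) : ℝ :=
  ‖Matrix.toEuclideanCLM (n := Fin N) (𝕜 := ℂ) C‖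

/-- The condition number `cond(Y) = |Y| |Y⁻¹|` in the spectral norm. -/
noncomputable def condNumber (Y : Matrix (Fin N) (Fin N) ℂ) : ℝ :=
  specNorm Y * specNorm Y⁻¹

/-- `a_1 = a_max² / (a_min a_0)`. -/
noncomputable def aOne (A : Matrix (Fin N) (Fin N) ℂ) : ℝ :=
  aMax A ^ 2 / (aMin A * lowerAbscissa A)

/-- `ν = a_max² η² p² / a_0`. -/
noncomputable def nuConst (A : Matrix (Fin N) (Fin N) ℂ) (η : ℝ) (p : ℝ≥0∞) : ℝ :=
  aMax A ^ 2 * η ^ 2 * p.toReal ^ 2 / lowerAbscissa A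

/-- `ω_{p,θ} = -b_0 + (1 + ε) a_max² η² p / a_0`. -/
noncomputable def omegaConst (A B : Matrix (Fin N) (Fin N) ℂ) (η : ℝ) (p : ℝ≥0∞) (ε : ℝ) : ℝ :=
  -lowerAbscissa B + (1 + ε) * (aMax A ^ 2 * η ^ 2 * p.toReal / lowerAbscissa A)

/-- Kummer's confluent hypergeometric function `₁F₁(a; b; z) = ∑ (a)_n / (b)_n * z^n / n!`. -/
noncomputable def kummer (a b z : ℝ) : ℝ :=
  ∑' n : ℕ, (ascPochhammer ℝ n).eval a / (ascPochhammer ℝ n).eval b * (z ^ n / (n.factorial : ℝ))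

/-- `₁F₁(d/2; 1/2; s) + 2 Γ((d+1)/2) / Γ(d/2) * s^(1/2) * ₁F₁((d+1)/2; 3/2; s)`. -/
noncomputable def kummerBracket (d : ℕ) (s : ℝ) : ℝ :=
  kummer ((d : ℝ) / 2) (1 / 2) s
    + 2 * (Real.Gamma (((d : ℝ) + 1) / 2) / Real.Gamma ((d : ℝ) / 2)) * Real.sqrt s
      * kummer (((d : ℝ) + 1) / 2) (3 / 2) s

/-- `C` is admissible as the constant `C_*(d, A, η, p, ε)`: it is positive and
`[₁F₁(d/2; 1/2; νt) + ...]^(1/p) ≤ C exp((1 + ε) (ν / p) t)` for all `t ≥ 0`. -/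
def IsAdmissibleConst (d : ℕ) (A : Matrix (Fin N) (Fin N) ℂ) (η : ℝ) (p : ℝ≥0∞) (ε C : ℝ) :
    Prop :=
  0 < C ∧ ∀ t : ℝ, 0 ≤ t →
    kummerBracket d (nuConst A η p * t) ^ (1 / p.toReal)
      ≤ C * Real.exp ((1 + ε) * (nuConst A η p / p.toReal) * t)

/-- `M_{p,θ} = C_θ κ a_1^(d/2) C_*` with `κ = cond(Y)`. -/
noncomputable def MConst (d : ℕ) (A Y : Matrix (Fin N) (Fin N) ℂ) (Cθ Cstar : ℝ) : ℝ :=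
  Cθ * condNumber Y * aOne A ^ ((d : ℝ) / 2) * Cstar

end MatrixConstants

section Weights

variable {d : ℕ}

/-- `θ` is a radial weight function of exponential growth rate `η`, with `C` as the constant in
the growth condition. -/
structure IsRadialWeight (θ : RSpace d → ℝ) (η C : ℝ) : Prop where
  continuous : Continuous θ
  eta_nonneg : 0 ≤ η
  pos : ∀ x, 0 < θ x
  const_pos : 0 < C
  growth : ∀ x y, θ (x + y) ≤ C * θ x * Real.exp (η * ‖y‖)
  radial : ∃ φ : ℝ → ℝ, ∀ x, θ x = φ ‖x‖

/-- `lim_{ψ → 0} sup_x |(θ(x + ψ) - θ(x)) / θ(x)| = 0`. -/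
def TranslationContinuous (θ : RSpace d → ℝ) : Prop :=
  Tendsto (fun ψ : RSpace d => ⨆ x : RSpace d, ENNReal.ofReal |(θ (x + ψ) - θ x) / θ x|)
    (𝓝 0) (𝓝 0)

/-- The measure `θ(x)^p dx`. -/
noncomputable def weightedMeasure (θ : RSpace d → ℝ) (p : ℝ≥0∞) : Measure (RSpace d) :=
  (volume : Measure (RSpace d)).withDensity (fun x => ENNReal.ofReal (θ x) ^ p.toReal)

/-- The exponentially weighted space `L^p_θ(ℝ^d, ℂ^N)`, realised as the `L^p` space of the measure
`θ(x)^p dx`. The two lemmas below show that its norm is `‖θ v‖_{L^p}`, and that its elements are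
the locally integrable `v` with `‖θ v‖_{L^p} < ∞` (modulo equality almost everywhere). -/
abbrev LpTheta (N : ℕ) (θ : RSpace d → ℝ) (p : ℝ≥0∞) : Type :=
  Lp (CSpace N) p (weightedMeasure θ p)

theorem eLpNorm_weightedMeasure {N : ℕ} {θ : RSpace d → ℝ} (hθ : Continuous θ)
    (hpos : ∀ x, 0 < θ x) {p : ℝ≥0∞} (hp0 : p ≠ 0) (hp : p ≠ ∞) (v : RSpace d → CSpace N) :
    eLpNorm v p (weightedMeasure θ p) = eLpNorm (fun x => θ x • v x) p volume := by
  rw [eLpNorm_eq_lintegral_rpow_enorm_toReal hp0 hp, eLpNorm_eq_lintegral_rpow_enorm_toReal hp0 hp,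
    weightedMeasure, lintegral_withDensity_eq_lintegral_mul_non_measurable]
  · congr 2
    ext x
    simp only [Pi.mul_apply, enorm_smul]
    rw [ENNReal.mul_rpow_of_nonneg _ _ ENNReal.toReal_nonneg,
      Real.enorm_eq_ofReal (hpos x).le]
  · exact (hθ.measurable.ennreal_ofReal).pow_const _
  · exact Eventually.of_forall fun x =>
      ENNReal.rpow_lt_top_of_nonneg ENNReal.toReal_nonneg ENNReal.ofReal_ne_top

theorem ae_weightedMeasure {θ : RSpace d → ℝ} (hθ : Continuous θ)
    (hpos : ∀ x, 0 < θ x) (p : ℝ≥0∞) :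
    ae (weightedMeasure θ p) = ae (volume : Measure (RSpace d)) := by
  have hm : Measurable fun x => ENNReal.ofReal (θ x) ^ p.toReal :=
    (hθ.measurable.ennreal_ofReal).pow_const _
  apply le_antisymm
  · exact (withDensity_absolutelyContinuous _ _).ae_le
  · refine (withDensity_absolutelyContinuous' hm.aemeasurable ?_).ae_le
    refine Eventually.of_forall fun x => ?_
    have := hpos x
    exact (ENNReal.rpow_pos (by simpa using this) ENNReal.ofReal_ne_top).ne'

theorem memLp_weightedMeasure_iff {N : ℕ} {θ : RSpace d → ℝ} (hθ : Continuous θ)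
    (hpos : ∀ x, 0 < θ x) {p : ℝ≥0∞} (hp1 : 1 ≤ p) (hp : p ≠ ∞) (v : RSpace d → CSpace N) :
    MemLp v p (weightedMeasure θ p) ↔
      LocallyIntegrable v volume ∧ eLpNorm (fun x => θ x • v x) p volume < ∞ := by
  have hp0 : p ≠ 0 := (zero_lt_one.trans_le hp1).ne'
  have hac : (volume : Measure (RSpace d)) ≪ weightedMeasure θ p := by
    rw [← Measure.ae_le_iff_absolutelyContinuous, ae_weightedMeasure hθ hpos p]
  constructor
  · rintro ⟨hv, hn⟩
    rw [eLpNorm_weightedMeasure hθ hpos hp0 hp] at hn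
    have hv' : AEStronglyMeasurable v volume := hv.mono_ac hac
    refine ⟨?_, hn⟩
    have h1 : MemLp (fun x => θ x • v x) p (volume : Measure (RSpace d)) :=
      ⟨hθ.aestronglyMeasurable.smul hv', hn⟩
    have h2 : LocallyIntegrable (fun x => θ x • v x) (volume : Measure (RSpace d)) :=
      h1.locallyIntegrable hp1
    have hc : Continuous fun x => (θ x)⁻¹ := hθ.inv₀ fun x => (hpos x).ne'
    rw [locallyIntegrable_iff] at h2 ⊢
    intro K hK
    have h3 := (h2 K hK).continuousOn_smul hc.continuousOn hK
    refine h3.congr (Eventually.of_forall fun x => ?_)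
    simp [smul_smul, inv_mul_cancel₀ (hpos x).ne']
  · rintro ⟨hv, hn⟩
    refine ⟨hv.aestronglyMeasurable.mono_ac (withDensity_absolutelyContinuous _ _), ?_⟩
    rw [eLpNorm_weightedMeasure hθ hpos hp0 hp]
    exact hn

end Weights

section Kernel

variable {N d : ℕ}

/-- The matrix function `f(M)` of a diagonalizable matrix `M`, i.e. `q(M)` for the polynomial `q`
that interpolates `f` on the set of eigenvalues of `M`. -/
noncomputable def matrixFun (f : ℂ → ℂ) (M : Matrix (Fin N) (Fin N) ℂ) :
    Matrix (Fin N) (Fin N) ℂ :=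
  Polynomial.aeval M (Lagrange.interpolate M.charpoly.roots.toFinset id f)

/-- `f(Y diag(μ) Y⁻¹) = Y diag(f(μ)) Y⁻¹`. -/
theorem matrixFun_conj_diagonal (f : ℂ → ℂ) (Y : (Matrix (Fin N) (Fin N) ℂ)ˣ) (μ : Fin N → ℂ) :
    matrixFun f (Y.val * Matrix.diagonal μ * Y⁻¹.val)
      = Y.val * Matrix.diagonal (fun k => f (μ k)) * Y⁻¹.val := by
  have hch : (Y.val * Matrix.diagonal μ * Y⁻¹.val).charpoly
      = ∏ i, (Polynomial.X - Polynomial.C (μ i)) := by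
    rw [← Matrix.charpoly_diagonal]
    simp
  have hroot : ∀ i, μ i ∈ (Y.val * Matrix.diagonal μ * Y⁻¹.val).charpoly.roots.toFinset := by
    intro i
    rw [hch, Multiset.mem_toFinset, Polynomial.mem_roots
      (Finset.prod_ne_zero_iff.2 fun j _ => Polynomial.X_sub_C_ne_zero (μ j)),
      Polynomial.IsRoot, Polynomial.eval_prod]
    exact Finset.prod_eq_zero (Finset.mem_univ i) (by simp)
  have key : ∀ q : Polynomial ℂ, Polynomial.aeval (Y.val * Matrix.diagonal μ * Y⁻¹.val) q
      = Y.val * Matrix.diagonal (fun k => q.eval (μ k)) * Y⁻¹.val := by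
    intro q
    induction q using Polynomial.induction_on' with
    | add p q hp hq =>
      have : (Matrix.diagonal fun k => (p + q).eval (μ k))
          = Matrix.diagonal (fun k => p.eval (μ k)) + Matrix.diagonal (fun k => q.eval (μ k)) := by
        rw [Matrix.diagonal_add]; simp
      rw [map_add, hp, hq, this, mul_add, add_mul]
    | monomial n a =>
      have : (Matrix.diagonal fun k => (Polynomial.monomial n a).eval (μ k))
          = a • (Matrix.diagonal μ) ^ n := by
        rw [Matrix.diagonal_pow, ← Matrix.diagonal_smul]
        congr 1
        ext k
        simp
      rw [Polynomial.aeval_monomial, this, Units.conj_pow, ← Algebra.smul_def]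
      simp
  rw [matrixFun, key]
  congr 3
  ext k
  exact Lagrange.eval_interpolate_at_node (v := id) f (Set.injOn_id _) (hroot k)

/-- The rotation `e^{tS} x`. -/
noncomputable def rotation (S : Matrix (Fin d) (Fin d) ℝ) (t : ℝ) (x : RSpace d) : RSpace d :=
  Matrix.toEuclideanCLM (n := Fin d) (𝕜 := ℝ) (NormedSpace.exp (t • S)) x

/-- The heat kernel matrix
`H(x, ξ, t) = (4 π t A)^(-d/2) exp(-B t - (4 t A)⁻¹ |e^{tS} x - ξ|²)`
(with the principal branch of the power). -/
noncomputable def heatKernel (A B : Matrix (Fin N) (Fin N) ℂ) (S : Matrix (Fin d) (Fin d) ℝ)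
    (x ξ : RSpace d) (t : ℝ) : Matrix (Fin N) (Fin N) ℂ :=
  matrixFun (fun z => z ^ (-(d : ℂ) / 2)) (((4 * Real.pi * t : ℝ) : ℂ) • A)
    * NormedSpace.exp (-((t : ℂ) • B)
        - ((‖rotation S t x - ξ‖ ^ 2 : ℝ) : ℂ) • (((4 * t : ℝ) : ℂ) • A)⁻¹)

/-- `H(x, ξ, t) v(ξ)`. -/
noncomputable def kernelApply (A B : Matrix (Fin N) (Fin N) ℂ) (S : Matrix (Fin d) (Fin d) ℝ)
    (t : ℝ) (v : RSpace d → CSpace N) (x ξ : RSpace d) : CSpace N :=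
  Matrix.toEuclideanCLM (n := Fin N) (𝕜 := ℂ) (heatKernel A B S x ξ t) (v ξ)

/-- The function `T(t)v`: `∫ H(x, ξ, t) v(ξ) dξ` for `t > 0` and `v(x)` for `t = 0`. -/
noncomputable def semigroupFun (A B : Matrix (Fin N) (Fin N) ℂ) (S : Matrix (Fin d) (Fin d) ℝ)
    (t : ℝ) (v : RSpace d → CSpace N) (x : RSpace d) : CSpace N :=
  if 0 < t then ∫ ξ, kernelApply A B S t v x ξ else v x

open Classical in
/-- `T(t)` as a map on `L^p_θ`. The theorem asserts in particular that the second case, where the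
function `T(t)v` does not belong to `L^p_θ`, does not occur for `t ≥ 0`. -/
noncomputable def semigroup (A B : Matrix (Fin N) (Fin N) ℂ) (S : Matrix (Fin d) (Fin d) ℝ)
    (θ : RSpace d → ℝ) (p : ℝ≥0∞) (t : ℝ) (v : LpTheta N θ p) : LpTheta N θ p :=
  if h : MemLp (semigroupFun A B S t v) p (weightedMeasure θ p) then h.toLp else 0

end Kernel

section Generator

variable {X : Type*} [NormedAddCommGroup X] [NormedSpace ℂ X]

/-- The difference quotient `(T(t)v - v) / t`. -/
noncomputable def diffQuot (T : ℝ → X → X) (v : X) (t : ℝ) : X :=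
  ((t : ℂ)⁻¹) • (T t v - v)

/-- The domain of the infinitesimal generator of the family `T`: those `v` for which
`lim_{t ↓ 0} (T(t)v - v) / t` exists in `X`. -/
def generatorDomain (T : ℝ → X → X) : Set X :=
  {v | ∃ w, Tendsto (diffQuot T v) (𝓝[>] 0) (𝓝 w)}

/-- The infinitesimal generator `v ↦ lim_{t ↓ 0} (T(t)v - v) / t`, to be used on
`generatorDomain T`. -/
noncomputable def generator (T : ℝ → X → X) (v : X) : X :=
  limUnder (𝓝[>] 0) (diffQuot T v)

/-- The operator `lam I - G`, where `G` is the generator of `T`. -/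
noncomputable def shiftedGenerator (T : ℝ → X → X) (lam : ℂ) (v : X) : X :=
  lam • v - generator T v

/-- The resolvent set of the generator `G` of `T`: those `lam` for which `lam I - G` is a bijection
from the domain of `G` onto `X`. -/
def generatorResolventSet (T : ℝ → X → X) : Set ℂ :=
  {lam | Set.BijOn (shiftedGenerator T lam) (generatorDomain T) Set.univ}

/-- The resolvent `R(lam, G) = (lam I - G)⁻¹`, to be used for `lam` in the resolvent set. -/
noncomputable def generatorResolvent (T : ℝ → X → X) (lam : ℂ) (g : X) : X :=
  Function.invFunOn (shiftedGenerator T lam) (generatorDomain T) g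

end Generator

end OrnsteinUhlenbeck

/-! The family `T(t)` is a strongly continuous semigroup with `‖T(t)‖ ≤ M exp(ω t)`. For such a
semigroup the Laplace transform of the orbits inverts `lam - G` for the generator `G` as soon as `Re
lam > ω`. The abstract half is the classical argument: `orbitLaplace_shift` and the fundamental
theorem of calculus give a right inverse, and commutation with `T(h)` makes it a left inverse.
Integrating the exponential bound yields the factor `M / (Re lam - ω)`.

The analytic half rests on diagonalization. With `A = U diag(α) U⁻¹` and `B = U diag(β) U⁻¹` the
heat kernel is `U diag(scalar kernels) U⁻¹`, so `T(t)` splits into scalar complex Gaussian operators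
acting on the ranges of the spectral projections. Since `Re (1/α_k) ≥ a_0 / a_max²` and `|α_k| ≥
a_min`, each scalar kernel is at most `a_1^(d/2) exp(-b_0 t)` times a real Gaussian density of time
`(a_max² / a_0) t` (`norm_scalarKernel_le`), and conjugation by `U` costs the factor `κ`. The
rotation leaves a radial weight unchanged, and moving the weight from `x` to `ξ` costs `C_θ exp(η
|y|)` with `y = e^{tS}x - ξ`. Young's inequality then bounds the operator norm by the `p`-th root of
a Gaussian moment of `exp(ηp|y|)`; `integral_exp_mul_gaussDensity` identifies that moment with the
Kummer bracket at `νt`, which is where `C_*` enters.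

The semigroup law is the Chapman–Kolmogorov identity for complex Gaussians
(`integral_scalarKernel_mul`), combined with the fact that rotations are isometries. Strong
continuity holds on continuous compactly supported functions by parabolic rescaling and dominated
convergence, and extends by density and the uniform bound on `(0, 1]`. The pointwise formula for the
resolvent follows by testing the Bochner integral on sets of finite measure (`ae_integral_Lp_eq`).
-/

namespace OrnsteinUhlenbeck

/-! ### Semigroup theory: the resolvent as a Laplace transform. -/

section AbstractSemigroup

variable {X : Type*} [NormedAddCommGroup X] [NormedSpace ℂ X]

/-- `T` is a strongly continuous semigroup of bounded linear operators with
`‖T(t)‖ ≤ M exp(ω t)`. -/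
structure IsBoundedC0Semigroup (T : ℝ → X → X) (M ω : ℝ) : Prop where
  zero : ∀ v, T 0 v = v
  add_time : ∀ s t v, 0 ≤ s → 0 ≤ t → T (s + t) v = T s (T t v)
  map_add : ∀ t u v, 0 ≤ t → T t (u + v) = T t u + T t v
  map_smul : ∀ t (c : ℂ) v, 0 ≤ t → T t (c • v) = c • T t v
  bound : ∀ t v, 0 ≤ t → ‖T t v‖ ≤ M * Real.exp (ω * t) * ‖v‖
  tendsto_zero : ∀ v, Tendsto (fun t => T t v) (𝓝[>] 0) (𝓝 v)

/-- The Laplace transform of the orbit `t ↦ T(t)g`. -/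
noncomputable def orbitLaplace (T : ℝ → X → X) (lam : ℂ) (g : X) : X :=
  ∫ t in Set.Ioi (0 : ℝ), Complex.exp (-lam * t) • T t g

namespace IsBoundedC0Semigroup

variable {T : ℝ → X → X} {M ω : ℝ} (hT : IsBoundedC0Semigroup T M ω)
include hT

/-- The operator `T(t)` as a bounded linear map. -/
noncomputable def toCLM {t : ℝ} (ht : 0 ≤ t) : X →L[ℂ] X :=
  LinearMap.mkContinuous
    { toFun := T t
      map_add' := fun u v => hT.map_add t u v ht
      map_smul' := fun c v => hT.map_smul t c v ht } (M * Real.exp (ω * t))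
    (fun v => hT.bound t v ht)

theorem toCLM_apply {t : ℝ} (ht : 0 ≤ t) (v : X) : hT.toCLM ht v = T t v := rfl

theorem map_sub {t : ℝ} (ht : 0 ≤ t) (u v : X) : T t (u - v) = T t u - T t v := by
  simpa [toCLM_apply] using _root_.map_sub (hT.toCLM ht) u v

/-- Including the time `0` allows composition with `t ↦ |t - t₀|`, which vanishes at `t₀`. -/
theorem tendsto_zero_right (v : X) : Tendsto (fun t => T t v) (𝓝[≥] 0) (𝓝 v) := by
  rw [← Set.Ioi_union_left, nhdsWithin_union, tendsto_sup]
  refine ⟨hT.tendsto_zero v, ?_⟩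
  rw [nhdsWithin_singleton]
  exact tendsto_pure_left.2 fun s hs => by rw [hT.zero]; exact mem_of_mem_nhds hs

/-- Neither `M` nor `ω` has a prescribed sign; the absolute values give a bound uniform on `[0, K]`.
-/
theorem bound_abs {t : ℝ} (ht : 0 ≤ t) {K : ℝ} (htK : t ≤ K) (v : X) :
    ‖T t v‖ ≤ |M| * Real.exp (|ω| * K) * ‖v‖ := by
  refine (hT.bound t v ht).trans ?_
  gcongr
  · exact le_abs_self M
  · exact le_abs_self ω

/-- Factoring out the operator at the smaller of the two times leaves `T |t - t₀| v - v`, which is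
small by continuity at `0`, under an operator that is bounded uniformly for `t < t₀ + 1`. This
treats both sides of `t₀` at once. -/
theorem continuousOn (v : X) : ContinuousOn (fun t => T t v) (Set.Ici 0) := by
  intro t₀ ht₀
  have ht₀' : (0 : ℝ) ≤ t₀ := ht₀
  have h1 : Tendsto (fun t : ℝ => |M| * Real.exp (|ω| * (t₀ + 1)) * ‖T |t - t₀| v - v‖)
      (𝓝[≥] t₀ ⊔ 𝓝[Set.Ici 0] t₀) (𝓝 0) := by
    have : Tendsto (fun t : ℝ => |t - t₀|) (𝓝 t₀) (𝓝[≥] 0) := by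
      apply tendsto_nhdsWithin_of_tendsto_nhds_of_eventually_within
      · have : Continuous fun t : ℝ => |t - t₀| := by fun_prop
        simpa using this.tendsto t₀
      · exact Eventually.of_forall fun t => Set.mem_Ici.2 (abs_nonneg _)
    have h2 := ((hT.tendsto_zero_right v).comp this).sub_const v
    have h3 := (h2.norm).const_mul (|M| * Real.exp (|ω| * (t₀ + 1)))
    simp only [sub_self, norm_zero, mul_zero] at h3
    refine h3.mono_left (sup_le nhdsWithin_le_nhds nhdsWithin_le_nhds)
  have h1' := h1.mono_left (le_sup_right)
  refine tendsto_iff_norm_sub_tendsto_zero.2 (squeeze_zero' (Eventually.of_forall fun _ =>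
    norm_nonneg _) ?_ h1')
  have hlt : ∀ᶠ t in 𝓝[Set.Ici 0] t₀, t < t₀ + 1 :=
    nhdsWithin_le_nhds (Iio_mem_nhds (by linarith))
  filter_upwards [hlt, self_mem_nhdsWithin] with t ht ht0
  have ht0' : (0 : ℝ) ≤ t := ht0
  rcases le_total t₀ t with h | h
  · have e : T t v - T t₀ v = T t₀ (T |t - t₀| v - v) := by
      rw [hT.map_sub ht₀', ← hT.add_time _ _ _ ht₀' (abs_nonneg _),
        abs_of_nonneg (sub_nonneg.2 h)]
      congr 2; ring
    rw [e]
    exact hT.bound_abs ht₀' (by linarith) _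
  · have e : T t₀ v - T t v = T t (T |t - t₀| v - v) := by
      rw [hT.map_sub ht0', ← hT.add_time _ _ _ ht0' (abs_nonneg _), abs_sub_comm,
        abs_of_nonneg (sub_nonneg.2 h)]
      congr 2; ring
    rw [norm_sub_rev, e]
    exact hT.bound_abs ht0' (by linarith) _

theorem norm_exp_smul_le (lam : ℂ) (g : X) {t : ℝ} (ht : 0 ≤ t) :
    ‖Complex.exp (-lam * t) • T t g‖ ≤ M * ‖g‖ * Real.exp (-(lam.re - ω) * t) := by
  rw [norm_smul, Complex.norm_exp]
  have : (-lam * (t : ℂ)).re = -lam.re * t := by simp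
  rw [this]
  calc Real.exp (-lam.re * t) * ‖T t g‖
      ≤ Real.exp (-lam.re * t) * (M * Real.exp (ω * t) * ‖g‖) := by
        gcongr; exact hT.bound t g ht
    _ = M * ‖g‖ * (Real.exp (-lam.re * t) * Real.exp (ω * t)) := by ring
    _ = _ := by rw [← Real.exp_add]; congr 2; ring

theorem continuousOn_exp_smul (lam : ℂ) (g : X) :
    ContinuousOn (fun t : ℝ => Complex.exp (-lam * t) • T t g) (Set.Ici 0) := by
  refine ContinuousOn.smul ?_ (hT.continuousOn g)
  fun_prop

variable {lam : ℂ} (hlam : ω < lam.re)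
include hlam

theorem integrableOn_orbit (g : X) :
    IntegrableOn (fun t : ℝ => Complex.exp (-lam * t) • T t g) (Set.Ioi 0) := by
  have h : IntegrableOn (fun t : ℝ => M * ‖g‖ * Real.exp (-(lam.re - ω) * t)) (Set.Ioi 0) :=
    (exp_neg_integrableOn_Ioi 0 (sub_pos.2 hlam)).const_mul _
  refine Integrable.mono' h (((hT.continuousOn_exp_smul lam g).mono
    Set.Ioi_subset_Ici_self).aestronglyMeasurable measurableSet_Ioi) ?_
  filter_upwards [ae_restrict_mem measurableSet_Ioi] with t ht
  exact hT.norm_exp_smul_le lam g (le_of_lt ht)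

theorem norm_orbitLaplace_le (g : X) :
    ‖orbitLaplace T lam g‖ ≤ M / (lam.re - ω) * ‖g‖ := by
  have h : IntegrableOn (fun t : ℝ => M * ‖g‖ * Real.exp (-(lam.re - ω) * t)) (Set.Ioi 0) :=
    (exp_neg_integrableOn_Ioi 0 (sub_pos.2 hlam)).const_mul _
  have h2 : ‖orbitLaplace T lam g‖ ≤ ∫ t in Set.Ioi (0 : ℝ),
      M * ‖g‖ * Real.exp (-(lam.re - ω) * t) := by
    refine norm_integral_le_of_norm_le h ?_
    filter_upwards [ae_restrict_mem measurableSet_Ioi] with t ht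
    exact hT.norm_exp_smul_le lam g (le_of_lt ht)
  refine h2.trans_eq ?_
  rw [integral_const_mul, integral_exp_mul_Ioi (by linarith : -(lam.re - ω) < 0) 0]
  have : lam.re - ω ≠ 0 := by linarith
  rw [mul_zero, Real.exp_zero, neg_div_neg_eq]
  field_simp

/-- Substituting `t + h` for the time turns the transform of `T h g` into the tail of the transform
of `g` over `(h, ∞)`, up to the factor `exp(lam h)`. -/
theorem orbitLaplace_shift (g : X) {h : ℝ} (hh : 0 ≤ h) :
    orbitLaplace T lam (T h g) = Complex.exp (lam * h) • (orbitLaplace T lam g -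
      ∫ t in (0 : ℝ)..h, Complex.exp (-lam * t) • T t g) := by
  have hint := hT.integrableOn_orbit hlam g
  have hsplit : orbitLaplace T lam g = (∫ t in (0 : ℝ)..h, Complex.exp (-lam * t) • T t g)
      + ∫ t in Set.Ioi h, Complex.exp (-lam * t) • T t g := by
    rw [intervalIntegral.integral_of_le hh, orbitLaplace, ← Set.Ioc_union_Ioi_eq_Ioi hh]
    exact setIntegral_union (Set.Ioc_disjoint_Ioi le_rfl) measurableSet_Ioi
      (hint.mono_set Set.Ioc_subset_Ioi_self) (hint.mono_set (Set.Ioi_subset_Ioi hh))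
  rw [hsplit, add_sub_cancel_left, ← integral_smul]
  have hpre : (fun t : ℝ => t + h) ⁻¹' Set.Ioi h = Set.Ioi 0 := by
    ext t; simp
  rw [← (measurePreserving_add_right volume h).setIntegral_preimage_emb
    (measurableEmbedding_addRight h), hpre, orbitLaplace]
  refine setIntegral_congr_fun measurableSet_Ioi fun t ht => ?_
  have ht' : (0 : ℝ) ≤ t := le_of_lt ht
  rw [hT.add_time _ _ _ ht' hh, smul_smul, ← Complex.exp_add]
  congr 2
  push_cast
  ring

variable [CompleteSpace X]

theorem apply_orbitLaplace (g : X) {h : ℝ} (hh : 0 ≤ h) :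
    T h (orbitLaplace T lam g) = orbitLaplace T lam (T h g) := by
  rw [← hT.toCLM_apply hh, orbitLaplace, ← ContinuousLinearMap.integral_comp_comm _
    (hT.integrableOn_orbit hlam g), orbitLaplace]
  refine setIntegral_congr_fun measurableSet_Ioi fun t ht => ?_
  have ht' : (0 : ℝ) ≤ t := le_of_lt ht
  simp only [hT.toCLM_apply]
  rw [hT.map_smul _ _ _ hh]
  rw [← hT.add_time _ _ _ hh ht', add_comm, hT.add_time _ _ _ ht' hh]

/-- `T h` applied to the transform is the function `F h` below, whose right derivative at `0`
follows from the product rule and the fundamental theorem of calculus. -/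
theorem tendsto_diffQuot_orbitLaplace (g : X) :
    Tendsto (diffQuot T (orbitLaplace T lam g)) (𝓝[>] 0) (𝓝 (lam • orbitLaplace T lam g - g)) := by
  set F : ℝ → X := fun h => Complex.exp (lam * h) • (orbitLaplace T lam g -
      ∫ t in (0 : ℝ)..h, Complex.exp (-lam * t) • T t g) with hF
  have hexp : HasDerivWithinAt (fun h : ℝ => Complex.exp (lam * h)) lam (Set.Ici 0) 0 := by
    have h1 : HasDerivAt (fun h : ℝ => lam * (h : ℂ)) lam 0 := by
      simpa using (Complex.ofRealCLM.hasDerivAt (x := (0 : ℝ))).const_mul lam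
    have h2 := h1.cexp
    simp only [Complex.ofReal_zero, mul_zero, Complex.exp_zero, one_mul] at h2
    exact h2.hasDerivWithinAt
  have hI : HasDerivWithinAt (fun h : ℝ => ∫ t in (0 : ℝ)..h, Complex.exp (-lam * t) • T t g) g
      (Set.Ici 0) 0 := by
    have hc : ContinuousWithinAt (fun t : ℝ => Complex.exp (-lam * t) • T t g) (Set.Ici 0) 0 :=
      hT.continuousOn_exp_smul lam g 0 Set.self_mem_Ici
    have h3 := intervalIntegral.integral_hasDerivWithinAt_right (a := 0) (b := 0)
      (f := fun t : ℝ => Complex.exp (-lam * t) • T t g) (s := Set.Ici 0) (t := Set.Ioi 0)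
      (by simp) (by
        refine ⟨Set.Ioi 0, self_mem_nhdsWithin, ?_⟩
        exact (hT.integrableOn_orbit hlam g).1) (hc.mono Set.Ioi_subset_Ici_self)
    simpa [hT.zero] using h3
  have hD : HasDerivWithinAt F (lam • orbitLaplace T lam g - g) (Set.Ici 0) 0 := by
    have := hexp.fun_smul 
      ((hasDerivWithinAt_const (0 : ℝ) (Set.Ici 0) (orbitLaplace T lam g)).sub hI)
    simp only [Pi.sub_apply, intervalIntegral.integral_same, Complex.ofReal_zero, mul_zero,
      Complex.exp_zero, one_smul, sub_zero, zero_sub] at this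
    rw [neg_add_eq_sub] at this
    exact this
  have hslope := hasDerivWithinAt_iff_tendsto_slope.1 hD
  rw [Set.Ici_sdiff_left] at hslope
  refine hslope.congr' ?_
  filter_upwards [self_mem_nhdsWithin] with h hh
  have hh' : (0 : ℝ) ≤ h := le_of_lt hh
  rw [slope_def_module, diffQuot, hT.apply_orbitLaplace hlam g hh',
    hT.orbitLaplace_shift hlam g hh']
  have hF0 : F 0 = orbitLaplace T lam g := by simp [hF]
  rw [hF0, sub_zero, ← Complex.ofReal_inv, Complex.coe_smul]

theorem orbitLaplace_mem_domain (g : X) : orbitLaplace T lam g ∈ generatorDomain T :=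
  ⟨_, hT.tendsto_diffQuot_orbitLaplace hlam g⟩

theorem shiftedGenerator_orbitLaplace (g : X) :
    shiftedGenerator T lam (orbitLaplace T lam g) = g := by
  rw [shiftedGenerator, generator, (hT.tendsto_diffQuot_orbitLaplace hlam g).limUnder_eq]
  abel

/-- The transform is linear, continuous and commutes with `T h`, so it can be applied to the
difference quotients of `w`. The resulting limit is compared with the one already known for
`orbitLaplace T lam w`. -/
theorem orbitLaplace_shiftedGenerator {w : X} (hw : w ∈ generatorDomain T) :
    orbitLaplace T lam (shiftedGenerator T lam w) = w := by
  obtain ⟨z, hz⟩ := hw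
  have hlin : ∀ u v, orbitLaplace T lam (u - v) = orbitLaplace T lam u - orbitLaplace T lam v := by
    intro u v
    rw [orbitLaplace, orbitLaplace, orbitLaplace, ← integral_sub (hT.integrableOn_orbit hlam u)
      (hT.integrableOn_orbit hlam v)]
    refine setIntegral_congr_fun measurableSet_Ioi fun t ht => ?_
    rw [hT.map_sub (le_of_lt ht), smul_sub]
  have hsmul : ∀ (c : ℂ) u, orbitLaplace T lam (c • u) = c • orbitLaplace T lam u := by
    intro c u
    rw [orbitLaplace, orbitLaplace, ← integral_smul]
    refine setIntegral_congr_fun measurableSet_Ioi fun t ht => ?_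
    rw [hT.map_smul _ _ _ (le_of_lt ht), smul_comm]
  have hcont : Tendsto (orbitLaplace T lam) (𝓝 z) (𝓝 (orbitLaplace T lam z)) := by
    rw [tendsto_iff_norm_sub_tendsto_zero]
    have hz0 : Tendsto (fun u => M / (lam.re - ω) * ‖u - z‖) (𝓝 z) (𝓝 0) := by
      have := (tendsto_iff_norm_sub_tendsto_zero.1 (tendsto_id (α := X) (x := 𝓝 z))).const_mul
        (M / (lam.re - ω))
      simpa using this
    refine squeeze_zero (fun _ => norm_nonneg _) (fun u => ?_) hz0
    rw [← hlin]
    exact hT.norm_orbitLaplace_le hlam _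
  have h1 : Tendsto (diffQuot T (orbitLaplace T lam w)) (𝓝[>] 0) (𝓝 (orbitLaplace T lam z)) := by
    refine (hcont.comp hz).congr' ?_
    filter_upwards [self_mem_nhdsWithin] with h hh
    simp only [Function.comp, diffQuot]
    rw [hsmul, hlin, hT.apply_orbitLaplace hlam w (le_of_lt hh)]
  have h2 := tendsto_nhds_unique h1 (hT.tendsto_diffQuot_orbitLaplace hlam w)
  rw [shiftedGenerator, generator, hz.limUnder_eq, hlin, hsmul, h2]
  abel

theorem bijOn_shiftedGenerator :
    Set.BijOn (shiftedGenerator T lam) (generatorDomain T) Set.univ := by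
  refine ⟨fun _ _ => Set.mem_univ _, fun u hu w hw h => ?_, fun g _ => ?_⟩
  · rw [← hT.orbitLaplace_shiftedGenerator hlam hu, h, hT.orbitLaplace_shiftedGenerator hlam hw]
  · exact ⟨_, hT.orbitLaplace_mem_domain hlam g, hT.shiftedGenerator_orbitLaplace hlam g⟩

theorem orbitLaplace_eq_generatorResolvent (g : X) :
    orbitLaplace T lam g = generatorResolvent T lam g := by
  have hb := hT.bijOn_shiftedGenerator hlam
  have hex : ∃ a ∈ generatorDomain T, shiftedGenerator T lam a = g :=
    ⟨_, hT.orbitLaplace_mem_domain hlam g, hT.shiftedGenerator_orbitLaplace hlam g⟩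
  refine hb.injOn (hT.orbitLaplace_mem_domain hlam g) (Function.invFunOn_mem hex) ?_
  rw [hT.shiftedGenerator_orbitLaplace hlam g]
  exact (Function.invFunOn_eq hex).symm

end IsBoundedC0Semigroup

end AbstractSemigroup

/-! ### Gaussian moments and their expression by Kummer functions. -/

section Gaussian

/-- The Gaussian density `(4 π τ)^(-d/2) exp(-|y|² / (4 τ))`. -/
noncomputable def gaussDensity {d : ℕ} (τ : ℝ) (y : RSpace d) : ℝ :=
  (4 * Real.pi * τ) ^ (-(d : ℝ) / 2) * Real.exp (-(4 * τ)⁻¹ * ‖y‖ ^ 2)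

variable {d : ℕ} {τ : ℝ}

theorem gaussDensity_nonneg (hτ : 0 ≤ τ) (y : RSpace d) : 0 ≤ gaussDensity τ y := by
  unfold gaussDensity
  have := Real.pi_pos
  positivity

@[fun_prop]
theorem continuous_gaussDensity : Continuous (gaussDensity τ : RSpace d → ℝ) := by
  unfold gaussDensity
  fun_prop

theorem integral_exp_neg_mul_norm_sq {b : ℝ} (hb : 0 < b) :
    ∫ y : RSpace d, Real.exp (-b * ‖y‖ ^ 2) = (Real.pi / b) ^ ((d : ℝ) / 2) := by
  simpa using GaussianFourier.integral_rexp_neg_mul_sq_norm (V := RSpace d) hb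

theorem integrable_exp_neg_mul_norm_sq {b : ℝ} (hb : 0 < b) :
    Integrable fun y : RSpace d => Real.exp (-b * ‖y‖ ^ 2) := by
  refine Integrable.of_integral_ne_zero ?_
  rw [integral_exp_neg_mul_norm_sq hb]
  have := Real.pi_pos
  positivity

theorem integral_gaussDensity (hτ : 0 < τ) : ∫ y : RSpace d, gaussDensity τ y = 1 := by
  unfold gaussDensity
  have := Real.pi_pos
  rw [integral_const_mul, integral_exp_neg_mul_norm_sq (by positivity), div_inv_eq_mul,
    show Real.pi * (4 * τ) = 4 * Real.pi * τ by ring, ← Real.rpow_add (by positivity)]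
  have : -(d : ℝ) / 2 + d / 2 = 0 := by ring
  rw [this, Real.rpow_zero]

theorem integrable_gaussDensity (hτ : 0 < τ) : Integrable (gaussDensity τ : RSpace d → ℝ) :=
  integrable_of_integral_eq_one (integral_gaussDensity hτ)

/-- Completing the square gives `s|y| ≤ (1 + ε) s²τ + |y|² / (4(1 + ε)τ)`. The share `ε / (1 + ε)`
of the Gaussian exponent that remains keeps the right side integrable. -/
theorem exp_mul_gaussDensity_le {ε s : ℝ} (hε : 0 < ε) (hτ : 0 < τ) (y : RSpace d) :
    Real.exp (s * ‖y‖) * gaussDensity τ y ≤ Real.exp ((1 + ε) * (s ^ 2 * τ)) *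
      ((4 * Real.pi * τ) ^ (-(d : ℝ) / 2) * Real.exp (-(ε / ((1 + ε) * (4 * τ))) * ‖y‖ ^ 2)) := by
  unfold gaussDensity
  have hpi := Real.pi_pos
  rw [mul_left_comm, ← Real.exp_add, mul_left_comm, ← Real.exp_add]
  refine mul_le_mul_of_nonneg_left (Real.exp_le_exp.2 ?_) (by positivity)
  have key : (1 + ε) * (s ^ 2 * τ) + -(ε / ((1 + ε) * (4 * τ))) * ‖y‖ ^ 2
      - (s * ‖y‖ + -(4 * τ)⁻¹ * ‖y‖ ^ 2)
      = (2 * (1 + ε) * τ * s - ‖y‖) ^ 2 / (4 * (1 + ε) * τ) := by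
    field_simp
    ring
  have : 0 ≤ (2 * (1 + ε) * τ * s - ‖y‖) ^ 2 / (4 * (1 + ε) * τ) := by positivity
  linarith

theorem integrable_exp_mul_gaussDensity (hτ : 0 < τ) (s : ℝ) :
    Integrable fun y : RSpace d => Real.exp (s * ‖y‖) * gaussDensity τ y := by
  have h := ((integrable_exp_neg_mul_norm_sq (d := d) (b := 1 / ((1 + 1) * (4 * τ)))
    (by positivity)).const_mul ((4 * Real.pi * τ) ^ (-(d : ℝ) / 2))).const_mul
      (Real.exp ((1 + 1) * (s ^ 2 * τ)))
  refine h.mono' (by fun_prop) (Eventually.of_forall fun y => ?_)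
  rw [Real.norm_of_nonneg (mul_nonneg (Real.exp_pos _).le (gaussDensity_nonneg hτ.le y))]
  exact exp_mul_gaussDensity_le one_pos hτ y

/-- The factor `((1 + ε) / ε)^(d/2)` is the mass of the widened Gaussian; its `p`-th root later
serves as an explicit admissible `C_*`. -/
theorem integral_exp_mul_gaussDensity_le {ε : ℝ} (hε : 0 < ε) (hτ : 0 < τ) (s : ℝ) :
    ∫ y : RSpace d, Real.exp (s * ‖y‖) * gaussDensity τ y
      ≤ ((1 + ε) / ε) ^ ((d : ℝ) / 2) * Real.exp ((1 + ε) * (s ^ 2 * τ)) := by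
  have hpi := Real.pi_pos
  have hb : 0 < ε / ((1 + ε) * (4 * τ)) := by positivity
  refine (integral_mono (integrable_exp_mul_gaussDensity hτ s)
    (((integrable_exp_neg_mul_norm_sq hb).const_mul _).const_mul _)
    (fun y => exp_mul_gaussDensity_le hε hτ y)).trans_eq ?_
  rw [integral_const_mul, integral_const_mul, integral_exp_neg_mul_norm_sq hb, mul_comm]
  congr 1
  have : Real.pi / (ε / ((1 + ε) * (4 * τ))) = ((1 + ε) / ε) * (4 * Real.pi * τ) := by
    field_simp
  rw [this, Real.mul_rpow (x := (1 + ε) / ε) (by positivity) (by positivity), mul_left_comm,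
    ← Real.rpow_add (by positivity)]
  have : -(d : ℝ) / 2 + d / 2 = 0 := by ring
  rw [this, Real.rpow_zero, mul_one]

theorem integrable_norm_pow_mul_gaussDensity (hτ : 0 < τ) (k : ℕ) :
    Integrable fun y : RSpace d => ‖y‖ ^ k * gaussDensity τ y := by
  have h := (integrable_exp_mul_gaussDensity (d := d) hτ 1).const_mul (k.factorial : ℝ)
  refine h.mono' (by fun_prop) (Eventually.of_forall fun y => ?_)
  have hg := gaussDensity_nonneg hτ.le y
  rw [Real.norm_of_nonneg (mul_nonneg (by positivity) hg), ← mul_assoc]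
  gcongr
  have := Real.pow_div_factorial_le_exp ‖y‖ (norm_nonneg y) k
  rw [div_le_iff₀ (by positivity)] at this
  rwa [one_mul, mul_comm]

/-- Polar coordinates reduce this to a one-dimensional Gamma integral. -/
theorem integral_norm_pow_mul_exp_neg (hd : 1 ≤ d) {b : ℝ} (hb : 0 < b) (k : ℕ) :
    ∫ y : RSpace d, ‖y‖ ^ k * Real.exp (-b * ‖y‖ ^ 2)
      = (d * (volume : Measure (RSpace d)).real (Metric.ball 0 1) / 2)
        * (b ^ (-((d : ℝ) + k) / 2) * Real.Gamma (((d : ℝ) + k) / 2)) := by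
  have : Nonempty (Fin d) := ⟨⟨0, hd⟩⟩
  rw [integral_fun_norm_addHaar volume (fun r : ℝ => r ^ k * Real.exp (-b * r ^ 2))]
  have h1 := integral_rpow_mul_exp_neg_mul_rpow (p := 2) (q := (d : ℝ) - 1 + k) (b := b)
    two_pos (by
      have : (1 : ℝ) ≤ d := by exact_mod_cast hd
      have : (0 : ℝ) ≤ k := by positivity
      linarith) hb
  have h2 : ∫ r in Set.Ioi (0 : ℝ), r ^ (Module.finrank ℝ (RSpace d) - 1) •
      (r ^ k * Real.exp (-b * r ^ 2))
      = ∫ x in Set.Ioi (0 : ℝ), x ^ ((d : ℝ) - 1 + k) * Real.exp (-b * x ^ (2 : ℝ)) := by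
    refine setIntegral_congr_fun measurableSet_Ioi fun r hr => ?_
    have hr' : 0 < r := hr
    simp only [finrank_euclideanSpace_fin, smul_eq_mul]
    rw [Real.rpow_add hr', Real.rpow_natCast, Real.rpow_two, ← mul_assoc]
    congr 2
    rw [← Real.rpow_natCast, Nat.cast_sub hd, Nat.cast_one]
  rw [h2, h1]
  have e : (d : ℝ) - 1 + k + 1 = d + k := by ring
  simp only [finrank_euclideanSpace_fin, nsmul_eq_mul, smul_eq_mul, e]
  ring

theorem integral_norm_pow_mul_gaussDensity (hd : 1 ≤ d) (hτ : 0 < τ) (k : ℕ) :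
    ∫ y : RSpace d, ‖y‖ ^ k * gaussDensity τ y
      = Real.Gamma (((d : ℝ) + k) / 2) / Real.Gamma ((d : ℝ) / 2) * (4 * τ) ^ ((k : ℝ) / 2) := by
  have hb : 0 < (4 * τ)⁻¹ := by positivity
  have hpi := Real.pi_pos
  have hd0 : (0 : ℝ) < d := by exact_mod_cast hd
  -- The case `k = 0` is the known total mass; it determines the constant containing the volume of
  -- the unit ball.
  have h0 := integral_norm_pow_mul_exp_neg hd hb 0
  simp only [pow_zero, one_mul, Nat.cast_zero, add_zero] at h0
  rw [integral_exp_neg_mul_norm_sq hb] at h0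
  have hk := integral_norm_pow_mul_exp_neg hd hb k
  set D := (d * (volume : Measure (RSpace d)).real (Metric.ball 0 1) / 2)
  have hG : 0 < Real.Gamma ((d : ℝ) / 2) := Real.Gamma_pos_of_pos (by positivity)
  have hτ4 : 0 < 4 * τ := by positivity
  have hD : D = Real.pi ^ ((d : ℝ) / 2) / Real.Gamma ((d : ℝ) / 2) := by
    rw [div_inv_eq_mul, Real.mul_rpow hpi.le hτ4.le, neg_div, Real.rpow_neg hb.le,
      Real.inv_rpow hτ4.le, inv_inv] at h0
    have : (0 : ℝ) < (4 * τ) ^ ((d : ℝ) / 2) := by positivity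
    rw [eq_div_iff hG.ne']
    refine mul_right_cancel₀ this.ne' ?_
    rw [h0]; ring
  have : ∀ y : RSpace d, ‖y‖ ^ k * gaussDensity τ y = (4 * Real.pi * τ) ^ (-(d : ℝ) / 2) *
      (‖y‖ ^ k * Real.exp (-(4 * τ)⁻¹ * ‖y‖ ^ 2)) := fun y => by
    unfold gaussDensity; ring
  simp_rw [this]
  rw [integral_const_mul, hk, hD, show 4 * Real.pi * τ = Real.pi * (4 * τ) by ring,
    Real.mul_rpow hpi.le hτ4.le, neg_div, neg_div, Real.rpow_neg hb.le, Real.inv_rpow hτ4.le,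
    inv_inv, Real.rpow_neg hpi.le, Real.rpow_neg hτ4.le, add_div, Real.rpow_add hτ4]
  have h1 : (0 : ℝ) < (4 * τ) ^ ((d : ℝ) / 2) := by positivity
  have h2 : (0 : ℝ) < Real.pi ^ ((d : ℝ) / 2) := by positivity
  field_simp

theorem Gamma_add_nat {x : ℝ} (hx : 0 < x) (m : ℕ) :
    Real.Gamma (x + m) = Real.Gamma x * (ascPochhammer ℝ m).eval x := by
  induction m with
  | zero => simp
  | succ m ih =>
    rw [ascPochhammer_succ_eval, Nat.cast_succ, ← add_assoc, Real.Gamma_add_one (by positivity), ih]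
    ring

/-- This duplication formula and its odd companion produce the lower parameters `1/2` and `3/2` of
the two Kummer series. -/
theorem factorial_two_mul_eq (m : ℕ) :
    ((2 * m).factorial : ℝ) = 4 ^ m * m.factorial * (ascPochhammer ℝ m).eval (1 / 2) := by
  induction m with
  | zero => simp
  | succ m ih =>
    rw [show 2 * (m + 1) = 2 * m + 1 + 1 by ring, Nat.factorial_succ, Nat.factorial_succ,
      Nat.factorial_succ, ascPochhammer_succ_eval]
    push_cast
    rw [ih]
    ring

theorem factorial_two_mul_add_one_eq (m : ℕ) :
    ((2 * m + 1).factorial : ℝ) = 4 ^ m * m.factorial * (ascPochhammer ℝ m).eval (3 / 2) := by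
  induction m with
  | zero => simp
  | succ m ih =>
    rw [show 2 * (m + 1) + 1 = 2 * m + 1 + 1 + 1 by ring, Nat.factorial_succ (2 * m + 1 + 1),
      Nat.factorial_succ (2 * m + 1), Nat.factorial_succ m, ascPochhammer_succ_eval, Nat.cast_mul,
      Nat.cast_mul, ih]
    push_cast
    ring

/-- All terms of the exponential series are nonnegative, so Tonelli in `ℝ≥0∞` exchanges sum and
integral; finiteness of the right side then gives summability in `ℝ`. -/
theorem hasSum_integral_exp_mul_gaussDensity (hτ : 0 < τ) {s : ℝ} (hs : 0 ≤ s) :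
    HasSum (fun k : ℕ => s ^ k / k.factorial * ∫ y : RSpace d, ‖y‖ ^ k * gaussDensity τ y)
      (∫ y : RSpace d, Real.exp (s * ‖y‖) * gaussDensity τ y) := by
  have hg := fun y : RSpace d => gaussDensity_nonneg hτ.le y
  have hI : ∀ k : ℕ, Integrable fun y : RSpace d => s ^ k / k.factorial *
      (‖y‖ ^ k * gaussDensity τ y) := fun k =>
    (integrable_norm_pow_mul_gaussDensity hτ k).const_mul _
  have h0 : ∀ k : ℕ, ∀ y : RSpace d, 0 ≤ s ^ k / k.factorial * (‖y‖ ^ k * gaussDensity τ y) :=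
    fun k y => mul_nonneg (by positivity) (mul_nonneg (by positivity) (hg y))
  have hpt : ∀ y : RSpace d, HasSum (fun k : ℕ => s ^ k / k.factorial *
      (‖y‖ ^ k * gaussDensity τ y)) (Real.exp (s * ‖y‖) * gaussDensity τ y) := by
    intro y
    have := (NormedSpace.expSeries_div_hasSum_exp (s * ‖y‖)).mul_right (gaussDensity τ y)
    rw [← Real.exp_eq_exp_ℝ] at this
    refine this.congr_fun fun k => ?_
    rw [mul_pow]; ring
  have e1 : ∑' k : ℕ, ENNReal.ofReal (s ^ k / k.factorial *
      ∫ y : RSpace d, ‖y‖ ^ k * gaussDensity τ y)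
      = ENNReal.ofReal (∫ y : RSpace d, Real.exp (s * ‖y‖) * gaussDensity τ y) := by
    rw [ofReal_integral_eq_lintegral_ofReal (integrable_exp_mul_gaussDensity hτ s)
      (Eventually.of_forall fun y => mul_nonneg (Real.exp_pos _).le (hg y))]
    have : ∀ y : RSpace d, ENNReal.ofReal (Real.exp (s * ‖y‖) * gaussDensity τ y)
        = ∑' k : ℕ, ENNReal.ofReal (s ^ k / k.factorial * (‖y‖ ^ k * gaussDensity τ y)) := by
      intro y
      rw [← ENNReal.ofReal_tsum_of_nonneg (fun k => h0 k y) (hpt y).summable, (hpt y).tsum_eq]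
    simp_rw [this]
    rw [lintegral_tsum fun k => (hI k).aemeasurable.ennreal_ofReal]
    refine tsum_congr fun k => ?_
    rw [← integral_const_mul, ofReal_integral_eq_lintegral_ofReal (hI k)
      (Eventually.of_forall (h0 k))]
  have hn : ∀ k : ℕ, 0 ≤ s ^ k / k.factorial * ∫ y : RSpace d, ‖y‖ ^ k * gaussDensity τ y :=
    fun k => mul_nonneg (by positivity)
      (integral_nonneg fun y => mul_nonneg (by positivity) (hg y))
  have hsum : Summable fun k : ℕ => s ^ k / k.factorial *
      ∫ y : RSpace d, ‖y‖ ^ k * gaussDensity τ y := by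
    have := ENNReal.summable_toReal (e1.trans_ne ENNReal.ofReal_ne_top)
    simpa only [ENNReal.toReal_ofReal (hn _)] using this
  rw [← ENNReal.ofReal_tsum_of_nonneg hn hsum, ENNReal.ofReal_eq_ofReal_iff (tsum_nonneg hn)
    (integral_nonneg fun y => mul_nonneg (Real.exp_pos _).le (hg y))] at e1
  rw [← e1]
  exact hsum.hasSum

theorem even_moment_term (hd : 1 ≤ d) (hτ : 0 < τ) (s : ℝ) (m : ℕ) :
    s ^ (2 * m) / ((2 * m).factorial : ℝ) * ∫ y : RSpace d, ‖y‖ ^ (2 * m) * gaussDensity τ y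
      = (ascPochhammer ℝ m).eval ((d : ℝ) / 2) / (ascPochhammer ℝ m).eval (1 / 2)
        * ((s ^ 2 * τ) ^ m / (m.factorial : ℝ)) := by
  have hd0 : (0 : ℝ) < d := by exact_mod_cast hd
  have hG : 0 < Real.Gamma ((d : ℝ) / 2) := Real.Gamma_pos_of_pos (by positivity)
  have hp : 0 < (ascPochhammer ℝ m).eval (1 / 2 : ℝ) := ascPochhammer_pos _ _ (by norm_num)
  have e1 : ((d : ℝ) + (2 * m : ℕ)) / 2 = d / 2 + m := by push_cast; ring
  have e2 : ((2 * m : ℕ) : ℝ) / 2 = m := by push_cast; ring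
  rw [integral_norm_pow_mul_gaussDensity hd hτ, e1, Gamma_add_nat (by positivity), e2,
    Real.rpow_natCast, factorial_two_mul_eq, pow_mul, mul_pow, mul_pow]
  generalize (ascPochhammer ℝ m).eval (1 / 2 : ℝ) = P at *
  generalize (ascPochhammer ℝ m).eval ((d : ℝ) / 2) = Q at *
  field_simp

theorem odd_moment_term (hd : 1 ≤ d) (hτ : 0 < τ) {s : ℝ} (hs : 0 ≤ s) (m : ℕ) :
    s ^ (2 * m + 1) / ((2 * m + 1).factorial : ℝ)
        * ∫ y : RSpace d, ‖y‖ ^ (2 * m + 1) * gaussDensity τ y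
      = 2 * (Real.Gamma (((d : ℝ) + 1) / 2) / Real.Gamma ((d : ℝ) / 2)) * √(s ^ 2 * τ)
        * ((ascPochhammer ℝ m).eval (((d : ℝ) + 1) / 2) / (ascPochhammer ℝ m).eval (3 / 2)
          * ((s ^ 2 * τ) ^ m / (m.factorial : ℝ))) := by
  have hd0 : (0 : ℝ) < d := by exact_mod_cast hd
  have hτ4 : 0 < 4 * τ := by positivity
  have hG : 0 < Real.Gamma ((d : ℝ) / 2) := Real.Gamma_pos_of_pos (by positivity)
  have hp : 0 < (ascPochhammer ℝ m).eval (3 / 2 : ℝ) := ascPochhammer_pos _ _ (by norm_num)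
  have e1 : ((d : ℝ) + (2 * m + 1 : ℕ)) / 2 = (d + 1) / 2 + m := by push_cast; ring
  have e2 : ((2 * m + 1 : ℕ) : ℝ) / 2 = m + 1 / 2 := by push_cast; ring
  have e3 : √(s ^ 2 * τ) = s * √τ := by
    rw [Real.sqrt_mul (sq_nonneg s), Real.sqrt_sq hs]
  have e4 : √(4 * τ) = 2 * √τ := by
    rw [Real.sqrt_mul (by norm_num), show (4 : ℝ) = 2 ^ 2 by norm_num,
      Real.sqrt_sq (by norm_num)]
  rw [integral_norm_pow_mul_gaussDensity hd hτ, e1, Gamma_add_nat (by positivity), e2,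
    Real.rpow_add hτ4, Real.rpow_natCast, ← Real.sqrt_eq_rpow, factorial_two_mul_add_one_eq, e3,
    e4, pow_succ, pow_mul, mul_pow, mul_pow]
  generalize (ascPochhammer ℝ m).eval (3 / 2 : ℝ) = P at *
  generalize (ascPochhammer ℝ m).eval (((d : ℝ) + 1) / 2) = Q at *
  generalize Real.Gamma (((d : ℝ) + 1) / 2) = G at *
  field_simp

/-- The exponential moments of the norm of a Gaussian vector are Kummer functions. -/
theorem integral_exp_mul_gaussDensity (hd : 1 ≤ d) (hτ : 0 < τ) {s : ℝ} (hs : 0 ≤ s) :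
    ∫ y : RSpace d, Real.exp (s * ‖y‖) * gaussDensity τ y = kummerBracket d (s ^ 2 * τ) := by
  have hsum := hasSum_integral_exp_mul_gaussDensity (d := d) hτ hs
  set f : ℕ → ℝ := fun k : ℕ => s ^ k / k.factorial * ∫ y : RSpace d, ‖y‖ ^ k * gaussDensity τ y
    with hf
  have hev : Summable fun k => f (2 * k) :=
    hsum.summable.comp_injective (i := fun k : ℕ => 2 * k) fun a b h => by
      simp only at h; omega
  have hod : Summable fun k => f (2 * k + 1) :=
    hsum.summable.comp_injective (i := fun k : ℕ => 2 * k + 1) fun a b h => by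
      simp only at h; omega
  have h2 : ∀ m, f (2 * m) = _ := even_moment_term hd hτ s
  have h3 : ∀ m, f (2 * m + 1) = _ := odd_moment_term hd hτ hs
  -- Even powers form the first Kummer series and odd powers the second.
  rw [← hsum.tsum_eq, ← tsum_even_add_odd hev hod, kummerBracket, kummer, kummer, ← tsum_mul_left,
    tsum_congr h2, tsum_congr h3]

theorem kummerBracket_nonneg (hd : 1 ≤ d) {s : ℝ} (hs : 0 ≤ s) : 0 ≤ kummerBracket d s := by
  have h := integral_exp_mul_gaussDensity hd one_pos (Real.sqrt_nonneg s)
  rw [Real.sq_sqrt hs, mul_one] at h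
  rw [← h]
  exact integral_nonneg fun y => mul_nonneg (Real.exp_pos _).le (gaussDensity_nonneg one_pos.le y)

/-- The bracket at `s` is the Gaussian moment with `τ = 1` and exponent `√s`, so the moment bound
applies to it. -/
theorem kummerBracket_le (hd : 1 ≤ d) {ε : ℝ} (hε : 0 < ε) {s : ℝ} (hs : 0 ≤ s) :
    kummerBracket d s ≤ ((1 + ε) / ε) ^ ((d : ℝ) / 2) * Real.exp ((1 + ε) * s) := by
  have h := integral_exp_mul_gaussDensity hd one_pos (Real.sqrt_nonneg s)
  have h2 := integral_exp_mul_gaussDensity_le (d := d) hε one_pos (√s)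
  rwa [h, Real.sq_sqrt hs, mul_one] at h2

end Gaussian

/-! ### A weighted form of Young's convolution inequality. -/

section Convolution

/-- Young's inequality for the convolution with a weighted probability measure. -/
theorem lintegral_rpow_convolution_le {E : Type*} [NormedAddCommGroup E] [MeasurableSpace E]
    [BorelSpace E] [SecondCountableTopology E] (μ γ : Measure E) [SFinite μ]
    [μ.IsAddLeftInvariant] [IsProbabilityMeasure γ] {w u : E → ℝ≥0∞} (hw : Measurable w)
    (hu : Measurable u) {r : ℝ} (hr : 1 ≤ r) :
    ∫⁻ x, (∫⁻ y, w y * u (x - y) ∂γ) ^ r ∂μ ≤ (∫⁻ y, w y ^ r ∂γ) * ∫⁻ x, u x ^ r ∂μ := by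
  have hr0 : 0 < r := by linarith
  -- Jensen's inequality on the probability space `γ`, as monotonicity of `L^r` norms between the
  -- exponents `1` and `r`.
  have hinner : ∀ x, (∫⁻ y, w y * u (x - y) ∂γ) ^ r ≤ ∫⁻ y, w y ^ r * u (x - y) ^ r ∂γ := by
    intro x
    have hm : Measurable fun y => w y * u (x - y) := by fun_prop
    have h := eLpNorm'_le_eLpNorm'_of_exponent_le one_pos hr γ
      hm.aemeasurable.aestronglyMeasurable
    simp only [eLpNorm', enorm_eq_self, ENNReal.rpow_one, div_one] at h
    calc (∫⁻ y, w y * u (x - y) ∂γ) ^ r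
        ≤ ((∫⁻ y, (w y * u (x - y)) ^ r ∂γ) ^ (1 / r)) ^ r := by gcongr
      _ = _ := by
        rw [← ENNReal.rpow_mul, one_div_mul_cancel hr0.ne', ENNReal.rpow_one]
        simp_rw [ENNReal.mul_rpow_of_nonneg _ _ hr0.le]
  refine (lintegral_mono hinner).trans_eq ?_
  -- After Tonelli, invariance of `μ` removes the shift by `y`, and the two integrals separate.
  rw [lintegral_lintegral_swap (by fun_prop)]
  have : ∀ y, ∫⁻ x, w y ^ r * u (x - y) ^ r ∂μ = w y ^ r * ∫⁻ x, u x ^ r ∂μ := by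
    intro y
    rw [lintegral_const_mul _ (by fun_prop),
      lintegral_sub_right_eq_self (fun x => u x ^ r) y]
  simp_rw [this]
  rw [lintegral_mul_const _ (by fun_prop)]

end Convolution

/-! ### Calculus of matrices diagonalized by a common `U`. -/

section Diagonalization

variable {N : ℕ}

/-- The matrix `U diag(α) U⁻¹`. -/
noncomputable def conjDiag (U : (Matrix (Fin N) (Fin N) ℂ)ˣ) (α : Fin N → ℂ) :
    Matrix (Fin N) (Fin N) ℂ :=
  U.val * Matrix.diagonal α * U⁻¹.val

theorem exists_conjDiag_of_isDiag (U : (Matrix (Fin N) (Fin N) ℂ)ˣ) (A : Matrix (Fin N) (Fin N) ℂ)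
    (h : ((U : Matrix (Fin N) (Fin N) ℂ)⁻¹ * A * U.val).IsDiag) : ∃ α, A = conjDiag U α := by
  refine ⟨(((U : Matrix (Fin N) (Fin N) ℂ)⁻¹ * A * U.val)).diag, ?_⟩
  rw [conjDiag, h.diagonal_diag, ← Matrix.coe_units_inv]
  simp [mul_assoc]

variable (U : (Matrix (Fin N) (Fin N) ℂ)ˣ) (α β : Fin N → ℂ)

theorem conjDiag_mul : conjDiag U α * conjDiag U β = conjDiag U (α * β) := by
  have : Matrix.diagonal (α * β) = Matrix.diagonal α * Matrix.diagonal β := by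
    rw [Matrix.diagonal_mul_diagonal]; rfl
  rw [conjDiag, conjDiag, conjDiag, this]
  simp only [mul_assoc, Units.inv_mul_cancel_left]

theorem conjDiag_one : conjDiag U 1 = 1 := by simp [conjDiag]

theorem conjDiag_smul (c : ℂ) : c • conjDiag U α = conjDiag U (c • α) := by
  simp [conjDiag, Matrix.diagonal_smul]

theorem conjDiag_sub : conjDiag U α - conjDiag U β = conjDiag U (α - β) := by
  have : Matrix.diagonal (α - β) = Matrix.diagonal α - Matrix.diagonal β :=
    (Matrix.diagonal_sub α β).symm
  rw [conjDiag, conjDiag, conjDiag, this]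
  noncomm_ring

theorem conjDiag_neg : -conjDiag U α = conjDiag U (-α) := by
  have : Matrix.diagonal (-α) = -Matrix.diagonal α := (Matrix.diagonal_neg α).symm
  rw [conjDiag, conjDiag, this]
  noncomm_ring

theorem conjDiag_inv (h : ∀ k, α k ≠ 0) : (conjDiag U α)⁻¹ = conjDiag U α⁻¹ := by
  refine Matrix.inv_eq_left_inv ?_
  rw [conjDiag_mul, ← conjDiag_one U]
  congr 1
  ext k
  simp [h k]

theorem exp_conjDiag : NormedSpace.exp (conjDiag U α) = conjDiag U fun k => Complex.exp (α k) := by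
  rw [conjDiag, Matrix.exp_units_conj, Matrix.exp_diagonal, conjDiag]
  congr 3
  ext k
  rw [Pi.coe_exp, Complex.exp_eq_exp_ℂ]

theorem spectrum_conjDiag : spectrum ℂ (conjDiag U α) = Set.range α := by
  rw [conjDiag, spectrum.units_conjugate, spectrum_diagonal]

/-- This spectral decomposition lets matrix-valued integrals be treated one eigenvalue at a time. -/
theorem conjDiag_sum_single : conjDiag U α = ∑ k, α k • conjDiag U (Pi.single k 1) := by
  have : Matrix.diagonal α = ∑ k, α k • Matrix.diagonal (Pi.single k (1 : ℂ)) := by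
    ext i j
    by_cases hij : i = j
    · subst hij
      simp [Matrix.sum_apply, Pi.single_apply]
    · simp [Matrix.sum_apply, hij]
  simp only [conjDiag]
  conv_lhs => rw [this]
  rw [Finset.mul_sum, Finset.sum_mul]
  simp

theorem specNorm_diagonal_le {m : ℝ} (hm : 0 ≤ m) (h : ∀ k, ‖α k‖ ≤ m) :
    specNorm (Matrix.diagonal α) ≤ m := by
  open scoped Matrix.Norms.L2Operator in
  have h1 : specNorm (Matrix.diagonal α) = ‖Matrix.diagonal α‖ := rfl
  rw [h1, Matrix.l2_opNorm_diagonal]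
  exact (pi_norm_le_iff_of_nonneg hm).2 h

theorem specNorm_mul_le (C D : Matrix (Fin N) (Fin N) ℂ) :
    specNorm (C * D) ≤ specNorm C * specNorm D := by
  rw [specNorm, map_mul]
  exact norm_mul_le _ _

theorem specNorm_nonneg (C : Matrix (Fin N) (Fin N) ℂ) : 0 ≤ specNorm C := norm_nonneg _

theorem condNumber_nonneg (C : Matrix (Fin N) (Fin N) ℂ) : 0 ≤ condNumber C :=
  mul_nonneg (specNorm_nonneg _) (specNorm_nonneg _)

/-- This is the source of `κ`. Estimating the whole diagonal matrix, rather than summing over the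
projections, avoids a factor depending on `N`. -/
theorem specNorm_conjDiag_le {m : ℝ} (hm : 0 ≤ m) (h : ∀ k, ‖α k‖ ≤ m) :
    specNorm (conjDiag U α) ≤ condNumber U.val * m := by
  rw [conjDiag, condNumber, ← Matrix.coe_units_inv]
  calc _ ≤ specNorm U.val * specNorm (Matrix.diagonal α) * specNorm U⁻¹.val :=
        (specNorm_mul_le _ _).trans
          (mul_le_mul_of_nonneg_right (specNorm_mul_le _ _) (specNorm_nonneg _))
    _ ≤ specNorm U.val * m * specNorm U⁻¹.val := by
        gcongr
        · exact specNorm_nonneg _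
        · exact specNorm_nonneg _
        · exact specNorm_diagonal_le α hm h
    _ = _ := by ring

/-- The `k`-th spectral projection of `U diag(α) U⁻¹`. -/
noncomputable def specProj (k : Fin N) : CSpace N →L[ℂ] CSpace N :=
  Matrix.toEuclideanCLM (n := Fin N) (𝕜 := ℂ) (conjDiag U (Pi.single k 1))

theorem toEuclideanCLM_conjDiag (v : CSpace N) :
    Matrix.toEuclideanCLM (n := Fin N) (𝕜 := ℂ) (conjDiag U α) v
      = ∑ k, α k • specProj U k v := by
  rw [conjDiag_sum_single, map_sum]
  simp [specProj]

theorem specProj_specProj (k l : Fin N) (v : CSpace N) :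
    specProj U k (specProj U l v) = if k = l then specProj U k v else 0 := by
  have h : specProj U k (specProj U l v) = (Matrix.toEuclideanCLM (n := Fin N) (𝕜 := ℂ)
      (conjDiag U (Pi.single k 1) * conjDiag U (Pi.single l 1))) v := by
    rw [map_mul]; rfl
  rw [h, conjDiag_mul]
  split_ifs with hkl
  · subst hkl
    have : (Pi.single k 1 * Pi.single k 1 : Fin N → ℂ) = Pi.single k 1 := by
      rw [← Pi.single_mul, mul_one]
    rw [this]; rfl
  · have : (Pi.single k 1 * Pi.single l 1 : Fin N → ℂ) = 0 := by
      ext j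
      by_cases hj : j = k
      · subst hj; simp [hkl]
      · simp [hj]
    rw [this]
    simp [conjDiag]

theorem sum_specProj (v : CSpace N) : ∑ k, specProj U k v = v := by
  have := toEuclideanCLM_conjDiag U 1 v
  rw [conjDiag_one, map_one] at this
  simpa using this.symm

end Diagonalization

/-! ### Bounds on eigenvalues by the spectral constants. -/

section SpectralConstants

variable {N : ℕ} (U : (Matrix (Fin N) (Fin N) ℂ)ˣ) (α : Fin N → ℂ)

/-- Finiteness is what makes passing to `toReal` monotone in the bounds that follow. -/
theorem spectralRadius_conjDiag_ne_top : spectralRadius ℂ (conjDiag U α) ≠ ∞ := by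
  have h : spectralRadius ℂ (conjDiag U α) ≤ ∑ k, ‖α k‖ₑ := by
    rw [spectralRadius, spectrum_conjDiag]
    refine iSup₂_le ?_
    rintro _ ⟨k, rfl⟩
    exact Finset.single_le_sum (f := fun k => ‖α k‖ₑ) (fun _ _ => zero_le) (Finset.mem_univ k)
  exact (h.trans_lt (ENNReal.sum_lt_top.2 fun k _ => enorm_lt_top)).ne

theorem norm_le_spectralRadius (k : Fin N) :
    ‖α k‖ ≤ (spectralRadius ℂ (conjDiag U α)).toReal := by
  have h : ‖α k‖ₑ ≤ spectralRadius ℂ (conjDiag U α) := by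
    rw [spectralRadius, spectrum_conjDiag]
    exact le_iSup₂ (f := fun z (_ : z ∈ Set.range α) => (‖z‖₊ : ℝ≥0∞)) (α k) ⟨k, rfl⟩
  have := ENNReal.toReal_mono (spectralRadius_conjDiag_ne_top U α) h
  simpa using this

theorem norm_le_aMax (k : Fin N) : ‖α k‖ ≤ aMax (conjDiag U α) := norm_le_spectralRadius U α k

theorem aMin_le_norm (h : ∀ k, α k ≠ 0) (k : Fin N) : aMin (conjDiag U α) ≤ ‖α k‖ := by
  have h1 := norm_le_spectralRadius U α⁻¹ k
  rw [aMin, conjDiag_inv U α h]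
  have hk : 0 < ‖α k‖ := norm_pos_iff.2 (h k)
  rw [Pi.inv_apply, norm_inv] at h1
  exact inv_le_of_inv_le₀ hk h1

theorem aMin_pos (hN : 1 ≤ N) (h : ∀ k, α k ≠ 0) : 0 < aMin (conjDiag U α) := by
  have h1 := norm_le_spectralRadius U α⁻¹ ⟨0, hN⟩
  rw [aMin, conjDiag_inv U α h]
  refine inv_pos.2 (lt_of_lt_of_le ?_ h1)
  exact norm_pos_iff.2 (inv_ne_zero (h _))

theorem lowerAbscissa_le_re (k : Fin N) : lowerAbscissa (conjDiag U α) ≤ (α k).re := by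
  rw [lowerAbscissa, spectralAbscissa, conjDiag_neg, spectrum_conjDiag, neg_le]
  have hfin : (Complex.re '' Set.range (-α)).Finite := (Set.finite_range _).image _
  exact le_csSup hfin.bddAbove ⟨-α k, ⟨k, rfl⟩, by simp⟩

theorem lowerAbscissa_pos (hN : 1 ≤ N) (h : ∀ k, 0 < (α k).re) :
    0 < lowerAbscissa (conjDiag U α) := by
  rw [lowerAbscissa, spectralAbscissa, conjDiag_neg, spectrum_conjDiag]
  have hfin : (Complex.re '' Set.range (-α)).Finite := (Set.finite_range _).image _
  have hne : (Complex.re '' Set.range (-α)).Nonempty := ⟨_, _, ⟨⟨0, hN⟩, rfl⟩, rfl⟩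
  obtain ⟨_, ⟨k, rfl⟩, hk⟩ := hne.csSup_mem hfin
  rw [← hk]
  simpa using h k

end SpectralConstants

/-! ### The scalar kernels and their real Gaussian majorant. -/

section ScalarKernel

/-- The scalar kernel `(4 π t a)^(-d/2) exp(-b t - r² / (4 t a))`. -/
noncomputable def scalarKernel (d : ℕ) (a b : ℂ) (t r : ℝ) : ℂ :=
  (((4 * Real.pi * t : ℝ) : ℂ) * a) ^ (-(d : ℂ) / 2)
    * Complex.exp (-((t : ℂ) * b) - ((r ^ 2 : ℝ) : ℂ) * (((4 * t : ℝ) : ℂ) * a)⁻¹)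

theorem continuous_scalarKernel (d : ℕ) (a b : ℂ) (t : ℝ) :
    Continuous fun r => scalarKernel d a b t r := by
  unfold scalarKernel
  fun_prop

theorem measurable_scalarKernel (d : ℕ) (a b : ℂ) :
    Measurable fun q : ℝ × ℝ => scalarKernel d a b q.1 q.2 := by
  unfold scalarKernel
  fun_prop

/-- The time scale `a_max² / a_0` of the Gaussian majorant. -/
noncomputable def gaussScale {N : ℕ} (A : Matrix (Fin N) (Fin N) ℂ) : ℝ :=
  aMax A ^ 2 / lowerAbscissa A

variable {N d : ℕ} (U : (Matrix (Fin N) (Fin N) ℂ)ˣ) (α β : Fin N → ℂ)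

theorem ne_zero_of_re_pos {α : Fin N → ℂ} (hα : ∀ k, 0 < (α k).re) (k : Fin N) : α k ≠ 0 := by
  intro h
  have := hα k
  simp [h] at this

theorem aMax_pos (hN : 1 ≤ N) (hα : ∀ k, 0 < (α k).re) : 0 < aMax (conjDiag U α) :=
  (norm_pos_iff.2 (ne_zero_of_re_pos hα ⟨0, hN⟩)).trans_le (norm_le_aMax U α _)

theorem gaussScale_pos (hN : 1 ≤ N) (hα : ∀ k, 0 < (α k).re) : 0 < gaussScale (conjDiag U α) :=
  div_pos (pow_pos (aMax_pos U α hN hα) 2) (lowerAbscissa_pos U α hN hα)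

theorem aOne_eq (A : Matrix (Fin N) (Fin N) ℂ) : aOne A = gaussScale A / aMin A := by
  rw [aOne, gaussScale, div_div, mul_comm (aMin A)]

/-- The exponent of the power is real, so only `|α k| ≥ a_min` matters for the prefactor. The decay
comes from `Re (1/α k) = Re (α k) / |α k|² ≥ a_0 / a_max²`. Normalizing the majorant with
`gaussScale` instead of `a_min` costs the factor `aOne ^ (d/2)`. -/
theorem norm_scalarKernel_le (hN : 1 ≤ N) (hα : ∀ k, 0 < (α k).re) (k : Fin N) {t : ℝ} (ht : 0 < t)
    (y : RSpace d) :
    ‖scalarKernel d (α k) (β k) t ‖y‖‖ ≤ aOne (conjDiag U α) ^ ((d : ℝ) / 2)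
      * Real.exp (-lowerAbscissa (conjDiag U β) * t)
      * gaussDensity (gaussScale (conjDiag U α) * t) y := by
  set A := conjDiag U α with hA
  have hpi := Real.pi_pos
  have hq := gaussScale_pos U α hN hα
  have hm := aMin_pos U α hN (ne_zero_of_re_pos hα)
  have hmk := aMin_le_norm U α (ne_zero_of_re_pos hα) k
  have h0 := lowerAbscissa_pos U α hN hα
  rw [← hA] at hq hm hmk h0
  have hk : 0 < ‖α k‖ := hm.trans_le hmk
  rw [scalarKernel, norm_mul, gaussDensity, Complex.norm_exp]
  have e1 : (-(d : ℂ) / 2) = ((-(d : ℝ) / 2 : ℝ) : ℂ) := by push_cast; ring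
  have b1 : ‖(((4 * Real.pi * t : ℝ) : ℂ) * α k) ^ (-(d : ℂ) / 2)‖
      ≤ aOne A ^ ((d : ℝ) / 2) * (4 * Real.pi * (gaussScale A * t)) ^ (-(d : ℝ) / 2) := by
    rw [e1, Complex.norm_cpow_real, norm_mul, Complex.norm_real,
      Real.norm_of_nonneg (by positivity), aOne_eq]
    have e2 : 4 * Real.pi * (gaussScale A * t)
        = (gaussScale A / aMin A) * (4 * Real.pi * t * aMin A) := by
      field_simp
    rw [e2, Real.mul_rpow (x := gaussScale A / aMin A) (by positivity) (by positivity), ← mul_assoc,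
      ← Real.rpow_add (by positivity)]
    have e3 : (d : ℝ) / 2 + -d / 2 = 0 := by ring
    rw [e3, Real.rpow_zero, one_mul]
    apply Real.rpow_le_rpow_of_nonpos (by positivity)
    · gcongr
    · have : (0 : ℝ) ≤ d := by positivity
      linarith
  have e4 : (-((t : ℂ) * β k) - ((‖y‖ ^ 2 : ℝ) : ℂ) * (((4 * t : ℝ) : ℂ) * α k)⁻¹).re
      = -(t * (β k).re) - ‖y‖ ^ 2 * ((4 * t)⁻¹ * ((α k).re / ‖α k‖ ^ 2)) := by
    rw [mul_inv, ← Complex.ofReal_inv, Complex.sub_re, Complex.neg_re, Complex.re_ofReal_mul,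
      Complex.re_ofReal_mul, Complex.re_ofReal_mul, Complex.inv_re, Complex.normSq_eq_norm_sq]
  have b2 : Real.exp (-((t : ℂ) * β k) - ((‖y‖ ^ 2 : ℝ) : ℂ) * (((4 * t : ℝ) : ℂ) * α k)⁻¹).re
      ≤ Real.exp (-lowerAbscissa (conjDiag U β) * t)
        * Real.exp (-(4 * (gaussScale A * t))⁻¹ * ‖y‖ ^ 2) := by
    rw [e4, ← Real.exp_add]
    apply Real.exp_le_exp.2
    have c1 : lowerAbscissa (conjDiag U β) * t ≤ t * (β k).re := by
      rw [mul_comm]; exact mul_le_mul_of_nonneg_left (lowerAbscissa_le_re U β k) ht.le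
    have c2 : (gaussScale A)⁻¹ ≤ (α k).re / ‖α k‖ ^ 2 := by
      rw [gaussScale, inv_div]
      exact div_le_div₀ (hα k).le (lowerAbscissa_le_re U α k) (by positivity)
        (by gcongr; exact norm_le_aMax U α k)
    have c3 : (4 * (gaussScale A * t))⁻¹ * ‖y‖ ^ 2
        ≤ ‖y‖ ^ 2 * ((4 * t)⁻¹ * ((α k).re / ‖α k‖ ^ 2)) := by
      have : (4 * (gaussScale A * t))⁻¹ = (4 * t)⁻¹ * (gaussScale A)⁻¹ := by
        rw [← mul_inv]; ring
      rw [this, mul_comm]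
      gcongr
    linarith
  calc _ ≤ (aOne A ^ ((d : ℝ) / 2) * (4 * Real.pi * (gaussScale A * t)) ^ (-(d : ℝ) / 2)) *
        (Real.exp (-lowerAbscissa (conjDiag U β) * t)
        * Real.exp (-(4 * (gaussScale A * t))⁻¹ * ‖y‖ ^ 2)) := by
          refine mul_le_mul b1 b2 (Real.exp_pos _).le ?_
          rw [aOne_eq]; positivity
    _ = _ := by ring

end ScalarKernel

/-! ### The rotations `e^{tS}` as isometries. -/

section Rotation

variable {d : ℕ} {S : Matrix (Fin d) (Fin d) ℝ}

theorem rotation_zero (S : Matrix (Fin d) (Fin d) ℝ) (x : RSpace d) : rotation S 0 x = x := by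
  simp [rotation]

theorem rotation_add (S : Matrix (Fin d) (Fin d) ℝ) (s t : ℝ) (x : RSpace d) :
    rotation S (s + t) x = rotation S s (rotation S t x) := by
  rw [rotation, add_smul, Matrix.exp_add_of_commute _ _
    (((Commute.refl S).smul_left s).smul_right t), map_mul]
  rfl

/-- Skew-symmetry makes the adjoint of `e^{tS}` equal to `e^{-tS}`, its inverse. -/
theorem norm_rotation (hS : S.transpose = -S) (t : ℝ) (x : RSpace d) :
    ‖rotation S t x‖ = ‖x‖ := by
  have hadj : ∀ x y : RSpace d, inner ℝ (rotation S t x) y = inner ℝ x (rotation S (-t) y) := by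
    intro x y
    have h1 : NormedSpace.exp ((-t) • S) = star (NormedSpace.exp (t • S)) := by
      rw [Matrix.star_eq_conjTranspose, Matrix.conjTranspose_eq_transpose_of_trivial,
        ← Matrix.exp_transpose, Matrix.transpose_smul, hS]
      simp
    rw [rotation, rotation, h1, map_star, ContinuousLinearMap.star_eq_adjoint,
      ContinuousLinearMap.adjoint_inner_right]
  have h2 : ‖rotation S t x‖ ^ 2 = ‖x‖ ^ 2 := by
    rw [← real_inner_self_eq_norm_sq, hadj, ← rotation_add, neg_add_cancel, rotation_zero,
      real_inner_self_eq_norm_sq]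
  exact (sq_eq_sq₀ (norm_nonneg _) (norm_nonneg _)).1 h2

/-- The rotation `e^{tS}` as a linear isometry. -/
noncomputable def rotationIso (hS : S.transpose = -S) (t : ℝ) : RSpace d ≃ₗᵢ[ℝ] RSpace d where
  toFun := rotation S t
  invFun := rotation S (-t)
  map_add' x y := by simp [rotation]
  map_smul' c x := by simp [rotation]
  left_inv x := by rw [← rotation_add, neg_add_cancel, rotation_zero]
  right_inv x := by rw [← rotation_add, add_neg_cancel, rotation_zero]
  norm_map' x := norm_rotation hS t x

theorem rotationIso_apply (hS : S.transpose = -S) (t : ℝ) (x : RSpace d) :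
    rotationIso hS t x = rotation S t x := rfl

theorem continuous_exp_smul_toEuclideanCLM (S : Matrix (Fin d) (Fin d) ℝ) :
    Continuous fun t : ℝ =>
      Matrix.toEuclideanCLM (n := Fin d) (𝕜 := ℝ) (NormedSpace.exp (t • S)) := by
  open scoped Matrix.Norms.L2Operator in
  have h1 : Continuous fun t : ℝ => NormedSpace.exp (t • S) := by
    let : NormedAlgebra ℚ (Matrix (Fin d) (Fin d) ℝ) := .restrictScalars ℚ ℝ _
    exact NormedSpace.exp_continuous.comp (continuous_id.smul continuous_const)
  have hl : Continuous (Matrix.toEuclideanCLM (n := Fin d) (𝕜 := ℝ)).toAlgEquiv.toLinearMap :=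
    LinearMap.continuous_of_finiteDimensional _
  exact hl.comp h1

theorem continuous_rotation (S : Matrix (Fin d) (Fin d) ℝ) :
    Continuous fun q : ℝ × RSpace d => rotation S q.1 q.2 :=
  ((continuous_exp_smul_toEuclideanCLM S).comp continuous_fst).clm_apply continuous_snd

theorem continuous_rotation_time (S : Matrix (Fin d) (Fin d) ℝ) (x : RSpace d) :
    Continuous fun t : ℝ => rotation S t x :=
  (continuous_exp_smul_toEuclideanCLM S).clm_apply continuous_const

end Rotation

/-! ### The heat kernel in diagonal form. -/

section KernelFormula

variable {N d : ℕ} (U : (Matrix (Fin N) (Fin N) ℂ)ˣ) (α β : Fin N → ℂ)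
  (S : Matrix (Fin d) (Fin d) ℝ)

theorem heatKernel_conjDiag (hα : ∀ k, α k ≠ 0) {t : ℝ} (ht : 0 < t) (x ξ : RSpace d) :
    heatKernel (conjDiag U α) (conjDiag U β) S x ξ t
      = conjDiag U fun k => scalarKernel d (α k) (β k) t ‖rotation S t x - ξ‖ := by
  have h4 : ((4 * t : ℝ) : ℂ) ≠ 0 := by
    rw [Complex.ofReal_ne_zero]; positivity
  rw [heatKernel, conjDiag_smul, conjDiag_smul, conjDiag_smul,
    conjDiag_inv U (((4 * t : ℝ) : ℂ) • α) (fun k => mul_ne_zero h4 (hα k)), conjDiag_smul, conjDiag_neg,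
    conjDiag_sub, exp_conjDiag]
  have := matrixFun_conj_diagonal (fun z => z ^ (-(d : ℂ) / 2)) U
    (((4 * Real.pi * t : ℝ) : ℂ) • α)
  rw [conjDiag, this]
  exact conjDiag_mul U _ _

theorem kernelApply_conjDiag (hα : ∀ k, α k ≠ 0) {t : ℝ} (ht : 0 < t) (v : RSpace d → CSpace N)
    (x ξ : RSpace d) :
    kernelApply (conjDiag U α) (conjDiag U β) S t v x ξ
      = ∑ k, scalarKernel d (α k) (β k) t ‖rotation S t x - ξ‖ • specProj U k (v ξ) := by
  rw [kernelApply, heatKernel_conjDiag U α β S hα ht, toEuclideanCLM_conjDiag]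

theorem norm_kernelApply_le (hN : 1 ≤ N) (hα : ∀ k, 0 < (α k).re) {t : ℝ} (ht : 0 < t)
    (v : RSpace d → CSpace N) (x ξ : RSpace d) :
    ‖kernelApply (conjDiag U α) (conjDiag U β) S t v x ξ‖
      ≤ condNumber U.val * aOne (conjDiag U α) ^ ((d : ℝ) / 2)
        * Real.exp (-lowerAbscissa (conjDiag U β) * t)
        * gaussDensity (gaussScale (conjDiag U α) * t) (rotation S t x - ξ) * ‖v ξ‖ := by
  rw [kernelApply, heatKernel_conjDiag U α β S (ne_zero_of_re_pos hα) ht]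
  refine (ContinuousLinearMap.le_opNorm _ _).trans ?_
  refine mul_le_mul_of_nonneg_right ?_ (norm_nonneg _)
  have h := specNorm_conjDiag_le U
    (fun k => scalarKernel d (α k) (β k) t ‖rotation S t x - ξ‖) ((norm_nonneg _).trans
      (norm_scalarKernel_le U α β hN hα ⟨0, hN⟩ ht (rotation S t x - ξ)))
    (fun k => norm_scalarKernel_le U α β hN hα k ht (rotation S t x - ξ))
  refine h.trans_eq (by ring)

end KernelFormula

/-! ### Weights and absolute convergence of Gaussian integrals. -/

section WeightBounds

variable {d : ℕ} {θ : RSpace d → ℝ} {η Cθ : ℝ}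

theorem IsRadialWeight.le_mul_exp_sub (hθ : IsRadialWeight θ η Cθ) (x ξ : RSpace d) :
    θ x ≤ Cθ * θ ξ * Real.exp (η * ‖x - ξ‖) := by
  have := hθ.growth ξ (x - ξ)
  rwa [add_sub_cancel] at this

theorem IsRadialWeight.eq_of_norm_eq (hθ : IsRadialWeight θ η Cθ) {x y : RSpace d}
    (h : ‖x‖ = ‖y‖) : θ x = θ y := by
  obtain ⟨φ, hφ⟩ := hθ.radial
  rw [hφ, hφ, h]

variable {N : ℕ} {p : ℝ≥0∞}

theorem ae_weightedMeasure_iff (hθ : IsRadialWeight θ η Cθ) (p : ℝ≥0∞) :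
    ae (weightedMeasure θ p) = ae (volume : Measure (RSpace d)) :=
  ae_weightedMeasure hθ.continuous hθ.pos p

theorem aestronglyMeasurable_of_weighted (hθ : IsRadialWeight θ η Cθ) {v : RSpace d → CSpace N}
    (hv : AEStronglyMeasurable v (weightedMeasure θ p)) :
    AEStronglyMeasurable v (volume : Measure (RSpace d)) :=
  hv.mono_ac (Measure.ae_le_iff_absolutelyContinuous.1 (ae_weightedMeasure_iff hθ p).ge)

theorem memLp_smul_of_weighted (hθ : IsRadialWeight θ η Cθ) (hp1 : 1 ≤ p) (hp : p ≠ ∞)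
    {v : RSpace d → CSpace N} (hv : MemLp v p (weightedMeasure θ p)) :
    MemLp (fun x => θ x • v x) p (volume : Measure (RSpace d)) := by
  refine ⟨hθ.continuous.aestronglyMeasurable.smul
    (aestronglyMeasurable_of_weighted hθ hv.aestronglyMeasurable), ?_⟩
  rw [← eLpNorm_weightedMeasure hθ.continuous hθ.pos (zero_lt_one.trans_le hp1).ne' hp]
  exact hv.2

/-- The growth condition inserts `θ ξ` at the cost of `exp(η |z - ξ|)`, which the Gaussian absorbs.
The bound `a ≤ 1 + a^p` then replaces Hölder and covers all `p` at once: one summand is an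
integrable Gaussian, the other a bounded function times `|θ v|^p`. -/
theorem integrable_gaussDensity_mul_norm (hθ : IsRadialWeight θ η Cθ) (hp1 : 1 ≤ p) (hp : p ≠ ∞)
    {v : RSpace d → CSpace N} (hv : MemLp v p (weightedMeasure θ p)) {τ : ℝ} (hτ : 0 < τ)
    (z : RSpace d) : Integrable fun ξ => gaussDensity τ (z - ξ) * ‖v ξ‖ := by
  have hm := aestronglyMeasurable_of_weighted hθ hv.aestronglyMeasurable
  have hpr : 1 ≤ p.toReal := by
    rw [← ENNReal.toReal_one]; exact ENNReal.toReal_mono hp hp1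
  have hI1 : Integrable fun ξ : RSpace d => Real.exp (η * ‖z - ξ‖) * gaussDensity τ (z - ξ) :=
    (integrable_exp_mul_gaussDensity hτ η).comp_sub_left z
  have hI2 : Integrable fun ξ : RSpace d => ‖θ ξ • v ξ‖ ^ p.toReal :=
    (memLp_smul_of_weighted hθ hp1 hp hv).integrable_norm_rpow (zero_lt_one.trans_le hp1).ne' hp
  -- `K` bounds `exp(η|y|) * gaussDensity τ y` uniformly: it is the majorant of
  -- `exp_mul_gaussDensity_le` for `ε = 1`, evaluated at `y = 0`.
  set K : ℝ := Real.exp ((1 + 1) * (η ^ 2 * τ)) * (4 * Real.pi * τ) ^ (-(d : ℝ) / 2) with hK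
  have hpi := Real.pi_pos
  have hbd : ∀ y : RSpace d, Real.exp (η * ‖y‖) * gaussDensity τ y ≤ K := fun y => by
    refine (exp_mul_gaussDensity_le one_pos hτ y).trans ?_
    rw [hK]
    refine mul_le_mul_of_nonneg_left ?_ (Real.exp_pos _).le
    refine mul_le_of_le_one_right (by positivity) (Real.exp_le_one_iff.2 ?_)
    rw [neg_mul]
    exact neg_nonpos.2 (by positivity)
  refine ((hI1.add (hI2.const_mul K)).const_mul (Cθ / θ z)).mono' ?_
    (Eventually.of_forall fun ξ => ?_)
  · exact (continuous_gaussDensity.comp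
      (continuous_const.sub continuous_id)).aestronglyMeasurable.mul hm.norm
  · have hg := gaussDensity_nonneg hτ.le (z - ξ)
    have hθξ := hθ.pos ξ
    have hθz := hθ.pos z
    have hC := hθ.const_pos
    rw [Real.norm_of_nonneg (mul_nonneg hg (norm_nonneg _)), Pi.add_apply]
    have h1 : 1 ≤ Cθ / θ z * (θ ξ * Real.exp (η * ‖z - ξ‖)) := by
      rw [div_mul_eq_mul_div, one_le_div hθz, ← mul_assoc]
      exact hθ.le_mul_exp_sub z ξ
    have h2 : ‖θ ξ • v ξ‖ ≤ 1 + ‖θ ξ • v ξ‖ ^ p.toReal := by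
      rcases le_total ‖θ ξ • v ξ‖ 1 with h | h
      · exact h.trans (le_add_of_nonneg_right (by positivity))
      · have := Real.rpow_le_rpow_of_exponent_le h hpr
        rw [Real.rpow_one] at this
        linarith
    have h3 : ‖θ ξ • v ξ‖ = θ ξ * ‖v ξ‖ := by rw [norm_smul, Real.norm_of_nonneg hθξ.le]
    set E := Real.exp (η * ‖z - ξ‖) * gaussDensity τ (z - ξ) with hE
    have hE0 : 0 ≤ E := mul_nonneg (Real.exp_pos _).le hg
    calc gaussDensity τ (z - ξ) * ‖v ξ‖
        ≤ gaussDensity τ (z - ξ) * ‖v ξ‖ * (Cθ / θ z * (θ ξ * Real.exp (η * ‖z - ξ‖))) :=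
          le_mul_of_one_le_right (mul_nonneg hg (norm_nonneg _)) h1
      _ = Cθ / θ z * (E * ‖θ ξ • v ξ‖) := by rw [h3, hE]; ring
      _ ≤ Cθ / θ z * (E * (1 + ‖θ ξ • v ξ‖ ^ p.toReal)) := by gcongr
      _ = Cθ / θ z * (E + E * ‖θ ξ • v ξ‖ ^ p.toReal) := by ring
      _ ≤ Cθ / θ z * (E + K * ‖θ ξ • v ξ‖ ^ p.toReal) := by
          gcongr
          exact hbd _

end WeightBounds

/-! ### Well-definedness and operator norm of `T(t)` on the weighted space. -/

section NormBound

variable {d N : ℕ} {U : (Matrix (Fin N) (Fin N) ℂ)ˣ} {α β : Fin N → ℂ}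
  {S : Matrix (Fin d) (Fin d) ℝ} {θ : RSpace d → ℝ} {η Cθ : ℝ} {p : ℝ≥0∞}

theorem integrable_scalarKernel_smul (hN : 1 ≤ N) (U : (Matrix (Fin N) (Fin N) ℂ)ˣ)
    (hα : ∀ k, 0 < (α k).re) (β : Fin N → ℂ)
    (hθ : IsRadialWeight θ η Cθ) (hp1 : 1 ≤ p) (hp : p ≠ ∞)
    {v : RSpace d → CSpace N} (hv : MemLp v p (weightedMeasure θ p)) (k : Fin N) {t : ℝ}
    (ht : 0 < t) (z : RSpace d) :
    Integrable fun ξ => scalarKernel d (α k) (β k) t ‖z - ξ‖ • v ξ := by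
  have hm := aestronglyMeasurable_of_weighted hθ hv.aestronglyMeasurable
  have hq := mul_pos (gaussScale_pos U α hN hα) ht
  refine ((integrable_gaussDensity_mul_norm hθ hp1 hp hv hq z).const_mul
    (aOne (conjDiag U α) ^ ((d : ℝ) / 2)
      * Real.exp (-lowerAbscissa (conjDiag U β) * t))).mono' ?_ (Eventually.of_forall fun ξ => ?_)
  · exact ((continuous_scalarKernel d (α k) (β k) t).comp
      (continuous_const.sub continuous_id).norm).aestronglyMeasurable.smul hm
  · rw [norm_smul, ← mul_assoc]
    exact mul_le_mul_of_nonneg_right (norm_scalarKernel_le U α β hN hα k ht (z - ξ))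
      (norm_nonneg _)

theorem memLp_specProj {μ : Measure (RSpace d)} {v : RSpace d → CSpace N} (hv : MemLp v p μ)
    (U : (Matrix (Fin N) (Fin N) ℂ)ˣ) (k : Fin N) : MemLp (fun x => specProj U k (v x)) p μ :=
  (specProj U k).comp_memLp' hv

theorem integrable_kernelApply (hN : 1 ≤ N) (hα : ∀ k, 0 < (α k).re)
    (hθ : IsRadialWeight θ η Cθ) (hp1 : 1 ≤ p) (hp : p ≠ ∞)
    {v : RSpace d → CSpace N} (hv : MemLp v p (weightedMeasure θ p)) {t : ℝ}
    (ht : 0 < t) (x : RSpace d) :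
    Integrable (kernelApply (conjDiag U α) (conjDiag U β) S t v x) := by
  have : kernelApply (conjDiag U α) (conjDiag U β) S t v x = fun ξ =>
      ∑ k, scalarKernel d (α k) (β k) t ‖rotation S t x - ξ‖ • specProj U k (v ξ) := by
    ext1 ξ
    exact kernelApply_conjDiag U α β S (ne_zero_of_re_pos hα) ht v x ξ
  rw [this]
  exact integrable_finsetSum _ fun k _ =>
    integrable_scalarKernel_smul hN U hα β hθ hp1 hp (memLp_specProj hv U k) k ht _

/-- The scalar components of the semigroup. -/
noncomputable def scalarOp (a b : ℂ) (S : Matrix (Fin d) (Fin d) ℝ) (t : ℝ)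
    (w : RSpace d → CSpace N) (x : RSpace d) : CSpace N :=
  ∫ ξ, scalarKernel d a b t ‖rotation S t x - ξ‖ • w ξ

theorem semigroupFun_conjDiag (hN : 1 ≤ N) (hα : ∀ k, 0 < (α k).re)
    (hθ : IsRadialWeight θ η Cθ) (hp1 : 1 ≤ p) (hp : p ≠ ∞)
    {v : RSpace d → CSpace N} (hv : MemLp v p (weightedMeasure θ p)) {t : ℝ}
    (ht : 0 < t) (x : RSpace d) :
    semigroupFun (conjDiag U α) (conjDiag U β) S t v x
      = ∑ k, scalarOp (α k) (β k) S t (fun ξ => specProj U k (v ξ)) x := by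
  rw [semigroupFun, if_pos ht]
  simp_rw [kernelApply_conjDiag U α β S (ne_zero_of_re_pos hα) ht v x]
  exact integral_finsetSum _ fun k _ =>
    integrable_scalarKernel_smul hN U hα β hθ hp1 hp (memLp_specProj hv U k) k ht _

/-- Measurability jointly in `(t, x)` is needed later to evaluate the Laplace integral pointwise. -/
theorem stronglyMeasurable_integral_kernelApply (U : (Matrix (Fin N) (Fin N) ℂ)ˣ)
    (α β : Fin N → ℂ) (S : Matrix (Fin d) (Fin d) ℝ) {v : RSpace d → CSpace N}
    (hv : StronglyMeasurable v) :
    StronglyMeasurable fun q : ℝ × RSpace d =>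
      ∫ ξ, ∑ k, scalarKernel d (α k) (β k) q.1 ‖rotation S q.1 q.2 - ξ‖ • specProj U k (v ξ) := by
  refine StronglyMeasurable.integral_prod_right
    (f := fun (q : ℝ × RSpace d) (ξ : RSpace d) => ∑ k,
      scalarKernel d (α k) (β k) q.1 ‖rotation S q.1 q.2 - ξ‖ • specProj U k (v ξ)) ?_
  refine Finset.stronglyMeasurable_fun_sum _ fun k _ => ?_
  have hr : Measurable fun z : (ℝ × RSpace d) × RSpace d => ‖rotation S z.1.1 z.1.2 - z.2‖ :=
    (((continuous_rotation S).comp continuous_fst).sub continuous_snd).norm.measurable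
  have h1 : StronglyMeasurable fun z : (ℝ × RSpace d) × RSpace d =>
      scalarKernel d (α k) (β k) z.1.1 ‖rotation S z.1.1 z.1.2 - z.2‖ :=
    ((measurable_scalarKernel d (α k) (β k)).comp
      ((measurable_fst.comp measurable_fst).prodMk hr)).stronglyMeasurable
  have h2 : StronglyMeasurable fun z : (ℝ × RSpace d) × RSpace d => specProj U k (v z.2) :=
    (specProj U k).continuous.comp_stronglyMeasurable (hv.comp_measurable measurable_snd)
  exact h1.smul h2

theorem stronglyMeasurable_semigroupFun (hα : ∀ k, 0 < (α k).re)
    {v : RSpace d → CSpace N} (hv : StronglyMeasurable v) (t : ℝ) :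
    StronglyMeasurable (semigroupFun (conjDiag U α) (conjDiag U β) S t v) := by
  by_cases ht : 0 < t
  · have := (stronglyMeasurable_integral_kernelApply U α β S hv).comp_measurable
      (g := fun x : RSpace d => (t, x)) (by fun_prop)
    convert this using 1
    ext1 x
    rw [semigroupFun, if_pos ht]
    simp_rw [kernelApply_conjDiag U α β S (ne_zero_of_re_pos hα) ht v x]
    rfl
  · have : semigroupFun (conjDiag U α) (conjDiag U β) S t v = v := by
      ext1 x
      rw [semigroupFun, if_neg ht]
    rwa [this]

/-- Radiality gives `θ x = θ (e^{tS}x)`, and the growth condition moves the weight to `ξ`. After `y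
= e^{tS}x - ξ` the right side is a convolution evaluated at the rotated point. Working in `ℝ≥0∞`
requires no integrability of the majorant. -/
theorem ofReal_mul_enorm_semigroupFun_le (hN : 1 ≤ N) (hα : ∀ k, 0 < (α k).re)
    (hS : S.transpose = -S) (hθ : IsRadialWeight θ η Cθ) {v : RSpace d → CSpace N} {t : ℝ}
    (ht : 0 < t) (x : RSpace d) :
    ENNReal.ofReal (θ x) * ‖semigroupFun (conjDiag U α) (conjDiag U β) S t v x‖ₑ
      ≤ ENNReal.ofReal (Cθ * (condNumber U.val * aOne (conjDiag U α) ^ ((d : ℝ) / 2)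
          * Real.exp (-lowerAbscissa (conjDiag U β) * t)))
        * ∫⁻ y, ENNReal.ofReal (gaussDensity (gaussScale (conjDiag U α) * t) y)
          * (ENNReal.ofReal (Real.exp (η * ‖y‖))
            * (ENNReal.ofReal (θ (rotation S t x - y)) * ‖v (rotation S t x - y)‖ₑ)) := by
  set c := condNumber U.val * aOne (conjDiag U α) ^ ((d : ℝ) / 2)
          * Real.exp (-lowerAbscissa (conjDiag U β) * t) with hc
  set z := rotation S t x with hz
  have hq := mul_pos (gaussScale_pos U α hN hα) ht
  have hc0 : 0 ≤ c := by
    have h1 := condNumber_nonneg U.val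
    have h2 : 0 ≤ aOne (conjDiag U α) := by
      rw [aOne_eq]
      exact div_nonneg (gaussScale_pos U α hN hα).le
        (aMin_pos U α hN (ne_zero_of_re_pos hα)).le
    positivity
  have hxz : θ x = θ z := hθ.eq_of_norm_eq (norm_rotation hS t x).symm
  have hC := hθ.const_pos
  rw [semigroupFun, if_pos ht]
  calc ENNReal.ofReal (θ x) * ‖∫ ξ, kernelApply (conjDiag U α) (conjDiag U β) S t v x ξ‖ₑ
      ≤ ENNReal.ofReal (θ x) * ∫⁻ ξ, ‖kernelApply (conjDiag U α) (conjDiag U β) S t v x ξ‖ₑ := by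
        gcongr; exact enorm_integral_le_lintegral_enorm _
    _ = ∫⁻ ξ, ENNReal.ofReal (θ x) * ‖kernelApply (conjDiag U α) (conjDiag U β) S t v x ξ‖ₑ :=
        (lintegral_const_mul' _ _ ENNReal.ofReal_ne_top).symm
    _ ≤ ∫⁻ ξ, (fun y => ENNReal.ofReal (Cθ * c)
          * (ENNReal.ofReal (gaussDensity (gaussScale (conjDiag U α) * t) y)
          * (ENNReal.ofReal (Real.exp (η * ‖y‖))
            * (ENNReal.ofReal (θ (z - y)) * ‖v (z - y)‖ₑ)))) (z - ξ) := by
        refine lintegral_mono fun ξ => ?_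
        simp only [sub_sub_cancel]
        have hg := gaussDensity_nonneg hq.le (z - ξ)
        rw [← ofReal_norm, ← ofReal_norm (v ξ), ← ENNReal.ofReal_mul (hθ.pos _).le,
          ← ENNReal.ofReal_mul (hθ.pos _).le, ← ENNReal.ofReal_mul (Real.exp_pos _).le,
          ← ENNReal.ofReal_mul hg, ← ENNReal.ofReal_mul (by positivity)]
        refine ENNReal.ofReal_le_ofReal ?_
        have h1 := norm_kernelApply_le U α β S hN hα ht v x ξ
        have h2 := hθ.le_mul_exp_sub z ξ
        rw [hxz]
        calc θ z * ‖kernelApply (conjDiag U α) (conjDiag U β) S t v x ξ‖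
            ≤ (Cθ * θ ξ * Real.exp (η * ‖z - ξ‖)) *
              (c * gaussDensity (gaussScale (conjDiag U α) * t) (z - ξ) * ‖v ξ‖) := by
              refine mul_le_mul h2 h1 (norm_nonneg _) ?_
              have := (hθ.pos ξ).le
              positivity
          _ = _ := by ring
    _ = ∫⁻ y, ENNReal.ofReal (Cθ * c)
          * (ENNReal.ofReal (gaussDensity (gaussScale (conjDiag U α) * t) y)
          * (ENNReal.ofReal (Real.exp (η * ‖y‖))
            * (ENNReal.ofReal (θ (z - y)) * ‖v (z - y)‖ₑ))) :=
        lintegral_sub_left_eq_self (μ := volume) (fun y => ENNReal.ofReal (Cθ * c)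
          * (ENNReal.ofReal (gaussDensity (gaussScale (conjDiag U α) * t) y)
          * (ENNReal.ofReal (Real.exp (η * ‖y‖))
            * (ENNReal.ofReal (θ (z - y)) * ‖v (z - y)‖ₑ)))) z
    _ = _ := lintegral_const_mul' _ _ ENNReal.ofReal_ne_top

/-- For `r = p` this is the factor that Young's inequality produces from the weight `exp(η|y|)`. -/
theorem lintegral_exp_rpow_gaussDensity (hd : 1 ≤ d) {τ : ℝ} (hτ : 0 < τ) (hη : 0 ≤ η) {r : ℝ}
    (hr : 0 ≤ r) :
    ∫⁻ y : RSpace d, ENNReal.ofReal (Real.exp (η * ‖y‖)) ^ r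
        ∂(volume.withDensity fun y => ENNReal.ofReal (gaussDensity τ y))
      = ENNReal.ofReal (kummerBracket d ((η * r) ^ 2 * τ)) := by
  rw [lintegral_withDensity_eq_lintegral_mul _ (by fun_prop) (by fun_prop),
    ← integral_exp_mul_gaussDensity hd hτ (mul_nonneg hη hr),
    ofReal_integral_eq_lintegral_ofReal (integrable_exp_mul_gaussDensity hτ _)
      (Eventually.of_forall fun y => mul_nonneg (Real.exp_pos _).le (gaussDensity_nonneg hτ.le y))]
  refine lintegral_congr fun y => ?_
  rw [Pi.mul_apply, ENNReal.ofReal_rpow_of_pos (Real.exp_pos _), ← Real.exp_mul, mul_comm,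
    ← ENNReal.ofReal_mul (Real.exp_pos _).le]
  congr 3
  ring

/-- The operator norm bound for `T(t)` on `L^p_θ`. -/
theorem eLpNorm_semigroupFun_le (hd : 1 ≤ d) (hN : 1 ≤ N) (hα : ∀ k, 0 < (α k).re)
    (hS : S.transpose = -S) (hθ : IsRadialWeight θ η Cθ) (hp1 : 1 ≤ p) (hp : p ≠ ∞)
    {v : RSpace d → CSpace N} (hv : StronglyMeasurable v) {t : ℝ} (ht : 0 < t) :
    eLpNorm (semigroupFun (conjDiag U α) (conjDiag U β) S t v) p (weightedMeasure θ p)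
      ≤ ENNReal.ofReal (Cθ * (condNumber U.val * aOne (conjDiag U α) ^ ((d : ℝ) / 2)
          * Real.exp (-lowerAbscissa (conjDiag U β) * t))
          * kummerBracket d (nuConst (conjDiag U α) η p * t) ^ (1 / p.toReal))
        * eLpNorm v p (weightedMeasure θ p) := by
  have hp0 : p ≠ 0 := (zero_lt_one.trans_le hp1).ne'
  have hpr : 1 ≤ p.toReal := by
    rw [← ENNReal.toReal_one]; exact ENNReal.toReal_mono hp hp1
  have hpr0 : 0 < p.toReal := by linarith
  set c := Cθ * (condNumber U.val * aOne (conjDiag U α) ^ ((d : ℝ) / 2)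
          * Real.exp (-lowerAbscissa (conjDiag U β) * t)) with hc
  set τ := gaussScale (conjDiag U α) * t with hτdef
  have hτ : 0 < τ := mul_pos (gaussScale_pos U α hN hα) ht
  have hc0 : 0 ≤ c := by
    have h1 := condNumber_nonneg U.val
    have h2 : 0 ≤ aOne (conjDiag U α) := by
      rw [aOne_eq]
      exact div_nonneg (gaussScale_pos U α hN hα).le
        (aMin_pos U α hN (ne_zero_of_re_pos hα)).le
    have h3 := hθ.const_pos
    positivity
  -- The argument `νt` of the Kummer bracket is the squared exponent `ηp` times the Gaussian time
  -- `τ`.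
  have hν : nuConst (conjDiag U α) η p * t = (η * p.toReal) ^ 2 * τ := by
    rw [nuConst, hτdef, gaussScale]; ring
  have hbr : 0 ≤ kummerBracket d (nuConst (conjDiag U α) η p * t) := by
    rw [hν]; exact kummerBracket_nonneg hd (by positivity)
  set γ : Measure (RSpace d) := volume.withDensity fun y => ENNReal.ofReal (gaussDensity τ y)
    with hγ
  have hγp : IsProbabilityMeasure γ := by
    refine ⟨?_⟩
    rw [hγ, withDensity_apply _ MeasurableSet.univ, Measure.restrict_univ,
      ← ofReal_integral_eq_lintegral_ofReal (integrable_gaussDensity hτ)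
        (Eventually.of_forall fun y => gaussDensity_nonneg hτ.le y), integral_gaussDensity hτ,
      ENNReal.ofReal_one]
  set u : RSpace d → ℝ≥0∞ := fun x => ENNReal.ofReal (θ x) * ‖v x‖ₑ with hu
  have hum : Measurable u := by
    have := hθ.continuous.measurable
    have := hv.measurable
    fun_prop
  set w : RSpace d → ℝ≥0∞ := fun y => ENNReal.ofReal (Real.exp (η * ‖y‖)) with hw
  have hwm : Measurable w := by fun_prop
  set F : RSpace d → ℝ≥0∞ := fun z => ∫⁻ y, w y * u (z - y) ∂γ with hF
  have hFm : Measurable F := by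
    refine Measurable.lintegral_prod_right ?_
    fun_prop
  have hFe : ∀ z, F z = ∫⁻ y, ENNReal.ofReal (gaussDensity τ y) * (w y * u (z - y)) := by
    intro z
    rw [hF, hγ]
    simp only
    rw [lintegral_withDensity_eq_lintegral_mul _ (by fun_prop) (by fun_prop)]
    rfl
  have hpt : ∀ x, ‖θ x • semigroupFun (conjDiag U α) (conjDiag U β) S t v x‖ₑ
      ≤ ENNReal.ofReal c * F (rotationIso hS t x) := by
    intro x
    rw [enorm_smul, Real.enorm_eq_ofReal (hθ.pos x).le, hFe]
    exact ofReal_mul_enorm_semigroupFun_le hN hα hS hθ ht x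
  rw [eLpNorm_weightedMeasure hθ.continuous hθ.pos hp0 hp,
    eLpNorm_weightedMeasure hθ.continuous hθ.pos hp0 hp,
    eLpNorm_eq_lintegral_rpow_enorm_toReal hp0 hp, eLpNorm_eq_lintegral_rpow_enorm_toReal hp0 hp]
  have hu' : ∀ x, ‖θ x • v x‖ₑ = u x := fun x => by
    rw [enorm_smul, Real.enorm_eq_ofReal (hθ.pos x).le]
  simp_rw [hu']
  have hint : ∫⁻ x, ‖θ x • semigroupFun (conjDiag U α) (conjDiag U β) S t v x‖ₑ ^ p.toReal
      ≤ ENNReal.ofReal c ^ p.toReal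
        * (ENNReal.ofReal (kummerBracket d (nuConst (conjDiag U α) η p * t))
          * ∫⁻ x, u x ^ p.toReal) := by
    calc _ ≤ ∫⁻ x, ENNReal.ofReal c ^ p.toReal * F (rotationIso hS t x) ^ p.toReal := by
          refine lintegral_mono fun x => ?_
          rw [← ENNReal.mul_rpow_of_nonneg _ _ hpr0.le]
          gcongr
          exact hpt x
      _ = ENNReal.ofReal c ^ p.toReal * ∫⁻ z, F z ^ p.toReal := by
          rw [lintegral_const_mul' _ _ (ENNReal.rpow_ne_top_of_nonneg hpr0.le
            ENNReal.ofReal_ne_top)]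
          congr 1
          -- The rotation preserves Lebesgue measure, so it disappears from the norm.
          exact (rotationIso hS t).measurePreserving.lintegral_comp (hFm.pow_const _)
      _ ≤ _ := by
          gcongr
          refine (lintegral_rpow_convolution_le volume γ hwm hum hpr).trans_eq ?_
          rw [hν, hw, hγ, lintegral_exp_rpow_gaussDensity hd hτ hθ.eta_nonneg hpr0.le]
  refine (ENNReal.rpow_le_rpow hint (by positivity)).trans_eq ?_
  have hinv : (0 : ℝ) ≤ 1 / p.toReal := by positivity
  rw [ENNReal.mul_rpow_of_nonneg _ _ hinv, ENNReal.mul_rpow_of_nonneg _ _ hinv,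
    ← ENNReal.rpow_mul, mul_one_div_cancel hpr0.ne', ENNReal.rpow_one,
    ENNReal.ofReal_rpow_of_nonneg hbr hinv, ENNReal.ofReal_mul hc0, mul_assoc]

theorem memLp_semigroupFun (hd : 1 ≤ d) (hN : 1 ≤ N) (hα : ∀ k, 0 < (α k).re)
    (hS : S.transpose = -S) (hθ : IsRadialWeight θ η Cθ) (hp1 : 1 ≤ p) (hp : p ≠ ∞)
    {v : RSpace d → CSpace N} (hv : StronglyMeasurable v) (hvp : MemLp v p (weightedMeasure θ p))
    (t : ℝ) :
    MemLp (semigroupFun (conjDiag U α) (conjDiag U β) S t v) p (weightedMeasure θ p) := by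
  refine ⟨(stronglyMeasurable_semigroupFun hα hv t).aestronglyMeasurable, ?_⟩
  by_cases ht : 0 < t
  · exact (eLpNorm_semigroupFun_le hd hN hα hS hθ hp1 hp hv ht).trans_lt
      (ENNReal.mul_lt_top ENNReal.ofReal_lt_top hvp.2)
  · have : semigroupFun (conjDiag U α) (conjDiag U β) S t v = v := by
      ext1 x
      rw [semigroupFun, if_neg ht]
    rw [this]
    exact hvp.2

end NormBound

/-! ### Chapman–Kolmogorov identity and the semigroup law. -/

section ChapmanKolmogorov

variable {d N : ℕ}

/-- Completing the square in `ξ` around a weighted mean of `u` and `z`: it makes the product of two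
Gaussians a Gaussian in `ξ` times one in `u - z`. -/
theorem norm_sq_div_add_norm_sq_div {E : Type*} [NormedAddCommGroup E] [InnerProductSpace ℝ E]
    {s t : ℝ} (hs : 0 < s) (ht : 0 < t) (u z ξ : E) :
    ‖u - ξ‖ ^ 2 / t + ‖ξ - z‖ ^ 2 / s
      = (t + s) / (t * s) * ‖ξ - ((s / (t + s)) • u + (t / (t + s)) • z)‖ ^ 2
        + ‖u - z‖ ^ 2 / (t + s) := by
  have hts : t + s ≠ 0 := by positivity
  set ζ := ξ - ((s / (t + s)) • u + (t / (t + s)) • z) with hζ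
  have e1 : u - ξ = (t / (t + s)) • (u - z) - ζ := by
    have : u = (t / (t + s)) • u + (s / (t + s)) • u := by
      rw [← add_smul, ← add_div, div_self hts, one_smul]
    rw [hζ, smul_sub]
    nth_rewrite 1 [this]
    abel
  have e2 : ξ - z = (s / (t + s)) • (u - z) + ζ := by
    have : z = (t / (t + s)) • z + (s / (t + s)) • z := by
      rw [← add_smul, ← add_div, div_self hts, one_smul]
    rw [hζ, smul_sub]
    nth_rewrite 1 [this]
    abel
  rw [e1, e2, norm_sub_sq_real, norm_add_sq_real, norm_smul, norm_smul, real_inner_smul_left,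
    real_inner_smul_left, Real.norm_of_nonneg (by positivity), Real.norm_of_nonneg (by positivity)]
  field_simp
  ring

/-- For positive `x` the principal logarithm satisfies `log (x z) = log x + log z`. All powers of
positive multiples of `a` thus share the same `log a`, and their exponents add without branch
corrections. -/
theorem ofReal_mul_cpow {x : ℝ} (hx : 0 < x) {z : ℂ} (hz : z ≠ 0) (w : ℂ) :
    ((x : ℂ) * z) ^ w = Complex.exp (((Real.log x : ℝ) + Complex.log z) * w) := by
  rw [Complex.cpow_def_of_ne_zero (mul_ne_zero (Complex.ofReal_ne_zero.2 hx.ne') hz),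
    Complex.log_ofReal_mul hx hz]

theorem inv_re_pos {a : ℂ} (ha : 0 < a.re) : 0 < (a⁻¹).re := by
  rw [Complex.inv_re]
  refine div_pos ha (Complex.normSq_pos.2 fun h => ?_)
  simp [h] at ha

theorem integral_cexp_neg_mul_norm_sq {c : ℂ} (hc : 0 < c.re) :
    ∫ y : RSpace d, Complex.exp (-c * (‖y‖ : ℂ) ^ 2) = (Real.pi / c) ^ ((d : ℂ) / 2) := by
  simpa using GaussianFourier.integral_cexp_neg_mul_sq_norm (V := RSpace d) hc

theorem integral_scalarKernel_mul {a : ℂ} (ha : 0 < a.re) (b : ℂ) {s t : ℝ} (hs : 0 < s)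
    (ht : 0 < t) (u z : RSpace d) :
    ∫ ξ : RSpace d, scalarKernel d a b t ‖u - ξ‖ * scalarKernel d a b s ‖ξ - z‖
      = scalarKernel d a b (t + s) ‖u - z‖ := by
  have ha0 : a ≠ 0 := fun h => by simp [h] at ha
  have hpi := Real.pi_pos
  have hts : 0 < t + s := by positivity
  have htC : (t : ℂ) ≠ 0 := Complex.ofReal_ne_zero.2 ht.ne'
  have hsC : (s : ℂ) ≠ 0 := Complex.ofReal_ne_zero.2 hs.ne'
  have htsC : (t : ℂ) + s ≠ 0 := by exact_mod_cast hts.ne'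
  set m := (s / (t + s)) • u + (t / (t + s)) • z with hm
  set c : ℂ := (((t + s) / (4 * (t * s)) : ℝ) : ℂ) * a⁻¹ with hc
  have hcre : 0 < c.re := by
    rw [hc, Complex.re_ofReal_mul]
    exact mul_pos (by positivity) (inv_re_pos ha)
  have hcomb : ∀ ξ : RSpace d, scalarKernel d a b t ‖u - ξ‖ * scalarKernel d a b s ‖ξ - z‖
      = (((4 * Real.pi * t : ℝ) : ℂ) * a) ^ (-(d : ℂ) / 2)
        * (((4 * Real.pi * s : ℝ) : ℂ) * a) ^ (-(d : ℂ) / 2)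
        * Complex.exp (-(((t + s : ℝ) : ℂ) * b)
          - ((‖u - z‖ ^ 2 : ℝ) : ℂ) * (((4 * (t + s) : ℝ) : ℂ) * a)⁻¹)
        * Complex.exp (-c * (‖ξ - m‖ : ℂ) ^ 2) := by
    intro ξ
    have hsq := norm_sq_div_add_norm_sq_div hs ht u z ξ
    have hsqC : ((‖u - ξ‖ ^ 2 : ℝ) : ℂ) / t + ((‖ξ - z‖ ^ 2 : ℝ) : ℂ) / s
      = (t + s) / (t * s) * ((‖ξ - m‖ : ℂ)) ^ 2 + ((‖u - z‖ ^ 2 : ℝ) : ℂ) / (t + s) := by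
      rw [← hm] at hsq
      exact_mod_cast hsq
    rw [scalarKernel, scalarKernel]
    rw [mul_mul_mul_comm, ← Complex.exp_add, mul_assoc (_ * _) (Complex.exp _), ← Complex.exp_add]
    congr 2
    have e1 : -((t : ℂ) * b) - ((‖u - ξ‖ ^ 2 : ℝ) : ℂ) * (((4 * t : ℝ) : ℂ) * a)⁻¹
        + (-((s : ℂ) * b) - ((‖ξ - z‖ ^ 2 : ℝ) : ℂ) * (((4 * s : ℝ) : ℂ) * a)⁻¹)
        = -(t + s) * b - (((‖u - ξ‖ ^ 2 : ℝ) : ℂ) / t + ((‖ξ - z‖ ^ 2 : ℝ) : ℂ) / s)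
          * (4 * a)⁻¹ := by
      generalize ((‖u - ξ‖ ^ 2 : ℝ) : ℂ) = X
      generalize ((‖ξ - z‖ ^ 2 : ℝ) : ℂ) = Y
      push_cast
      field_simp
      ring
    rw [e1, hsqC, hc]
    generalize ((‖u - z‖ ^ 2 : ℝ) : ℂ) = X
    generalize (‖ξ - m‖ : ℂ) = Y
    push_cast
    field_simp
    ring
  simp_rw [hcomb]
  rw [integral_const_mul, integral_sub_right_eq_self
    (fun ξ : RSpace d => Complex.exp (-c * (‖ξ‖ : ℂ) ^ 2)) m,
    integral_cexp_neg_mul_norm_sq hcre, scalarKernel]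
  have e2 : (Real.pi : ℂ) / c = ((4 * Real.pi * (t * s) / (t + s) : ℝ) : ℂ) * a := by
    rw [hc]; push_cast; field_simp
  rw [e2, mul_right_comm, ofReal_mul_cpow (by positivity) ha0, ofReal_mul_cpow (by positivity) ha0,
    ofReal_mul_cpow (by positivity) ha0, ofReal_mul_cpow (by positivity) ha0, ← Complex.exp_add,
    ← Complex.exp_add]
  congr 2
  have hlog : Real.log (4 * Real.pi * t) + Real.log (4 * Real.pi * s)
      - Real.log (4 * Real.pi * (t * s) / (t + s)) = Real.log (4 * Real.pi * (t + s)) := by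
    rw [← Real.log_mul (by positivity) (by positivity),
      ← Real.log_div (by positivity) (by positivity)]
    congr 1
    field_simp
  rw [← hlog]
  push_cast
  ring

/-- The real Gaussian density is the case `a = 1`, `b = 0`, so it inherits the convolution identity.
-/
theorem scalarKernel_one_zero {τ : ℝ} (hτ : 0 < τ) (y : RSpace d) :
    scalarKernel d 1 0 τ ‖y‖ = (gaussDensity τ y : ℂ) := by
  have hpi := Real.pi_pos
  have h : ((gaussDensity τ y : ℝ) : ℂ) = ((4 * Real.pi * τ : ℝ) : ℂ) ^ ((-(d : ℝ) / 2 : ℝ) : ℂ)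
      * Complex.exp ((-(4 * τ)⁻¹ * ‖y‖ ^ 2 : ℝ) : ℂ) := by
    rw [← Complex.ofReal_cpow (by positivity), ← Complex.ofReal_exp, ← Complex.ofReal_mul]
    rfl
  rw [h, scalarKernel]
  push_cast
  congr 2 <;> ring

theorem integral_gaussDensity_mul {s t : ℝ} (hs : 0 < s) (ht : 0 < t) (u z : RSpace d) :
    ∫ ξ : RSpace d, gaussDensity t (u - ξ) * gaussDensity s (ξ - z)
      = gaussDensity (t + s) (u - z) := by
  have h := integral_scalarKernel_mul (d := d) (a := 1) (by simp) 0 hs ht u z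
  simp_rw [scalarKernel_one_zero ht, scalarKernel_one_zero hs] at h
  rw [scalarKernel_one_zero (by positivity)] at h
  simp_rw [← Complex.ofReal_mul] at h
  rw [integral_complex_ofReal] at h
  exact_mod_cast h

theorem integrable_gaussDensity_mul {s t : ℝ} (hs : 0 < s) (ht : 0 < t) (u z : RSpace d) :
    Integrable fun ξ : RSpace d => gaussDensity t (u - ξ) * gaussDensity s (ξ - z) := by
  refine Integrable.of_integral_ne_zero ?_
  rw [integral_gaussDensity_mul hs ht]
  have hpi := Real.pi_pos
  unfold gaussDensity
  positivity

theorem gaussDensity_eq_of_norm_eq {τ : ℝ} {x y : RSpace d} (h : ‖x‖ = ‖y‖) :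
    gaussDensity τ x = gaussDensity τ y := by
  rw [gaussDensity, gaussDensity, h]

variable {U : (Matrix (Fin N) (Fin N) ℂ)ˣ} {α β : Fin N → ℂ}
  {S : Matrix (Fin d) (Fin d) ℝ} {θ : RSpace d → ℝ} {η Cθ : ℝ} {p : ℝ≥0∞}

theorem norm_rotation_sub (hS : S.transpose = -S) (s : ℝ) (ξ y : RSpace d) :
    ‖rotation S s ξ - y‖ = ‖ξ - rotation S (-s) y‖ := by
  have h : rotation S s ξ - y = rotationIso hS s (ξ - rotation S (-s) y) := by
    rw [map_sub, rotationIso_apply, rotationIso_apply, ← rotation_add, add_neg_cancel,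
      rotation_zero]
  rw [h, LinearIsometryEquiv.norm_map]

theorem exists_norm_scalarKernel_le (hN : 1 ≤ N) (U : (Matrix (Fin N) (Fin N) ℂ)ˣ)
    (hα : ∀ k, 0 < (α k).re) (β : Fin N → ℂ) (k : Fin N) :
    ∃ q : ℝ, 0 < q ∧ ∃ C : ℝ → ℝ, ∀ t, 0 < t → ∀ y : RSpace d,
      ‖scalarKernel d (α k) (β k) t ‖y‖‖ ≤ C t * gaussDensity (q * t) y := by
  refine ⟨gaussScale (conjDiag U α), gaussScale_pos U α hN hα,
    fun t => aOne (conjDiag U α) ^ ((d : ℝ) / 2) * Real.exp (-lowerAbscissa (conjDiag U β) * t),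
    fun t ht y => ?_⟩
  exact norm_scalarKernel_le U α β hN hα k ht y

/-- This justifies Fubini in `scalarOp_scalarOp`: integrating the majorant in `ξ` gives one Gaussian
of time `q t + q s`, whose product with `‖w y‖` is integrable. -/
theorem integrable_scalarKernel_mul_smul (hN : 1 ≤ N) (U : (Matrix (Fin N) (Fin N) ℂ)ˣ)
    (hα : ∀ k, 0 < (α k).re) (β : Fin N → ℂ) (hS : S.transpose = -S)
    (hθ : IsRadialWeight θ η Cθ) (hp1 : 1 ≤ p) (hp : p ≠ ∞)
    {w : RSpace d → CSpace N} (hw : MemLp w p (weightedMeasure θ p)) (k : Fin N) {s t : ℝ}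
    (hs : 0 < s) (ht : 0 < t) (z : RSpace d) :
    Integrable (fun r : RSpace d × RSpace d => (scalarKernel d (α k) (β k) t ‖z - r.1‖
        * scalarKernel d (α k) (β k) s ‖rotation S s r.1 - r.2‖) • w r.2)
      ((volume : Measure (RSpace d)).prod (volume : Measure (RSpace d))) := by
  obtain ⟨q, hq, C, hK⟩ := exists_norm_scalarKernel_le (d := d) hN U hα β k
  have hqs : 0 < q * s := by positivity
  have hqt : 0 < q * t := by positivity
  have hm := aestronglyMeasurable_of_weighted hθ hw.aestronglyMeasurable
  have hrc : Continuous fun ξ : RSpace d => rotation S s ξ := (rotationIso hS s).continuous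
  have hcoef : Continuous fun r : RSpace d × RSpace d =>
      scalarKernel d (α k) (β k) t ‖z - r.1‖
        * scalarKernel d (α k) (β k) s ‖rotation S s r.1 - r.2‖ := by
    have h1 : Continuous fun r : RSpace d × RSpace d => ‖z - r.1‖ := by fun_prop
    have h2 : Continuous fun r : RSpace d × RSpace d => ‖rotation S s r.1 - r.2‖ := by fun_prop
    have h3 := (continuous_scalarKernel d (α k) (β k) t).comp h1
    have h4 := (continuous_scalarKernel d (α k) (β k) s).comp h2
    exact h3.mul h4
  have hfm : AEStronglyMeasurable (fun r : RSpace d × RSpace d =>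
      (scalarKernel d (α k) (β k) t ‖z - r.1‖
        * scalarKernel d (α k) (β k) s ‖rotation S s r.1 - r.2‖) • w r.2)
      ((volume : Measure (RSpace d)).prod (volume : Measure (RSpace d))) :=
    AEStronglyMeasurable.smul hcoef.aestronglyMeasurable hm.comp_snd
  have hfb : ∀ ξ y, ‖(scalarKernel d (α k) (β k) t ‖z - ξ‖
      * scalarKernel d (α k) (β k) s ‖rotation S s ξ - y‖) • w y‖ ≤ C t * C s * ‖w y‖ *
      (gaussDensity (q * t) (z - ξ) * gaussDensity (q * s) (ξ - rotation S (-s) y)) := by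
    intro ξ y
    have h1 := hK t ht (z - ξ)
    have h2 := hK s hs (rotation S s ξ - y)
    rw [gaussDensity_eq_of_norm_eq (norm_rotation_sub hS s ξ y)] at h2
    rw [norm_smul, norm_mul]
    calc _ ≤ (C t * gaussDensity (q * t) (z - ξ))
          * (C s * gaussDensity (q * s) (ξ - rotation S (-s) y)) * ‖w y‖ :=
          mul_le_mul_of_nonneg_right (mul_le_mul h1 h2 (norm_nonneg _)
            ((norm_nonneg _).trans h1)) (norm_nonneg _)
      _ = _ := by ring
  have hfy : ∀ y, Integrable fun ξ => C t * C s * ‖w y‖ *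
      (gaussDensity (q * t) (z - ξ) * gaussDensity (q * s) (ξ - rotation S (-s) y)) := fun y =>
    (integrable_gaussDensity_mul hqs hqt z _).const_mul _
  have hfi1 : ∀ y, Integrable fun ξ => (scalarKernel d (α k) (β k) t ‖z - ξ‖
      * scalarKernel d (α k) (β k) s ‖rotation S s ξ - y‖) • w y := fun y => by
    refine (hfy y).mono' ?_ (Eventually.of_forall fun ξ => hfb ξ y)
    exact ((hcoef.comp (continuous_id.prodMk continuous_const)).smul
      continuous_const).aestronglyMeasurable
  have hfi2 : Integrable fun y => ∫ ξ, ‖(scalarKernel d (α k) (β k) t ‖z - ξ‖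
      * scalarKernel d (α k) (β k) s ‖rotation S s ξ - y‖) • w y‖ := by
    have hmaj := (integrable_gaussDensity_mul_norm hθ hp1 hp hw (τ := q * t + q * s)
      (by positivity) (rotation S s z)).const_mul (C t * C s)
    refine hmaj.mono' hfm.norm.prod_swap.integral_prod_right' (Eventually.of_forall fun y => ?_)
    rw [Real.norm_of_nonneg (integral_nonneg fun _ => norm_nonneg _)]
    refine (integral_mono_of_nonneg (Eventually.of_forall fun _ => norm_nonneg _) (hfy y)
      (Eventually.of_forall fun ξ => hfb ξ y)).trans_eq ?_
    rw [integral_const_mul, integral_gaussDensity_mul hqs hqt,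
      gaussDensity_eq_of_norm_eq (norm_rotation_sub hS s z y)]
    ring
  exact (integrable_prod_iff' hfm).2 ⟨Eventually.of_forall hfi1, hfi2⟩

theorem scalarOp_scalarOp (hN : 1 ≤ N) (U : (Matrix (Fin N) (Fin N) ℂ)ˣ)
    (hα : ∀ k, 0 < (α k).re) (β : Fin N → ℂ) (hS : S.transpose = -S)
    (hθ : IsRadialWeight θ η Cθ) (hp1 : 1 ≤ p) (hp : p ≠ ∞)
    {w : RSpace d → CSpace N} (hw : MemLp w p (weightedMeasure θ p)) (k : Fin N) {s t : ℝ}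
    (hs : 0 < s) (ht : 0 < t) (x : RSpace d) :
    scalarOp (α k) (β k) S t (scalarOp (α k) (β k) S s w) x
      = scalarOp (α k) (β k) S (t + s) w x := by
  set z := rotation S t x with hz
  have hfi := integrable_scalarKernel_mul_smul hN U hα β hS hθ hp1 hp hw k hs ht z
  have e1 : scalarOp (α k) (β k) S t (scalarOp (α k) (β k) S s w) x = ∫ ξ, ∫ y,
      (scalarKernel d (α k) (β k) t ‖z - ξ‖
        * scalarKernel d (α k) (β k) s ‖rotation S s ξ - y‖) • w y := by
    rw [scalarOp]
    refine integral_congr_ae (Eventually.of_forall fun ξ => ?_)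
    simp only [scalarOp, mul_smul]
    rw [integral_smul]
  rw [e1, integral_integral_swap hfi, scalarOp]
  refine integral_congr_ae (Eventually.of_forall fun y => ?_)
  simp only
  rw [integral_smul_const]
  -- Moving the inner rotation onto `y` leaves an ordinary convolution in `ξ`.
  simp_rw [norm_rotation_sub hS s _ y]
  rw [integral_scalarKernel_mul (hα k) (β k) hs ht, hz, ← norm_rotation_sub hS, ← rotation_add,
    add_comm s t]

/-- Orthogonality of the projections, `P_k P_l = 0` for `k ≠ l`, decouples the components, so the
semigroup law reduces to the scalar one. -/
theorem specProj_semigroupFun (hN : 1 ≤ N) (hα : ∀ k, 0 < (α k).re)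
    (hθ : IsRadialWeight θ η Cθ) (hp1 : 1 ≤ p) (hp : p ≠ ∞)
    {v : RSpace d → CSpace N} (hv : MemLp v p (weightedMeasure θ p)) {t : ℝ}
    (ht : 0 < t) (k : Fin N) (x : RSpace d) :
    specProj U k (semigroupFun (conjDiag U α) (conjDiag U β) S t v x)
      = scalarOp (α k) (β k) S t (fun ξ => specProj U k (v ξ)) x := by
  rw [semigroupFun_conjDiag hN hα hθ hp1 hp hv ht, map_sum, Finset.sum_eq_single k]
  · rw [scalarOp, ← ContinuousLinearMap.integral_comp_comm _
      (integrable_scalarKernel_smul hN U hα β hθ hp1 hp (memLp_specProj hv U k) k ht _)]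
    simp only [map_smul, specProj_specProj, if_true]
  · intro l _ hl
    rw [scalarOp, ← ContinuousLinearMap.integral_comp_comm _
      (integrable_scalarKernel_smul hN U hα β hθ hp1 hp (memLp_specProj hv U l) l ht _)]
    simp only [map_smul, specProj_specProj, if_neg hl.symm, smul_zero, integral_zero]
  · simp

theorem semigroupFun_semigroupFun (hd : 1 ≤ d) (hN : 1 ≤ N) (hα : ∀ k, 0 < (α k).re)
    (hS : S.transpose = -S) (hθ : IsRadialWeight θ η Cθ) (hp1 : 1 ≤ p) (hp : p ≠ ∞)
    {v : RSpace d → CSpace N} (hv : StronglyMeasurable v) (hvp : MemLp v p (weightedMeasure θ p))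
    {s t : ℝ} (hs : 0 < s) (ht : 0 < t) (x : RSpace d) :
    semigroupFun (conjDiag U α) (conjDiag U β) S t
        (semigroupFun (conjDiag U α) (conjDiag U β) S s v) x
      = semigroupFun (conjDiag U α) (conjDiag U β) S (t + s) v x := by
  rw [semigroupFun_conjDiag hN hα hθ hp1 hp
    (memLp_semigroupFun hd hN hα hS hθ hp1 hp hv hvp s) ht,
    semigroupFun_conjDiag hN hα hθ hp1 hp hvp (by positivity)]
  refine Finset.sum_congr rfl fun k _ => ?_
  simp_rw [specProj_semigroupFun hN hα hθ hp1 hp hvp hs k]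
  exact scalarOp_scalarOp hN U hα β hS hθ hp1 hp (memLp_specProj hvp U k) k hs ht x

end ChapmanKolmogorov

/-! ### Scalar kernels as an approximate identity. -/

section ApproximateIdentity

variable {d N : ℕ}

theorem integrable_scalarKernel_one {a : ℂ} (ha : 0 < a.re) :
    Integrable fun y : RSpace d => scalarKernel d a 0 1 ‖y‖ := by
  have hc : 0 < ((4 * a)⁻¹).re := inv_re_pos (by simpa using ha)
  have h := (GaussianFourier.integrable_cexp_neg_mul_sq_norm_add (V := RSpace d) hc 0 0).const_mul
    ((((4 * Real.pi * 1 : ℝ) : ℂ) * a) ^ (-(d : ℂ) / 2))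
  refine h.congr (Eventually.of_forall fun y => ?_)
  simp only [scalarKernel]
  congr 2
  push_cast
  ring

theorem integral_scalarKernel_one {a : ℂ} (ha : 0 < a.re) :
    ∫ y : RSpace d, scalarKernel d a 0 1 ‖y‖ = 1 := by
  have ha0 : a ≠ 0 := fun h => by simp [h] at ha
  have hpi := Real.pi_pos
  have hc : 0 < ((4 * a)⁻¹).re := inv_re_pos (by simpa using ha)
  have e : ∀ y : RSpace d, scalarKernel d a 0 1 ‖y‖
      = (((4 * Real.pi : ℝ) : ℂ) * a) ^ (-(d : ℂ) / 2)
        * Complex.exp (-(4 * a)⁻¹ * (‖y‖ : ℂ) ^ 2) := by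
    intro y
    rw [scalarKernel, mul_one]
    congr 2
    push_cast
    ring
  simp_rw [e]
  rw [integral_const_mul, integral_cexp_neg_mul_norm_sq hc, div_inv_eq_mul,
    show (Real.pi : ℂ) * (4 * a) = ((4 * Real.pi : ℝ) : ℂ) * a by push_cast; ring,
    ofReal_mul_cpow (by positivity) ha0, ofReal_mul_cpow (by positivity) ha0, ← Complex.exp_add]
  rw [← Complex.exp_zero]
  congr 1
  ring

/-- Parabolic scaling: `√t ^ d` is the Jacobian of `y ↦ √t y`. Writing every factor as an
exponential of logarithms lets the powers of `t` cancel on the principal branch. -/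
theorem sqrt_pow_mul_scalarKernel {a : ℂ} (ha : 0 < a.re) (b : ℂ) {t : ℝ} (ht : 0 < t) (r : ℝ) :
    ((√t ^ d : ℝ) : ℂ) * scalarKernel d a b t (√t * r)
      = Complex.exp (-((t : ℂ) * b)) * scalarKernel d a 0 1 r := by
  have ha0 : a ≠ 0 := fun h => by simp [h] at ha
  have hpi := Real.pi_pos
  have htC : (t : ℂ) ≠ 0 := Complex.ofReal_ne_zero.2 ht.ne'
  have e1 : ((√t ^ d : ℝ) : ℂ) = Complex.exp ((Real.log t : ℝ) * ((d : ℂ) / 2)) := by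
    have : √t ^ d = Real.exp (Real.log t * (d / 2)) := by
      rw [← Real.rpow_def_of_pos ht, Real.sqrt_eq_rpow, ← Real.rpow_natCast,
        ← Real.rpow_mul ht.le]
      congr 1; ring
    rw [this]
    push_cast
    ring_nf
  rw [scalarKernel, scalarKernel, e1, ofReal_mul_cpow (by positivity) ha0,
    ofReal_mul_cpow (by positivity) ha0, Real.log_mul (by positivity) ht.ne', mul_one,
    ← Complex.exp_add, ← Complex.exp_add, ← Complex.exp_add, ← Complex.exp_add, mul_pow, Real.sq_sqrt ht.le]
  congr 1
  push_cast
  field_simp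
  ring

theorem scalarOp_eq_rescaled {a : ℂ} (ha : 0 < a.re) (b : ℂ) (S : Matrix (Fin d) (Fin d) ℝ)
    {t : ℝ} (ht : 0 < t) (w : RSpace d → CSpace N) (x : RSpace d) :
    scalarOp a b S t w x = Complex.exp (-((t : ℂ) * b)) •
      ∫ y : RSpace d, scalarKernel d a 0 1 ‖y‖ • w (rotation S t x - √t • y) := by
  have hst : 0 < √t := Real.sqrt_pos.2 ht
  set f : RSpace d → CSpace N := fun y => scalarKernel d a b t ‖y‖ • w (rotation S t x - y) with hf
  have e1 : scalarOp a b S t w x = ∫ y, f y := by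
    rw [← integral_sub_left_eq_self f volume (rotation S t x)]
    simp only [hf, sub_sub_cancel]
    rfl
  have e2 := Measure.integral_comp_smul volume f (√t)
  rw [finrank_euclideanSpace_fin, abs_of_nonneg (by positivity)] at e2
  have e3 : ∫ y, f y = (√t ^ d) • ∫ y, f (√t • y) := by
    rw [e2, smul_smul, mul_inv_cancel₀ (by positivity), one_smul]
  rw [e1, e3, ← integral_smul, ← integral_smul]
  congr 1
  ext1 y
  rw [hf, smul_smul, ← sqrt_pow_mul_scalarKernel ha b ht]
  simp only [norm_smul, Real.norm_of_nonneg hst.le]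
  rw [mul_smul, Complex.coe_smul]

/-- In rescaled form the kernel no longer depends on `t`, so dominated convergence applies with its
integrable norm times `D`; the limit kernel integrates to `1`. -/
theorem tendsto_scalarOp {a : ℂ} (ha : 0 < a.re) (b : ℂ) (S : Matrix (Fin d) (Fin d) ℝ)
    {w : RSpace d → CSpace N} (hw : Continuous w) {D : ℝ} (hD : ∀ x, ‖w x‖ ≤ D) (x : RSpace d) :
    Tendsto (fun t => scalarOp a b S t w x) (𝓝[>] 0) (𝓝 (w x)) := by
  have hint := integrable_scalarKernel_one (d := d) ha
  have hrot := continuous_rotation_time S x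
  have h1 : Tendsto (fun t : ℝ => ∫ y : RSpace d,
      scalarKernel d a 0 1 ‖y‖ • w (rotation S t x - √t • y)) (𝓝[>] 0)
      (𝓝 (∫ y : RSpace d, scalarKernel d a 0 1 ‖y‖ • w x)) := by
    refine tendsto_integral_filter_of_dominated_convergence
      (fun y => ‖scalarKernel d a 0 1 ‖y‖‖ * D) (Eventually.of_forall fun t => ?_)
      (Eventually.of_forall fun t => Eventually.of_forall fun y => ?_) (hint.norm.mul_const D)
      (Eventually.of_forall fun y => ?_)
    · refine AEStronglyMeasurable.smul hint.aestronglyMeasurable ?_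
      exact (hw.comp (by fun_prop)).aestronglyMeasurable
    · rw [norm_smul]
      exact mul_le_mul_of_nonneg_left (hD _) (norm_nonneg _)
    · have hc : Continuous fun t : ℝ => w (rotation S t x - √t • y) := by fun_prop
      have := hc.tendsto 0
      simp only [rotation_zero, Real.sqrt_zero, zero_smul, sub_zero] at this
      exact (this.mono_left nhdsWithin_le_nhds).const_smul _
  rw [integral_smul_const, integral_scalarKernel_one ha, one_smul] at h1
  have h2 : Tendsto (fun t : ℝ => Complex.exp (-((t : ℂ) * b))) (𝓝[>] 0) (𝓝 1) := by
    have hc : Continuous fun t : ℝ => Complex.exp (-((t : ℂ) * b)) := by fun_prop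
    have := hc.tendsto 0
    simp only [Complex.ofReal_zero, zero_mul, neg_zero, Complex.exp_zero] at this
    exact this.mono_left nhdsWithin_le_nhds
  have h3 := h2.smul h1
  rw [one_smul] at h3
  refine h3.congr' ?_
  filter_upwards [self_mem_nhdsWithin] with t ht
  rw [scalarOp_eq_rescaled ha b S ht]

end ApproximateIdentity

/-! ### Strong continuity on continuous compactly supported functions. -/

section StrongContinuity

variable {d N : ℕ} {U : (Matrix (Fin N) (Fin N) ℂ)ˣ} {α β : Fin N → ℂ}
  {S : Matrix (Fin d) (Fin d) ℝ} {θ : RSpace d → ℝ} {η Cθ : ℝ} {p : ℝ≥0∞}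

theorem tendsto_semigroupFun (hN : 1 ≤ N) (hα : ∀ k, 0 < (α k).re)
    (hθ : IsRadialWeight θ η Cθ) (hp1 : 1 ≤ p) (hp : p ≠ ∞)
    {v : RSpace d → CSpace N} (hv : Continuous v) (hvp : MemLp v p (weightedMeasure θ p))
    {D : ℝ} (hD : ∀ x, ‖v x‖ ≤ D) (x : RSpace d) :
    Tendsto (fun t => semigroupFun (conjDiag U α) (conjDiag U β) S t v x) (𝓝[>] 0)
      (𝓝 (v x)) := by
  have h : Tendsto (fun t => ∑ k, scalarOp (α k) (β k) S t (fun ξ => specProj U k (v ξ)) x)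
      (𝓝[>] 0) (𝓝 (∑ k, specProj U k (v x))) := by
    refine tendsto_finsetSum _ fun k _ => ?_
    refine tendsto_scalarOp (hα k) (β k) S ((specProj U k).continuous.comp hv)
      (D := ‖specProj U k‖ * D) (fun y => ?_) x
    exact (specProj U k).le_opNorm_of_le (hD y)
  rw [sum_specProj] at h
  refine h.congr' ?_
  filter_upwards [self_mem_nhdsWithin] with t ht
  rw [semigroupFun_conjDiag hN hα hθ hp1 hp hvp ht]

/-- Exponential decay survives because `exp(-m|ξ|) ≤ exp(-m|x|) exp(m|e^{tS}x - ξ|)`, and the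
Gaussian moment of the last factor is bounded for `t ≤ 1`. This supplies a majorant independent of
`t`. -/
theorem exists_norm_semigroupFun_le (hN : 1 ≤ N) (hα : ∀ k, 0 < (α k).re)
    (hS : S.transpose = -S) {v : RSpace d → CSpace N} {D m : ℝ} (hm : 0 ≤ m)
    (hD : ∀ x, ‖v x‖ ≤ D * Real.exp (-m * ‖x‖)) :
    ∃ K : ℝ, 0 ≤ K ∧ ∀ t, 0 < t → t ≤ 1 → ∀ x,
      ‖semigroupFun (conjDiag U α) (conjDiag U β) S t v x‖ ≤ K * Real.exp (-m * ‖x‖) := by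
  set q := gaussScale (conjDiag U α) with hqdef
  have hq : 0 < q := gaussScale_pos U α hN hα
  set b := lowerAbscissa (conjDiag U β) with hb
  set c := condNumber U.val * aOne (conjDiag U α) ^ ((d : ℝ) / 2) with hc
  have hD0 : 0 ≤ D := by
    have := (norm_nonneg _).trans (hD 0)
    simpa using this
  have hc0 : 0 ≤ c := by
    have h1 := condNumber_nonneg U.val
    have h2 : 0 ≤ aOne (conjDiag U α) := by
      rw [aOne_eq]
      exact div_nonneg hq.le (aMin_pos U α hN (ne_zero_of_re_pos hα)).le
    positivity
  refine ⟨c * Real.exp |b| * D * (((1 + 1) / 1) ^ ((d : ℝ) / 2)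
    * Real.exp ((1 + 1) * (m ^ 2 * q))), by positivity, fun t ht ht1 x => ?_⟩
  have hqt : 0 < q * t := by positivity
  rw [semigroupFun, if_pos ht]
  set z := rotation S t x with hz
  have hzx : ‖z‖ = ‖x‖ := norm_rotation hS t x
  have hbt : Real.exp (-b * t) ≤ Real.exp |b| := by
    apply Real.exp_le_exp.2
    calc -b * t ≤ |b| * t := by gcongr; exact neg_le_abs b
      _ ≤ |b| * 1 := by gcongr
      _ = |b| := mul_one _
  have hgi : Integrable fun ξ : RSpace d =>
      Real.exp (m * ‖z - ξ‖) * gaussDensity (q * t) (z - ξ) :=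
    (integrable_exp_mul_gaussDensity hqt m).comp_sub_left z
  have hbound : ∀ ξ, ‖kernelApply (conjDiag U α) (conjDiag U β) S t v x ξ‖
      ≤ c * Real.exp |b| * D * Real.exp (-m * ‖x‖) *
        (Real.exp (m * ‖z - ξ‖) * gaussDensity (q * t) (z - ξ)) := by
    intro ξ
    have hg := gaussDensity_nonneg hqt.le (z - ξ)
    have h1 : ‖v ξ‖ ≤ D * (Real.exp (-m * ‖x‖) * Real.exp (m * ‖z - ξ‖)) := by
      refine (hD ξ).trans ?_
      rw [← Real.exp_add]
      gcongr
      have : ‖z‖ ≤ ‖z - ξ‖ + ‖ξ‖ := by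
        simpa using norm_add_le (z - ξ) ξ
      rw [hzx] at this
      nlinarith
    calc _ ≤ c * Real.exp (-b * t) * gaussDensity (q * t) (z - ξ) * ‖v ξ‖ :=
          norm_kernelApply_le U α β S hN hα ht v x ξ
      _ ≤ c * Real.exp |b| * gaussDensity (q * t) (z - ξ)
          * (D * (Real.exp (-m * ‖x‖) * Real.exp (m * ‖z - ξ‖))) := by gcongr
      _ = _ := by ring
  refine (norm_integral_le_of_norm_le (hgi.const_mul _) (Eventually.of_forall hbound)).trans ?_
  rw [integral_const_mul, integral_sub_left_eq_self
    (fun y : RSpace d => Real.exp (m * ‖y‖) * gaussDensity (q * t) y) volume z]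
  have h2 := integral_exp_mul_gaussDensity_le (d := d) one_pos hqt m
  have h3 : Real.exp ((1 + 1) * (m ^ 2 * (q * t))) ≤ Real.exp ((1 + 1) * (m ^ 2 * q)) := by
    apply Real.exp_le_exp.2
    gcongr
    exact mul_le_of_le_one_right hq.le ht1
  calc _ ≤ c * Real.exp |b| * D * Real.exp (-m * ‖x‖) * (((1 + 1) / 1) ^ ((d : ℝ) / 2)
          * Real.exp ((1 + 1) * (m ^ 2 * q))) := by
        gcongr
        exact h2.trans (by gcongr)
    _ = _ := by ring

theorem integrable_exp_neg_norm (hd : 1 ≤ d) : Integrable fun x : RSpace d => Real.exp (-‖x‖) := by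
  have : Nonempty (Fin d) := ⟨⟨0, hd⟩⟩
  have hd0 : (0 : ℝ) < d := by exact_mod_cast hd
  rw [integrable_fun_norm_addHaar volume (f := fun r : ℝ => Real.exp (-r))]
  refine (Real.GammaIntegral_convergent hd0).congr_fun (fun r hr => ?_) measurableSet_Ioi
  simp only [finrank_euclideanSpace_fin, smul_eq_mul]
  rw [mul_comm, ← Real.rpow_natCast, Nat.cast_sub hd, Nat.cast_one]

/-- The decay rate `η + 1` beats the growth rate of the weight by one, leaving `exp(-‖x‖)`. -/
theorem lintegral_exp_neg_weighted_lt_top (hd : 1 ≤ d) (hθ : IsRadialWeight θ η Cθ) (hp1 : 1 ≤ p)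
    (hp : p ≠ ∞) {K : ℝ} (hK : 0 ≤ K) :
    ∫⁻ x, ENNReal.ofReal (K * Real.exp (-(η + 1) * ‖x‖)) ^ p.toReal ∂(weightedMeasure θ p) < ∞ := by
  have hpr : 1 ≤ p.toReal := by
    rw [← ENNReal.toReal_one]; exact ENNReal.toReal_mono hp hp1
  have hpr0 : 0 < p.toReal := by linarith
  have hC := hθ.const_pos
  have hθ0 := hθ.pos 0
  have hθm := hθ.continuous.measurable
  rw [weightedMeasure, lintegral_withDensity_eq_lintegral_mul _ (by fun_prop) (by fun_prop)]
  have hI := (integrable_exp_neg_norm hd).const_mul ((Cθ * θ 0 * K) ^ p.toReal)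
  refine (lintegral_mono fun x => ?_).trans_lt hI.lintegral_lt_top
  rw [Pi.mul_apply, ← ENNReal.mul_rpow_of_nonneg _ _ hpr0.le, ← ENNReal.ofReal_mul (hθ.pos x).le,
    ENNReal.ofReal_rpow_of_nonneg (mul_nonneg (hθ.pos x).le (by positivity)) hpr0.le]
  refine ENNReal.ofReal_le_ofReal ?_
  have h1 : θ x * (K * Real.exp (-(η + 1) * ‖x‖)) ≤ Cθ * θ 0 * K * Real.exp (-‖x‖) := by
    have h2 := hθ.le_mul_exp_sub x 0
    rw [sub_zero] at h2
    calc _ ≤ Cθ * θ 0 * Real.exp (η * ‖x‖) * (K * Real.exp (-(η + 1) * ‖x‖)) := by gcongr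
      _ = Cθ * θ 0 * K * (Real.exp (η * ‖x‖) * Real.exp (-(η + 1) * ‖x‖)) := by ring
      _ = _ := by rw [← Real.exp_add]; congr 2; ring
  refine (Real.rpow_le_rpow (mul_nonneg (hθ.pos x).le (by positivity)) h1 hpr0.le).trans ?_
  rw [Real.mul_rpow (by positivity) (Real.exp_pos _).le, ← Real.exp_mul]
  gcongr
  have := norm_nonneg x
  nlinarith

theorem tendsto_eLpNorm_semigroupFun_sub (hd : 1 ≤ d) (hN : 1 ≤ N) (hα : ∀ k, 0 < (α k).re)
    (hS : S.transpose = -S) (hθ : IsRadialWeight θ η Cθ) (hp1 : 1 ≤ p) (hp : p ≠ ∞)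
    {v : RSpace d → CSpace N} (hv : Continuous v) (hvc : HasCompactSupport v)
    (hvp : MemLp v p (weightedMeasure θ p)) :
    Tendsto (fun t => eLpNorm (fun x => semigroupFun (conjDiag U α) (conjDiag U β) S t v x - v x)
      p (weightedMeasure θ p)) (𝓝[>] 0) (𝓝 0) := by
  have hp0 : p ≠ 0 := (zero_lt_one.trans_le hp1).ne'
  have hpr : 1 ≤ p.toReal := by
    rw [← ENNReal.toReal_one]; exact ENNReal.toReal_mono hp hp1
  have hpr0 : 0 < p.toReal := by linarith
  have hη := hθ.eta_nonneg
  -- Multiplying `v` by `exp((η + 1)|x|)` keeps it continuous with compact support, hence bounded.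
  obtain ⟨D, hD⟩ : ∃ D : ℝ, ∀ x, ‖v x‖ ≤ D * Real.exp (-(η + 1) * ‖x‖) := by
    have hc : Continuous fun x => Real.exp ((η + 1) * ‖x‖) • v x := by fun_prop
    have hcs : HasCompactSupport fun x => Real.exp ((η + 1) * ‖x‖) • v x := by
      refine hvc.mono fun x hx hvx => hx ?_
      simp only [hvx, smul_zero]
    obtain ⟨D, hD⟩ := hc.bounded_above_of_compact_support hcs
    refine ⟨D, fun x => ?_⟩
    have := hD x
    rw [norm_smul, Real.norm_of_nonneg (Real.exp_pos _).le] at this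
    rw [neg_mul, Real.exp_neg, ← div_eq_mul_inv, le_div_iff₀ (Real.exp_pos _), mul_comm]
    exact this
  have hD0 : 0 ≤ D := by
    have := (norm_nonneg _).trans (hD 0)
    simpa using this
  have hDv : ∀ x, ‖v x‖ ≤ D := fun x => (hD x).trans (mul_le_of_le_one_right hD0
    (Real.exp_le_one_iff.2 (by rw [neg_mul]; exact neg_nonpos.2 (by positivity))))
  obtain ⟨K, hK0, hK⟩ := exists_norm_semigroupFun_le (U := U) (β := β) hN hα hS
    (by positivity : 0 ≤ η + 1) hD
  have hmeas := stronglyMeasurable_semigroupFun (U := U) (β := β) (S := S) hα hv.stronglyMeasurable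
  have hlim : Tendsto (fun t => ∫⁻ x,
      ‖semigroupFun (conjDiag U α) (conjDiag U β) S t v x - v x‖ₑ ^ p.toReal
        ∂(weightedMeasure θ p)) (𝓝[>] 0) (𝓝 (∫⁻ _, 0 ∂(weightedMeasure θ p))) := by
    refine tendsto_lintegral_filter_of_dominated_convergence
      (fun x => ENNReal.ofReal ((K + D) * Real.exp (-(η + 1) * ‖x‖)) ^ p.toReal)
      (Eventually.of_forall fun t => ?_) ?_
      (lintegral_exp_neg_weighted_lt_top hd hθ hp1 hp (by positivity)).ne
      (Eventually.of_forall fun x => ?_)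
    · exact (((hmeas t).sub hv.stronglyMeasurable).enorm).pow_const _
    · have h1 : ∀ᶠ t : ℝ in 𝓝[>] 0, t ≤ 1 :=
        nhdsWithin_le_nhds (Iic_mem_nhds one_pos)
      filter_upwards [h1, self_mem_nhdsWithin] with t ht1 ht0
      refine Eventually.of_forall fun x => ?_
      rw [← ofReal_norm]
      gcongr
      refine (norm_sub_le _ _).trans ?_
      rw [add_mul]
      exact add_le_add (hK t ht0 ht1 x) (hD x)
    · have h2 := (tendsto_semigroupFun (U := U) (β := β) (S := S) hN hα hθ hp1 hp hv hvp hDv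
        x).sub_const (v x)
      rw [sub_self] at h2
      have h3 := ((ENNReal.continuous_rpow_const (y := p.toReal)).tendsto _).comp h2.enorm
      simpa [ENNReal.zero_rpow_of_pos hpr0, Function.comp_def] using h3
  rw [lintegral_zero] at hlim
  have h4 := ((ENNReal.continuous_rpow_const (y := 1 / p.toReal)).tendsto _).comp hlim
  rw [ENNReal.zero_rpow_of_pos (by positivity)] at h4
  refine h4.congr fun t => ?_
  rw [eLpNorm_eq_lintegral_rpow_enorm_toReal hp0 hp]
  rfl

end StrongContinuity

/-! ### Pointwise evaluation of Bochner integrals in `L^p`. -/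

section BochnerRepresentative

variable {X Ω E : Type*} [MeasurableSpace X] [MeasurableSpace Ω] [NormedAddCommGroup E]
  [NormedSpace ℝ E] [CompleteSpace E] {μ : Measure X} {ν : Measure Ω} {p : ℝ≥0∞} [Fact (1 ≤ p)]

-- Hölder against the indicator of `s`; the bound makes integration over `s` continuous on `L^p`.
omit [NormedSpace ℝ E] [CompleteSpace E] in
theorem setIntegral_norm_Lp_le {s : Set X} (hs : μ s < ∞) (g : Lp E p μ) :
    IntegrableOn g s μ ∧
      ∫ x in s, ‖g x‖ ∂μ ≤ (μ s ^ (1 - 1 / p.toReal)).toReal * ‖g‖ := by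
  have hp1 : 1 ≤ p := Fact.out
  have : IsFiniteMeasure (μ.restrict s) := isFiniteMeasure_restrict.2 hs.ne
  have hmem : MemLp g p (μ.restrict s) := (Lp.memLp g).restrict s
  have hint : IntegrableOn g s μ := hmem.integrable hp1
  refine ⟨hint, ?_⟩
  have hexp : 0 ≤ 1 - 1 / p.toReal := by
    rcases eq_or_ne p ∞ with rfl | hp
    · simp
    · have : 1 ≤ p.toReal := by
        rw [← ENNReal.toReal_one]; exact ENNReal.toReal_mono hp hp1
      rw [sub_nonneg]
      exact (div_le_one (by linarith)).2 this
  have h1 := eLpNorm_le_eLpNorm_mul_rpow_measure_univ hp1 hmem.aestronglyMeasurable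
  rw [ENNReal.toReal_one, one_div_one, Measure.restrict_apply_univ,
    eLpNorm_one_eq_lintegral_enorm] at h1
  have h2 : eLpNorm g p (μ.restrict s) ≤ eLpNorm g p μ :=
    eLpNorm_mono_measure _ Measure.restrict_le_self
  have hfin : μ s ^ (1 - 1 / p.toReal) ≠ ∞ := ENNReal.rpow_ne_top_of_nonneg hexp hs.ne
  rw [integral_norm_eq_lintegral_enorm hint.aestronglyMeasurable, Lp.norm_def, mul_comm,
    ← ENNReal.toReal_mul]
  exact ENNReal.toReal_mono (ENNReal.mul_ne_top (Lp.eLpNorm_ne_top g) hfin)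
    (h1.trans (by gcongr))

/-- Integration over a set of finite measure as a bounded linear map on `L^p`. -/
noncomputable def setIntegralCLM {s : Set X} (hs : μ s < ∞) : Lp E p μ →L[ℝ] E :=
  LinearMap.mkContinuous
    { toFun := fun g => ∫ x in s, g x ∂μ
      map_add' := fun f g => by
        rw [← integral_add (setIntegral_norm_Lp_le hs f).1 (setIntegral_norm_Lp_le hs g).1]
        exact integral_congr_ae (ae_restrict_of_ae (Lp.coeFn_add f g))
      map_smul' := fun c g => by
        rw [RingHom.id_apply, ← integral_smul]
        exact integral_congr_ae (ae_restrict_of_ae (Lp.coeFn_smul c g)) }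
    ((μ s ^ (1 - 1 / p.toReal)).toReal)
    (fun g => (norm_integral_le_integral_norm _).trans (setIntegral_norm_Lp_le hs g).2)

omit [CompleteSpace E] in
theorem setIntegralCLM_apply {s : Set X} (hs : μ s < ∞) (g : Lp E p μ) :
    setIntegralCLM hs g = ∫ x in s, g x ∂μ := rfl

variable [SigmaFinite μ]

omit [NormedSpace ℝ E] [CompleteSpace E] in
theorem integrable_prod_of_integrable_Lp {F : Ω → Lp E p μ} (hF : Integrable F ν)
    {f : Ω × X → E} (hf : StronglyMeasurable f) (hFf : ∀ᵐ t ∂ν, F t =ᵐ[μ] fun x => f (t, x))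
    {s : Set X} (hs : μ s < ∞) : Integrable f (ν.prod (μ.restrict s)) := by
  rw [integrable_prod_iff hf.aestronglyMeasurable]
  refine ⟨?_, ?_⟩
  · filter_upwards [hFf] with t ht
    exact (setIntegral_norm_Lp_le hs (F t)).1.congr (ae_restrict_of_ae ht)
  · refine (hF.norm.const_mul ((μ s ^ (1 - 1 / p.toReal)).toReal)).mono'
      hf.norm.integral_prod_right'.aestronglyMeasurable ?_
    filter_upwards [hFf] with t ht
    rw [Real.norm_of_nonneg (integral_nonneg fun _ => norm_nonneg _)]
    refine le_trans (le_of_eq ?_) (setIntegral_norm_Lp_le hs (F t)).2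
    refine integral_congr_ae (ae_restrict_of_ae ?_)
    filter_upwards [ht] with x hx
    rw [hx]

variable [SFinite ν]

/-- A Bochner integral in `L^p` is given pointwise almost everywhere by the integrals of the
representatives. -/
theorem ae_integral_Lp_eq {F : Ω → Lp E p μ} (hF : Integrable F ν)
    {f : Ω × X → E} (hf : StronglyMeasurable f) (hFf : ∀ᵐ t ∂ν, F t =ᵐ[μ] fun x => f (t, x)) :
    ∀ᵐ x ∂μ, Integrable (fun t => f (t, x)) ν ∧ (∫ t, F t ∂ν : Lp E p μ) x = ∫ t, f (t, x) ∂ν := by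
  have hprod := fun (s : Set X) (hs : μ s < ∞) => integrable_prod_of_integrable_Lp hF hf hFf hs
  refine Eventually.and ?_ ?_
  · refine ae_of_forall_measure_lt_top_ae_restrict _ fun s _ hs => ?_
    exact (hprod s hs).prod_left_ae
  -- Both sides have equal integrals over every set of finite measure: the continuous functional
  -- passes inside the Bochner integral, and Fubini exchanges the order.
  · refine ae_eq_of_forall_setIntegral_eq_of_sigmaFinite
      (fun s _ hs => (setIntegral_norm_Lp_le hs _).1)
      (fun s _ hs => (hprod s hs).integral_prod_right) fun s _ hs => ?_
    rw [← setIntegralCLM_apply hs, ← ContinuousLinearMap.integral_comp_comm _ hF,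
      ← integral_integral_swap (f := fun t x => f (t, x)) (hprod s hs)]
    refine integral_congr_ae ?_
    filter_upwards [hFf] with t ht
    exact integral_congr_ae (ae_restrict_of_ae ht)

end BochnerRepresentative

/-! ### The semigroup on the weighted space. -/

section SemigroupOnLp

variable {d N : ℕ} {U : (Matrix (Fin N) (Fin N) ℂ)ˣ} {α β : Fin N → ℂ}
  {S : Matrix (Fin d) (Fin d) ℝ} {θ : RSpace d → ℝ} {η Cθ : ℝ} {p : ℝ≥0∞}

/-- Local finiteness is used for the density of compactly supported continuous functions and for the
pointwise evaluation of the Laplace integral. -/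
theorem isLocallyFiniteMeasure_weightedMeasure (hθ : IsRadialWeight θ η Cθ) (p : ℝ≥0∞) :
    IsLocallyFiniteMeasure (weightedMeasure θ p) := by
  have h : weightedMeasure θ p = (volume : Measure (RSpace d)).withDensity
      fun x => ENNReal.ofReal (θ x ^ p.toReal) := by
    rw [weightedMeasure]
    congr 1
    ext1 x
    rw [ENNReal.ofReal_rpow_of_pos (hθ.pos x)]
  rw [h]
  exact IsLocallyFiniteMeasure.withDensity_ofReal
    (hθ.continuous.rpow_const fun _ => Or.inr ENNReal.toReal_nonneg)

theorem isAdmissibleConst_of_pos (hd : 1 ≤ d) (A : Matrix (Fin N) (Fin N) ℂ)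
    (hA : 0 < lowerAbscissa A) (η : ℝ) {ε : ℝ} (hε : 0 < ε) :
    IsAdmissibleConst d A η p ε ((((1 + ε) / ε) ^ ((d : ℝ) / 2)) ^ (1 / p.toReal)) := by
  refine ⟨by positivity, fun t ht => ?_⟩
  have hν : 0 ≤ nuConst A η p * t := by
    unfold nuConst; positivity
  have hinv : (0 : ℝ) ≤ 1 / p.toReal := by positivity
  refine (Real.rpow_le_rpow (kummerBracket_nonneg hd hν) (kummerBracket_le hd hε hν)
    hinv).trans_eq ?_
  rw [Real.mul_rpow (by positivity) (Real.exp_pos _).le, ← Real.exp_mul]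
  congr 2
  ring

theorem semigroupFun_congr (A B : Matrix (Fin N) (Fin N) ℂ) (S : Matrix (Fin d) (Fin d) ℝ)
    (hθ : IsRadialWeight θ η Cθ) {t : ℝ} (ht : 0 < t) {u v : RSpace d → CSpace N}
    (h : u =ᵐ[weightedMeasure θ p] v) : semigroupFun A B S t u = semigroupFun A B S t v := by
  ext1 x
  rw [semigroupFun, semigroupFun, if_pos ht, if_pos ht]
  refine integral_congr_ae ?_
  have h' : u =ᵐ[volume] v := by
    rw [EventuallyEq, ← ae_weightedMeasure_iff hθ p]; exact h
  filter_upwards [h'] with ξ hξ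
  rw [kernelApply, kernelApply, hξ]

theorem semigroup_zero (A B : Matrix (Fin N) (Fin N) ℂ) (S : Matrix (Fin d) (Fin d) ℝ)
    (v : LpTheta N θ p) : semigroup A B S θ p 0 v = v := by
  have h0 : semigroupFun A B S 0 v = v := by
    ext1 x
    rw [semigroupFun, if_neg (lt_irrefl _)]
  have h : MemLp (semigroupFun A B S 0 v) p (weightedMeasure θ p) := by
    rw [h0]; exact Lp.memLp v
  rw [semigroup, dif_pos h]
  refine Lp.ext (h.coeFn_toLp.trans ?_)
  rw [h0]

variable [Fact (1 ≤ p)]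

/-- This rules out the default branch of `semigroup`, so identities can be checked on
representatives. -/
theorem semigroup_coeFn (hd : 1 ≤ d) (hN : 1 ≤ N) (hα : ∀ k, 0 < (α k).re)
    (hS : S.transpose = -S) (hθ : IsRadialWeight θ η Cθ) (hp : p ≠ ∞) (t : ℝ)
    (v : LpTheta N θ p) :
    semigroup (conjDiag U α) (conjDiag U β) S θ p t v
      =ᵐ[weightedMeasure θ p] semigroupFun (conjDiag U α) (conjDiag U β) S t v := by
  have h := memLp_semigroupFun (U := U) (β := β) hd hN hα hS hθ Fact.out hp
    (Lp.stronglyMeasurable v) (Lp.memLp v) t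
  rw [semigroup, dif_pos h]
  exact h.coeFn_toLp

theorem semigroup_add (hd : 1 ≤ d) (hN : 1 ≤ N) (hα : ∀ k, 0 < (α k).re)
    (hS : S.transpose = -S) (hθ : IsRadialWeight θ η Cθ) (hp : p ≠ ∞) {t : ℝ} (ht : 0 < t)
    (u v : LpTheta N θ p) :
    semigroup (conjDiag U α) (conjDiag U β) S θ p t (u + v)
      = semigroup (conjDiag U α) (conjDiag U β) S θ p t u
        + semigroup (conjDiag U α) (conjDiag U β) S θ p t v := by
  refine Lp.ext ?_
  filter_upwards [semigroup_coeFn (U := U) (β := β) hd hN hα hS hθ hp t (u + v),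
    semigroup_coeFn (U := U) (β := β) hd hN hα hS hθ hp t u,
    semigroup_coeFn (U := U) (β := β) hd hN hα hS hθ hp t v,
    Lp.coeFn_add (semigroup (conjDiag U α) (conjDiag U β) S θ p t u)
      (semigroup (conjDiag U α) (conjDiag U β) S θ p t v)] with x h1 h2 h3 h4
  rw [h1, h4, Pi.add_apply, h2, h3, semigroupFun_congr _ _ _ hθ ht (Lp.coeFn_add u v),
    semigroupFun, semigroupFun, semigroupFun, if_pos ht, if_pos ht, if_pos ht,
    ← integral_add (integrable_kernelApply hN hα hθ Fact.out hp (Lp.memLp u) ht x)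
      (integrable_kernelApply hN hα hθ Fact.out hp (Lp.memLp v) ht x)]
  simp only [kernelApply, Pi.add_apply, map_add]

theorem semigroup_smul (hd : 1 ≤ d) (hN : 1 ≤ N) (hα : ∀ k, 0 < (α k).re)
    (hS : S.transpose = -S) (hθ : IsRadialWeight θ η Cθ) (hp : p ≠ ∞) {t : ℝ} (ht : 0 < t)
    (c : ℂ) (v : LpTheta N θ p) :
    semigroup (conjDiag U α) (conjDiag U β) S θ p t (c • v)
      = c • semigroup (conjDiag U α) (conjDiag U β) S θ p t v := by
  refine Lp.ext ?_
  filter_upwards [semigroup_coeFn (U := U) (β := β) hd hN hα hS hθ hp t (c • v),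
    semigroup_coeFn (U := U) (β := β) hd hN hα hS hθ hp t v,
    Lp.coeFn_smul c (semigroup (conjDiag U α) (conjDiag U β) S θ p t v)] with x h1 h2 h3
  rw [h1, h3, Pi.smul_apply, h2, semigroupFun_congr _ _ _ hθ ht (Lp.coeFn_smul c v),
    semigroupFun, semigroupFun, if_pos ht, if_pos ht, ← integral_smul]
  simp only [kernelApply, Pi.smul_apply, map_smul]

theorem semigroup_semigroup (hd : 1 ≤ d) (hN : 1 ≤ N) (hα : ∀ k, 0 < (α k).re)
    (hS : S.transpose = -S) (hθ : IsRadialWeight θ η Cθ) (hp : p ≠ ∞) {s t : ℝ} (hs : 0 < s)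
    (ht : 0 < t) (v : LpTheta N θ p) :
    semigroup (conjDiag U α) (conjDiag U β) S θ p s
        (semigroup (conjDiag U α) (conjDiag U β) S θ p t v)
      = semigroup (conjDiag U α) (conjDiag U β) S θ p (s + t) v := by
  refine Lp.ext ?_
  filter_upwards [semigroup_coeFn (U := U) (β := β) hd hN hα hS hθ hp (s + t) v,
    semigroup_coeFn (U := U) (β := β) hd hN hα hS hθ hp s
      (semigroup (conjDiag U α) (conjDiag U β) S θ p t v)] with x h1 h2
  rw [h1, h2, semigroupFun_congr _ _ _ hθ hs
    (semigroup_coeFn (U := U) (β := β) hd hN hα hS hθ hp t v)]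
  exact semigroupFun_semigroupFun hd hN hα hS hθ Fact.out hp (Lp.stronglyMeasurable v)
    (Lp.memLp v) ht hs x

theorem norm_semigroup_le (hd : 1 ≤ d) (hN : 1 ≤ N) (hα : ∀ k, 0 < (α k).re)
    (hS : S.transpose = -S) (hθ : IsRadialWeight θ η Cθ) (hp : p ≠ ∞) {ε Cstar : ℝ}
    (hC : IsAdmissibleConst d (conjDiag U α) η p ε Cstar) {t : ℝ} (ht : 0 < t)
    (v : LpTheta N θ p) :
    ‖semigroup (conjDiag U α) (conjDiag U β) S θ p t v‖
      ≤ MConst d (conjDiag U α) U.val Cθ Cstar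
        * Real.exp (omegaConst (conjDiag U α) (conjDiag U β) η p ε * t) * ‖v‖ := by
  have hp1 : 1 ≤ p := Fact.out
  have hpr : 1 ≤ p.toReal := by
    rw [← ENNReal.toReal_one]; exact ENNReal.toReal_mono hp hp1
  have hpr0 : 0 < p.toReal := by linarith
  have hcoef : 0 ≤ Cθ * (condNumber U.val * aOne (conjDiag U α) ^ ((d : ℝ) / 2)
      * Real.exp (-lowerAbscissa (conjDiag U β) * t)) := by
    have h1 := condNumber_nonneg U.val
    have h2 : 0 ≤ aOne (conjDiag U α) := by
      rw [aOne_eq]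
      exact div_nonneg (gaussScale_pos U α hN hα).le (aMin_pos U α hN (ne_zero_of_re_pos hα)).le
    have h3 := hθ.const_pos
    positivity
  have h1 := eLpNorm_semigroupFun_le (U := U) (β := β) hd hN hα hS hθ hp1 hp
    (Lp.stronglyMeasurable v) ht
  rw [← eLpNorm_congr_ae (semigroup_coeFn (U := U) (β := β) hd hN hα hS hθ hp t v)] at h1
  have h2 := ENNReal.toReal_mono
    (ENNReal.mul_ne_top ENNReal.ofReal_ne_top (Lp.eLpNorm_ne_top v)) h1
  have hbr := hC.2 t ht.le
  have hν : 0 ≤ nuConst (conjDiag U α) η p * t := by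
    have := lowerAbscissa_pos U α hN hα
    unfold nuConst
    positivity
  rw [ENNReal.toReal_mul, ENNReal.toReal_ofReal (mul_nonneg hcoef
    (Real.rpow_nonneg (kummerBracket_nonneg hd hν) _)), ← Lp.norm_def, ← Lp.norm_def] at h2
  refine h2.trans (mul_le_mul_of_nonneg_right ?_ (norm_nonneg _))
  refine (mul_le_mul_of_nonneg_left hbr hcoef).trans_eq ?_
  have e : Real.exp (omegaConst (conjDiag U α) (conjDiag U β) η p ε * t)
      = Real.exp (-lowerAbscissa (conjDiag U β) * t)
        * Real.exp ((1 + ε) * (nuConst (conjDiag U α) η p / p.toReal) * t) := by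
    rw [← Real.exp_add, omegaConst, nuConst]
    congr 1
    field_simp
  rw [e, MConst]
  ring

theorem tendsto_semigroup_zero (hd : 1 ≤ d) (hN : 1 ≤ N) (hα : ∀ k, 0 < (α k).re)
    (hS : S.transpose = -S) (hθ : IsRadialWeight θ η Cθ) (hp : p ≠ ∞) (v : LpTheta N θ p) :
    Tendsto (fun t => semigroup (conjDiag U α) (conjDiag U β) S θ p t v) (𝓝[>] 0) (𝓝 v) := by
  have := isLocallyFiniteMeasure_weightedMeasure hθ p
  -- Any exponential bound suffices for uniform boundedness on `(0, 1]`; the choice `ε = 1` is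
  -- arbitrary.
  obtain ⟨Cstar, hC⟩ : ∃ C, IsAdmissibleConst d (conjDiag U α) η p 1 C :=
    ⟨_, isAdmissibleConst_of_pos hd (conjDiag U α) (lowerAbscissa_pos U α hN hα) η one_pos⟩
  obtain ⟨K, hK0, hK⟩ : ∃ K : ℝ, 0 ≤ K ∧ ∀ t, 0 < t → t ≤ 1 → ∀ w : LpTheta N θ p,
      ‖semigroup (conjDiag U α) (conjDiag U β) S θ p t w‖ ≤ K * ‖w‖ := by
    refine ⟨|MConst d (conjDiag U α) U.val Cθ Cstar|
      * Real.exp |omegaConst (conjDiag U α) (conjDiag U β) η p 1|, by positivity,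
      fun t ht ht1 w => (norm_semigroup_le hd hN hα hS hθ hp hC ht w).trans ?_⟩
    gcongr
    · exact le_abs_self _
    · calc _ ≤ |omegaConst (conjDiag U α) (conjDiag U β) η p 1| * t := by
            gcongr; exact le_abs_self _
        _ ≤ _ := mul_le_of_le_one_right (abs_nonneg _) ht1
  have hsub : ∀ t, 0 < t → ∀ u w : LpTheta N θ p,
      semigroup (conjDiag U α) (conjDiag U β) S θ p t (u - w)
        = semigroup (conjDiag U α) (conjDiag U β) S θ p t u
          - semigroup (conjDiag U α) (conjDiag U β) S θ p t w := fun t ht u w => by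
    have h := semigroup_add (U := U) (β := β) hd hN hα hS hθ hp ht (u - w) w
    rw [sub_add_cancel] at h
    rw [h, add_sub_cancel_right]
  rw [Metric.tendsto_nhds]
  intro r hr
  -- The three errors `Kδ`, `δ` and `δ` below add up to `r / 2`.
  set δ := r / (2 * (K + 2)) with hδ
  have hδ0 : 0 < δ := by positivity
  obtain ⟨g, hgc, hgv, hgcont, hgp⟩ := (Lp.memLp v).exists_hasCompactSupport_eLpNorm_sub_le hp
    (ε := ENNReal.ofReal δ) (by simpa using hδ0)
  set G : LpTheta N θ p := hgp.toLp with hG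
  have hGg : G =ᵐ[weightedMeasure θ p] g := hgp.coeFn_toLp
  have hvG : ‖v - G‖ ≤ δ := by
    rw [Lp.norm_def]
    refine ENNReal.toReal_le_of_le_ofReal hδ0.le (le_trans (le_of_eq ?_) hgv)
    refine eLpNorm_congr_ae ?_
    filter_upwards [Lp.coeFn_sub v G, hGg] with x h1 h2
    rw [h1, Pi.sub_apply, Pi.sub_apply, h2]
  have hlim := tendsto_eLpNorm_semigroupFun_sub (U := U) (β := β) (S := S) hd hN hα hS hθ Fact.out
    hp hgcont hgc hgp
  have hev : ∀ᶠ t in 𝓝[>] (0 : ℝ), eLpNorm (fun x =>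
      semigroupFun (conjDiag U α) (conjDiag U β) S t g x - g x) p (weightedMeasure θ p)
        < ENNReal.ofReal δ :=
    hlim.eventually (gt_mem_nhds (by simpa using hδ0))
  have h1 : ∀ᶠ t : ℝ in 𝓝[>] 0, t ≤ 1 := nhdsWithin_le_nhds (Iic_mem_nhds one_pos)
  filter_upwards [hev, h1, self_mem_nhdsWithin] with t hte ht1 ht0
  have ht : 0 < t := ht0
  have hTG : ‖semigroup (conjDiag U α) (conjDiag U β) S θ p t G - G‖ ≤ δ := by
    rw [Lp.norm_def]
    refine ENNReal.toReal_le_of_le_ofReal hδ0.le (le_trans (le_of_eq ?_) hte.le)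
    refine eLpNorm_congr_ae ?_
    filter_upwards [Lp.coeFn_sub (semigroup (conjDiag U α) (conjDiag U β) S θ p t G) G, hGg,
      semigroup_coeFn (U := U) (β := β) hd hN hα hS hθ hp t G] with x h1 h2 h3
    rw [h1, Pi.sub_apply, h2, h3, semigroupFun_congr _ _ _ hθ ht hGg]
  rw [dist_eq_norm]
  have e : semigroup (conjDiag U α) (conjDiag U β) S θ p t v - v
      = semigroup (conjDiag U α) (conjDiag U β) S θ p t (v - G)
        + (semigroup (conjDiag U α) (conjDiag U β) S θ p t G - G) - (v - G) := by
    rw [hsub t ht]; abel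
  rw [e]
  calc _ ≤ ‖semigroup (conjDiag U α) (conjDiag U β) S θ p t (v - G)‖
        + ‖semigroup (conjDiag U α) (conjDiag U β) S θ p t G - G‖ + ‖v - G‖ :=
        (norm_sub_le _ _).trans (add_le_add_left (norm_add_le _ _) _)
    _ ≤ K * δ + δ + δ := by
        gcongr
        exact (hK t ht ht1 _).trans (by gcongr)
    _ = r / 2 := by rw [hδ]; field_simp; ring
    _ < r := by linarith

theorem isBoundedC0Semigroup (hd : 1 ≤ d) (hN : 1 ≤ N) (hα : ∀ k, 0 < (α k).re)
    (hS : S.transpose = -S) (hθ : IsRadialWeight θ η Cθ) (hp : p ≠ ∞) {ε Cstar : ℝ}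
    (hC : IsAdmissibleConst d (conjDiag U α) η p ε Cstar) :
    IsBoundedC0Semigroup (semigroup (conjDiag U α) (conjDiag U β) S θ p : ℝ → LpTheta N θ p → _)
      (MConst d (conjDiag U α) U.val Cθ Cstar)
      (omegaConst (conjDiag U α) (conjDiag U β) η p ε) where
  zero := semigroup_zero _ _ S
  add_time s t v hs ht := by
    rcases hs.eq_or_lt with rfl | hs
    · rw [semigroup_zero, zero_add]
    rcases ht.eq_or_lt with rfl | ht
    · rw [semigroup_zero, add_zero]
    exact (semigroup_semigroup hd hN hα hS hθ hp hs ht v).symm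
  map_add t u v ht := by
    rcases ht.eq_or_lt with rfl | ht
    · rw [semigroup_zero, semigroup_zero, semigroup_zero]
    exact semigroup_add hd hN hα hS hθ hp ht u v
  map_smul t c v ht := by
    rcases ht.eq_or_lt with rfl | ht
    · rw [semigroup_zero, semigroup_zero]
    exact semigroup_smul hd hN hα hS hθ hp ht c v
  bound t v ht := by
    rcases ht.eq_or_lt with rfl | ht
    · rw [semigroup_zero]
      -- At `t = 0` the bound reads `‖v‖ ≤ M ‖v‖`; it follows by letting `t ↓ 0` in the estimate for
      -- positive times.
      have h1 := (tendsto_semigroup_zero (U := U) (β := β) hd hN hα hS hθ hp v).norm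
      have h2 : Continuous fun t : ℝ => MConst d (conjDiag U α) U.val Cθ Cstar
          * Real.exp (omegaConst (conjDiag U α) (conjDiag U β) η p ε * t) * ‖v‖ := by fun_prop
      refine le_of_tendsto_of_tendsto h1 ((h2.tendsto 0).mono_left nhdsWithin_le_nhds) ?_
      filter_upwards [self_mem_nhdsWithin] with t ht
      exact norm_semigroup_le hd hN hα hS hθ hp hC ht v
    · exact norm_semigroup_le hd hN hα hS hθ hp hC ht v
  tendsto_zero := tendsto_semigroup_zero hd hN hα hS hθ hp

theorem ae_orbitLaplace_eq (hd : 1 ≤ d) (hN : 1 ≤ N) (hα : ∀ k, 0 < (α k).re)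
    (hS : S.transpose = -S) (hθ : IsRadialWeight θ η Cθ) (hp : p ≠ ∞) {lam : ℂ}
    (g : LpTheta N θ p)
    (hint : IntegrableOn (fun t : ℝ => Complex.exp (-lam * t)
      • semigroup (conjDiag U α) (conjDiag U β) S θ p t g) (Set.Ioi 0)) :
    ∀ᵐ x : RSpace d,
      IntegrableOn (fun t : ℝ => Complex.exp (-lam * t)
        • ∫ ξ, kernelApply (conjDiag U α) (conjDiag U β) S t g x ξ) (Set.Ioi 0) ∧
      orbitLaplace (semigroup (conjDiag U α) (conjDiag U β) S θ p) lam g x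
        = ∫ t in Set.Ioi (0 : ℝ), Complex.exp (-lam * t)
          • ∫ ξ, kernelApply (conjDiag U α) (conjDiag U β) S t g x ξ := by
  have := isLocallyFiniteMeasure_weightedMeasure hθ p
  have hexp : StronglyMeasurable fun q : ℝ × RSpace d => Complex.exp (-lam * (q.1 : ℂ)) := by
    have : Continuous fun q : ℝ × RSpace d => Complex.exp (-lam * (q.1 : ℂ)) := by fun_prop
    exact this.stronglyMeasurable
  have hf := hexp.smul
    (stronglyMeasurable_integral_kernelApply U α β S (Lp.stronglyMeasurable g))
  -- The sum of scalar kernels is the jointly measurable representative; it is identified with the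
  -- heat kernel for `t > 0` only, which suffices on `(0, ∞)`.
  have hker : ∀ t : ℝ, 0 < t → ∀ x, ∫ ξ, ∑ k, scalarKernel d (α k) (β k) t ‖rotation S t x - ξ‖
      • specProj U k (g ξ) = ∫ ξ, kernelApply (conjDiag U α) (conjDiag U β) S t g x ξ := by
    intro t ht x
    simp_rw [kernelApply_conjDiag U α β S (ne_zero_of_re_pos hα) ht]
  have h := ae_integral_Lp_eq hint hf ?_
  · rw [ae_weightedMeasure_iff hθ p] at h
    filter_upwards [h] with x hx
    have hEq : Set.EqOn (fun t : ℝ => Complex.exp (-lam * t) •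
        ∫ ξ, ∑ k, scalarKernel d (α k) (β k) t ‖rotation S t x - ξ‖ • specProj U k (g ξ))
        (fun t : ℝ => Complex.exp (-lam * t)
          • ∫ ξ, kernelApply (conjDiag U α) (conjDiag U β) S t g x ξ) (Set.Ioi 0) := by
      intro t ht
      simp only [hker t ht x]
    refine ⟨IntegrableOn.congr_fun hx.1 hEq measurableSet_Ioi, ?_⟩
    exact hx.2.trans (setIntegral_congr_fun measurableSet_Ioi hEq)
  · filter_upwards [ae_restrict_mem measurableSet_Ioi] with t ht
    filter_upwards [Lp.coeFn_smul (Complex.exp (-lam * t))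
      (semigroup (conjDiag U α) (conjDiag U β) S θ p t g),
      semigroup_coeFn (U := U) (β := β) hd hN hα hS hθ hp t g] with x h1 h2
    rw [h1, Pi.smul_apply, h2, semigroupFun, if_pos (Set.mem_Ioi.1 ht),
      ← hker t (Set.mem_Ioi.1 ht) x]
    rfl

end SemigroupOnLp

end OrnsteinUhlenbeck

/-! ### The resolvent theorem. -/

open OrnsteinUhlenbeck in
theorem corollary5p5 {d N : ℕ} (hd : 1 ≤ d) (hN : 1 ≤ N)
    (A B Y : Matrix (Fin N) (Fin N) ℂ) (S : Matrix (Fin d) (Fin d) ℝ)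
    -- `A` and `B` are simultaneously diagonalizable with transformation matrix `Y`
    (hY : IsUnit Y) (hYA : (Y⁻¹ * A * Y).IsDiag) (hYB : (Y⁻¹ * B * Y).IsDiag)
    -- `Re σ(A) > 0`
    (hA : ∀ z ∈ spectrum ℂ A, 0 < z.re)
    -- `S` is skew-symmetric
    (hS : S.transpose = -S)
    (p : ℝ≥0∞) [Fact (1 ≤ p)] (hp : p ≠ ∞)
    (θ : RSpace d → ℝ) (η Cθ : ℝ) (hθ : IsRadialWeight θ η Cθ) (hθc : TranslationContinuous θ)
    (ε : ℝ) (hε : 0 < ε) (lam : ℂ) (hlam : omegaConst A B η p ε < lam.re) :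
    -- the operators `T(t)` are well defined on `L^p_θ`
    (∀ v : LpTheta N θ p,
      (∀ t : ℝ, 0 < t → ∀ x, Integrable (kernelApply A B S t v x) volume) ∧
      (∀ t : ℝ, 0 ≤ t → MemLp (semigroupFun A B S t v) p (weightedMeasure θ p))) ∧
    -- constants `C_*` exist
    (∃ Cstar : ℝ, IsAdmissibleConst d A η p ε Cstar) ∧
    lam ∈ generatorResolventSet (semigroup A B S θ p) ∧
    ∀ g : LpTheta N θ p, ∃ v : LpTheta N θ p,
      -- `v` is the unique solution of the resolvent equation in the domain
      (v ∈ generatorDomain (semigroup A B S θ p) ∧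
        lam • v - generator (semigroup A B S θ p) v = g) ∧
      (∀ w ∈ generatorDomain (semigroup A B S θ p),
        lam • w - generator (semigroup A B S θ p) w = g → w = v) ∧
      v = generatorResolvent (semigroup A B S θ p) lam g ∧
      -- the integral expression, as an integral in `L^p_θ`
      IntegrableOn (fun t : ℝ => Complex.exp (-lam * t) • semigroup A B S θ p t g)
        (Set.Ioi 0) volume ∧
      v = ∫ t in Set.Ioi (0 : ℝ), Complex.exp (-lam * t) • semigroup A B S θ p t g ∧
      -- the integral expression in terms of the heat kernel, at almost every point
      (∀ᵐ x : RSpace d,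
        IntegrableOn (fun t : ℝ => Complex.exp (-lam * t) • ∫ ξ, kernelApply A B S t g x ξ)
          (Set.Ioi 0) volume ∧
        v x = ∫ t in Set.Ioi (0 : ℝ),
          Complex.exp (-lam * t) • ∫ ξ, kernelApply A B S t g x ξ) ∧
      -- the resolvent estimate
      ∀ Cstar : ℝ, IsAdmissibleConst d A η p ε Cstar →
        ‖v‖ ≤ MConst d A Y Cθ Cstar / (lam.re - omegaConst A B η p ε) * ‖g‖ := by
  obtain ⟨U, rfl⟩ := hY
  obtain ⟨α, rfl⟩ := exists_conjDiag_of_isDiag U A hYA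
  obtain ⟨β, rfl⟩ := exists_conjDiag_of_isDiag U B hYB
  have hα : ∀ k, 0 < (α k).re := fun k => hA _ (by rw [spectrum_conjDiag]; exact ⟨k, rfl⟩)
  have hp1 : 1 ≤ p := Fact.out
  obtain ⟨C₀, hC₀⟩ : ∃ C, IsAdmissibleConst d (conjDiag U α) η p ε C :=
    ⟨_, isAdmissibleConst_of_pos hd _ (lowerAbscissa_pos U α hN hα) η hε⟩
  have hT := isBoundedC0Semigroup (β := β) hd hN hα hS hθ hp hC₀
  refine ⟨fun v => ⟨fun t ht x => integrable_kernelApply hN hα hθ hp1 hp (Lp.memLp v) ht x,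
    fun t _ => memLp_semigroupFun hd hN hα hS hθ hp1 hp (Lp.stronglyMeasurable v) (Lp.memLp v) t⟩,
    ⟨C₀, hC₀⟩, hT.bijOn_shiftedGenerator hlam, fun g => ?_⟩
  have hint := hT.integrableOn_orbit hlam g
  refine ⟨orbitLaplace (semigroup (conjDiag U α) (conjDiag U β) S θ p) lam g,
    ⟨hT.orbitLaplace_mem_domain hlam g, hT.shiftedGenerator_orbitLaplace hlam g⟩,
    fun w hw hwg => ?_, hT.orbitLaplace_eq_generatorResolvent hlam g, hint, rfl,
    ae_orbitLaplace_eq hd hN hα hS hθ hp g hint, fun Cstar hC => ?_⟩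
  · rw [← hwg]
    exact (hT.orbitLaplace_shiftedGenerator hlam hw).symm
  -- The solution does not depend on `C_*`, so each admissible constant gives its own growth bound
  -- and hence its own resolvent estimate.
  · exact (isBoundedC0Semigroup (β := β) hd hN hα hS hθ hp hC).norm_orbitLaplace_le hlam g
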